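/- Let $\varepsilon_1,\varepsilon_2,\dots$ be i.i.d. with mean $0$, variance $\sigma_0^2\in(0,\infty)$ and finite fourth moments. Let $u_t=0$ for $t\le 0$ and $u_t=\varphi_0u_{t-1}+\varepsilon_t$ for $t\ge1$, and let $x_t=\mu_0+u_t$, $t=1,\dots,T$, i.e. $x_t=\mu_0+\Delta_+^{-d_0}u_t$ with $d_0=0$. Let the parameter space $\Phi\subset(-1,1)$ be compact and convex with $\varphi_0$ in its interior. Put $c_1(\varphi)=1$ and $c_t(\varphi)=1-\varphi$ for $t\ge2$; let $\epsilon_1(\varphi,\mu)=x_1-\mu$ and $\epsilon_t(\varphi,\mu)=x_t-\varphi x_{t-1}-\mu c_t(\varphi)$ for $t\ge2$ be the residuals with $d$ set to zero, and let $L(\varphi,\mu)=\frac12\sum_{t=1}^T\epsilon_t(\varphi,\mu)^2$. Let $L^*(\varphi)=\min_\mu L(\varphi,\mu)$, $L^*_{\mu_0}(\varphi)=L(\varphi,\mu_0)$ and $L^*_m(\varphi)=\bigl(\sum_{t=1}^Tc_t(\varphi)^2\bigr)^{1/(T-1)}L^*(\varphi)$, and let $\hat\varphi$ (CSS, unknown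 level), $\hat\varphi_{\mu_0}$ (CSS, known level) and $\hat\varphi_m$ (MCSS) be minimisers over $\Phi$ of $L^*$, $L^*_{\mu_0}$ and $L^*_m$, respectively. Let $\omega_j(\varphi)=\varphi^j$ and $\phi(s;\varphi)=1-\varphi s=\sum_j\phi_j(\varphi)s^j$, let $b_i=\sum_{s=0}^{i-1}\omega_s(\varphi_0)\,\partial_\varphi\phi_{i-s}(\varphi_0)$ and $b'_i=\sum_{s=0}^{i-1}\omega_s(\varphi_0)\,\partial^2_\varphi\phi_{i-s}(\varphi_0)$, and put $A=\sum_{j\ge1}b_j^2$, $F=\sum_{i\ge1}b'_ib_i$, $G=2\sum_{k\ge1}\sum_{s\ge1}b_sb_{s+k}b_k$ and $C=3\sum_{i\ge1}b_ib'_i$. The approximate intrinsic bias $\mathcal B_T(\varphi_0)$ and the approximate unknown-level score bias $\mathcal S_T(\varphi_0)$ are defined by $$T\mathcal B_T(\varphi_0)=A^{-2}(G+F)-\tfrac12A^{-2}C,\qquad T\mathcal S_T(\varphi_0)=A^{-1}\,\frac{\partial_\varphi\phi(1;\varphi_0)}{\phi(1;\varphi_0)} .$$ Their exact counterparts for a sample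 of size $T$ are $$TS_T(\varphi_0)=-A^{-1}\sigma_0^{-2}E\bigl(\partial_\varphi L^*(\varphi_0)\bigr),\qquad TB_T(\varphi_0)=A^{-2}(G_T+F_T)-\tfrac12A^{-3}C_TA_T,$$ where, with $S_t^{(k)}=\partial_\varphi^k\epsilon_t(\varphi_0,\mu_0)$ and $M_{k,l}=\sigma_0^{-2}T^{-1/2}\sum_{t=1}^T\bigl(S_t^{(k)}S_t^{(l)}-E(S_t^{(k)}S_t^{(l)})\bigr)$, one sets $A_T=E(M_{0,1}^2)$, $F_T=E(M_{0,2}M_{0,1})$, $G_T=E(M_{1,1}M_{0,1})$ and $C_T=3\sigma_0^{-2}T^{-1}\sum_{t=1}^TE(S^{(1)}_tS^{(2)}_t)$. Then $$T\mathcal B_T(\varphi_0)=-2\varphi_0=\lim_{T\to\infty}TB_T(\varphi_0),\qquad T\mathcal S_T(\varphi_0)=-(1+\varphi_0)=\lim_{T\to\infty}TS_T(\varphi_0),$$ and, as $T\to\infty$, $$E(\hat\varphi)-\varphi_0=\mathcal S_T(\varphi_0)+\mathcal B_T(\varphi_0)+o(T^{-1}),\qquad E(\hat\varphi_{\mu_0})-\varphi_0=\mathcal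 B_T(\varphi_0)+o(T^{-1}),\qquad E(\hat\varphi_m)-\varphi_0=\mathcal B_T(\varphi_0)+o(T^{-1}).$$ In particular, the MCSS estimator has bias $-2\varphi_0/T+o(T^{-1})$. -/

import Mathlib

open MeasureTheory ProbabilityTheory Filter Asymptotics Set Topology

noncomputable section

namespace FracBias

/-! ### The process

Time runs over `ℕ`; every series is zero at times `t ≤ 0`, so only the indices `t ≥ 1` carry
information and the value of a sequence at `0` is never used. -/

/-- Coefficients of the binomial expansion `(1 - L)^(-a) = ∑ i, π_i(a) L^i`. -/
def fracCoeff (a : ℝ) : ℕ → ℝ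
  | 0 => 1
  | i + 1 => ((i : ℝ) + a) / ((i : ℝ) + 1) * fracCoeff a i

/-- The truncated fractional difference `Δ₊^ζ v_t = ∑_{i=0}^{t-1} π_i(-ζ) v_{t-i}`. -/
def fracDiff (ζ : ℝ) (v : ℕ → ℝ) (t : ℕ) : ℝ :=
  ∑ i ∈ Finset.range t, fracCoeff (-ζ) i * v (t - i)

/-- The AR(1) error `u_t = φ u_{t-1} + ε_t` for `t ≥ 1`, with `u_t = 0` for `t ≤ 0`. -/
def arError (φ : ℝ) (e : ℕ → ℝ) : ℕ → ℝ
  | 0 => 0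
  | t + 1 => φ * arError φ e t + e (t + 1)

/-- The observations `x_t = μ I(t ≥ 1) + Δ₊^{-d} u_t`, with AR(1) errors `u_t`. -/
def observation (d μ φ : ℝ) (e : ℕ → ℝ) (t : ℕ) : ℝ :=
  (if 1 ≤ t then μ else 0) + fracDiff (-d) (arError φ e) t

/-! ### Lag polynomials of the AR(1) model -/

/-- Coefficients `ω_j(φ)` of `ω(s;φ) = 1 / (1 - φ s)`. -/
def maCoeff (j : ℕ) (φ : ℝ) : ℝ := φ ^ j

/-- Coefficients `ϕ_j(φ)` of the inverse lag polynomial `ϕ(s;φ) = 1 - φ s`. -/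
def arCoeff (j : ℕ) (φ : ℝ) : ℝ := if j = 0 then 1 else if j = 1 then -φ else 0

/-- The inverse lag polynomial `ϕ(s;φ) = ∑_j ϕ_j(φ) s^j`. -/
def arPoly (s φ : ℝ) : ℝ := ∑' j : ℕ, arCoeff j φ * s ^ j

/-! ### Objective functions and estimators -/

/-- `ϕ(L;φ) Δ₊^d x_t`. -/
def filtered (d φ : ℝ) (x : ℕ → ℝ) (t : ℕ) : ℝ :=
  ∑ j ∈ Finset.range t, arCoeff j φ * fracDiff d x (t - j)

/-- `c_t(d,φ) = ϕ(L;φ) Δ₊^d I(t ≥ 1)`. -/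
def convCoeff (d φ : ℝ) (t : ℕ) : ℝ :=
  filtered d φ (fun s => if 1 ≤ s then 1 else 0) t

/-- The residual `ε_t(d,φ,μ) = ϕ(L;φ) Δ₊^d x_t - μ c_t(d,φ)`. -/
def cssResidual (d φ μ : ℝ) (x : ℕ → ℝ) (t : ℕ) : ℝ :=
  filtered d φ x t - μ * convCoeff d φ t

/-- The conditional sum of squares `L(d,φ,μ)` of a sample of size `T`. -/
def cssObj (T : ℕ) (x : ℕ → ℝ) (d φ μ : ℝ) : ℝ :=
  1 / 2 * ∑ t ∈ Finset.Icc 1 T, cssResidual d φ μ x t ^ 2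

/-- `∑_{t=1}^T c_t(d,φ)²`. -/
def sumSqCoeff (T : ℕ) (d φ : ℝ) : ℝ := ∑ t ∈ Finset.Icc 1 T, convCoeff d φ t ^ 2

/-- The CSS estimator of the level for fixed `(d,φ)`. -/
def levelEstimate (T : ℕ) (x : ℕ → ℝ) (d φ : ℝ) : ℝ :=
  (∑ t ∈ Finset.Icc 1 T, filtered d φ x t * convCoeff d φ t) / sumSqCoeff T d φ

/-- The profile CSS objective `L*(d,φ)` (unknown level). -/
def profileObj (T : ℕ) (x : ℕ → ℝ) (d φ : ℝ) : ℝ :=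
  cssObj T x d φ (levelEstimate T x d φ)

/-- The CSS objective `L*_{μ₀}(d,φ)` with known level `μ₀`. -/
def knownLevelObj (μ₀ : ℝ) (T : ℕ) (x : ℕ → ℝ) (d φ : ℝ) : ℝ :=
  cssObj T x d φ μ₀

/-- The modification term `m(d,φ) = (∑_{t=1}^T c_t²)^{1/(T-1)}`. -/
def modification (T : ℕ) (d φ : ℝ) : ℝ := sumSqCoeff T d φ ^ (1 / ((T : ℝ) - 1))

/-- The modified profile CSS objective `L*_m = m · L*`. -/
def modifiedObj (T : ℕ) (x : ℕ → ℝ) (d φ : ℝ) : ℝ :=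
  modification T d φ * profileObj T x d φ

variable {Ω : Type*} [MeasurableSpace Ω]

/-- The random variable `est` is a minimiser over the parameter set `Φ` of the random
objective `Q`. -/
def IsArgmin (P : Measure Ω) (Φ : Set ℝ) (Q : Ω → ℝ → ℝ) (est : Ω → ℝ) : Prop :=
  AEMeasurable est P ∧ ∀ᵐ w ∂P, est w ∈ Φ ∧ IsMinOn (Q w) Φ (est w)

/-- The bias `E(est) - φ₀`. -/
def bias (P : Measure Ω) (φ₀ : ℝ) (est : Ω → ℝ) : ℝ := (∫ w, est w ∂P) - φ₀

/-! ### Coefficients of the bias expressions (scalar parameter `φ`, memory parameter fixed) -/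

/-- `b_{φ i}(φ₀) = ∑_{s=0}^{i-1} ω_s(φ₀) D_φ ϕ_{i-s}(φ₀)`. -/
def b₁ (φ₀ : ℝ) (i : ℕ) : ℝ :=
  ∑ s ∈ Finset.range i, maCoeff s φ₀ * deriv (arCoeff (i - s)) φ₀

/-- `b_{φφ i}(φ₀) = ∑_{s=0}^{i-1} ω_s(φ₀) D_{φφ} ϕ_{i-s}(φ₀)`. -/
def b₂ (φ₀ : ℝ) (i : ℕ) : ℝ :=
  ∑ s ∈ Finset.range i, maCoeff s φ₀ * iteratedDeriv 2 (arCoeff (i - s)) φ₀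

/-- `A = ∑_{j≥1} b_{φ j}²`. -/
def coefA (φ₀ : ℝ) : ℝ := ∑' j : ℕ, b₁ φ₀ (j + 1) ^ 2

/-- `F = ∑_{i≥1} b_{φφ i} b_{φ i}`. -/
def coefF (φ₀ : ℝ) : ℝ := ∑' i : ℕ, b₂ φ₀ (i + 1) * b₁ φ₀ (i + 1)

/-- `G = ∑_{k≥1} ∑_{s≥1} (b_{φ s} b_{φ (s+k)} + b_{φ (s+k)} b_{φ s}) b_{φ k}`. -/
def coefG (φ₀ : ℝ) : ℝ :=
  ∑' k : ℕ, ∑' s : ℕ,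
    (b₁ φ₀ (s + 1) * b₁ φ₀ ((s + 1) + (k + 1)) + b₁ φ₀ ((s + 1) + (k + 1)) * b₁ φ₀ (s + 1)) *
      b₁ φ₀ (k + 1)

/-- `C₀`, the sum of the three (for a scalar parameter equal) sums `∑_{i≥1} b_{φ i} b_{φφ i}`. -/
def coefC (φ₀ : ℝ) : ℝ :=
  (∑' i : ℕ, b₁ φ₀ (i + 1) * b₂ φ₀ (i + 1)) + (∑' i : ℕ, b₁ φ₀ (i + 1) * b₂ φ₀ (i + 1)) +
    ∑' i : ℕ, b₁ φ₀ (i + 1) * b₂ φ₀ (i + 1)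

/-- The approximate intrinsic bias `𝓑_T(φ₀)`. -/
def approxIntrinsicBias (φ₀ : ℝ) (T : ℕ) : ℝ :=
  (T : ℝ)⁻¹ *
    ((coefA φ₀)⁻¹ * ((coefA φ₀)⁻¹ * (coefG φ₀ + coefF φ₀)) -
      1 / 2 * (coefA φ₀)⁻¹ * (((coefA φ₀)⁻¹ * coefC φ₀ * (coefA φ₀)⁻¹) * coefA φ₀))

/-- The approximate (unknown-level) score bias `𝓢_T(φ₀)`, where
`T 𝓢_T(φ₀) = A⁻¹ D_φ ϕ(1;φ₀) / ϕ(1;φ₀)`. -/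
def approxScoreBias (φ₀ : ℝ) (T : ℕ) : ℝ :=
  (T : ℝ)⁻¹ * ((coefA φ₀)⁻¹ * (deriv (arPoly 1) φ₀ / arPoly 1 φ₀))

/-! ### Exact biases

These are expectations at a fixed sample size `T`, with the memory parameter set to `0`. In them
`x w` is the path of the observations. -/

/-- The exact score bias `S_T(φ₀) = - A⁻¹ T⁻¹ σ₀⁻² E(D_φ L*(φ₀))`. -/
def exactScoreBias (P : Measure Ω) (x : Ω → ℕ → ℝ) (σ₀ φ₀ : ℝ) (T : ℕ) : ℝ :=
  -((coefA φ₀)⁻¹ * (T : ℝ)⁻¹ *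
    ((σ₀ ^ 2)⁻¹ * ∫ w, deriv (fun φ => profileObj T (x w) 0 φ) φ₀ ∂P))

/-- The `k`-th `φ`-derivative at `φ₀` of the residual at the true level. -/
def residualDeriv (k : ℕ) (x : Ω → ℕ → ℝ) (μ₀ φ₀ : ℝ) (t : ℕ) (w : Ω) : ℝ :=
  iteratedDeriv k (fun φ => cssResidual 0 φ μ₀ (x w) t) φ₀

/-- Centred product moment
`M_{k,l} = σ₀⁻² T^{-1/2} ∑_{t=1}^T (S_t^{(k)} S_t^{(l)} - E(S_t^{(k)} S_t^{(l)}))` of the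
derivatives `S_t^{(k)}` of the residual. -/
def productMoment (P : Measure Ω) (x : Ω → ℕ → ℝ) (σ₀ μ₀ φ₀ : ℝ) (k l T : ℕ) (w : Ω) : ℝ :=
  (σ₀ ^ 2)⁻¹ * (Real.sqrt T)⁻¹ * ∑ t ∈ Finset.Icc 1 T,
    (residualDeriv k x μ₀ φ₀ t w * residualDeriv l x μ₀ φ₀ t w -
      ∫ w', residualDeriv k x μ₀ φ₀ t w' * residualDeriv l x μ₀ φ₀ t w' ∂P)

/-- `A_T`, the second moment of the centred score (known level). -/
def exactA (P : Measure Ω) (x : Ω → ℕ → ℝ) (σ₀ μ₀ φ₀ : ℝ) (T : ℕ) : ℝ :=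
  ∫ w, productMoment P x σ₀ μ₀ φ₀ 0 1 T w ^ 2 ∂P

/-- `F_T = E(M_{0,φφ} M_{0,φ})`. -/
def exactF (P : Measure Ω) (x : Ω → ℕ → ℝ) (σ₀ μ₀ φ₀ : ℝ) (T : ℕ) : ℝ :=
  ∫ w, productMoment P x σ₀ μ₀ φ₀ 0 2 T w * productMoment P x σ₀ μ₀ φ₀ 0 1 T w ∂P

/-- `G_T = E(M_{φ,φ} M_{0,φ})`. -/
def exactG (P : Measure Ω) (x : Ω → ℕ → ℝ) (σ₀ μ₀ φ₀ : ℝ) (T : ℕ) : ℝ :=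
  ∫ w, productMoment P x σ₀ μ₀ φ₀ 1 1 T w * productMoment P x σ₀ μ₀ φ₀ 0 1 T w ∂P

/-- `C_T = 3 σ₀⁻² T⁻¹ ∑_{t=1}^T E(S_{φ t} S_{φφ t})`. -/
def exactC (P : Measure Ω) (x : Ω → ℕ → ℝ) (σ₀ μ₀ φ₀ : ℝ) (T : ℕ) : ℝ :=
  3 * ((σ₀ ^ 2)⁻¹ * (T : ℝ)⁻¹ * ∑ t ∈ Finset.Icc 1 T,
    ∫ w, residualDeriv 1 x μ₀ φ₀ t w * residualDeriv 2 x μ₀ φ₀ t w ∂P)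

/-- The exact intrinsic bias `B_T(φ₀)`. -/
def exactIntrinsicBias (P : Measure Ω) (x : Ω → ℕ → ℝ) (σ₀ μ₀ φ₀ : ℝ) (T : ℕ) : ℝ :=
  (T : ℝ)⁻¹ *
    ((coefA φ₀)⁻¹ * ((coefA φ₀)⁻¹ * (exactG P x σ₀ μ₀ φ₀ T + exactF P x σ₀ μ₀ φ₀ T)) -
      1 / 2 * (coefA φ₀)⁻¹ *
        (((coefA φ₀)⁻¹ * exactC P x σ₀ μ₀ φ₀ T * (coefA φ₀)⁻¹) * exactA P x σ₀ μ₀ φ₀ T))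

end FracBias

end

/-!
With `θ = φ - φ₀`, `V = ∑ ε_t u_{t-1}` and `W = ∑ u_{t-1}²`, each of the three objective functions is,
up to a positive factor and a constant, of the form `W θ² / 2 - V θ - R(φ)`. Here `R = 0` for the
known level. For the unknown level, `R` is half of what concentrating out the level takes off the
sum of squares. For MCSS, this is diminished by the product of the relative change of the
modification term, which is `O(1 / T)`, and the profile objective, which is `O(T)`. In every case `R`
and its first two derivatives are bounded on the parameter set by a random variable that is bounded
in `L²` (`IsInnovation.exists_c2Bound_sampleGain`, `IsInnovation.exists_c2Bound_modifiedGain`). A minimiser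
inside the parameter set therefore solves `W θ = V + R'(φ₀) + O(|θ|)`, and a minimiser anywhere has
`W |θ| ≤ 2 (|V| + O(1))` (`approxRoot_of_isMinOn`).

Write `W = T A + Y` with `A = σ₀² / (1 - φ₀²)`. Inserting the first order condition into itself gives
`T θ = V / A + R'(φ₀) / A - Y V / (T A²) + remainder`, where the critical term of the
remainder is of order `Y² |θ| / T`. Fourth moments yield that `V² / T` and `Y² / T` are uniformly
integrable (`SqUI`), and no more. This is enough, for two reasons. The event that `θ` is not small has probability
`o(1 / T)` by the sharpened Chebyshev inequality `SqUI.tendsto_mul_measure`, so that boundedness of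
the parameter set controls it; and off this event `Y² |θ| / T` is small in mean. Hence
`T E θ → lim E R'(φ₀) / A - ν / A²` with `ν = lim E (Y V) / T`
(`tendsto_mul_integral_of_approxRoot`).

The limits come from `(1 - φ₀²) W = 2 φ₀ V + ∑ ε_t² - u_T²` and
`(1 - φ₀) ∑_{t < T} u_t = ∑ ε_t - u_T`: the former gives `ν = 2 φ₀ A²`, the latter
`lim E R'(φ₀) = -σ₀² / (1 - φ₀)` for the unknown level, and the modification cancels this limit.
-/

namespace FracBias

set_option linter.unusedSectionVars false

/-! ### The coefficients of the bias expressions -/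

theorem arCoeff_zero : arCoeff 0 = fun _ => 1 := by
  funext φ; simp [arCoeff]

theorem arCoeff_one : arCoeff 1 = fun φ => -φ := by
  funext φ; simp [arCoeff]

theorem arCoeff_add_two (j : ℕ) : arCoeff (j + 2) = fun _ => 0 := by
  funext φ; simp [arCoeff]

theorem arCoeff_of_two_le {j : ℕ} (hj : 2 ≤ j) : arCoeff j = fun _ => 0 := by
  obtain ⟨k, rfl⟩ := Nat.exists_eq_add_of_le' hj
  exact arCoeff_add_two k

theorem b₁_succ (φ : ℝ) (i : ℕ) : b₁ φ (i + 1) = -φ ^ i := by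
  rw [b₁, Finset.sum_range_succ, Finset.sum_eq_zero]
  · simp [maCoeff, arCoeff_one]
  · intro s hs
    rw [arCoeff_of_two_le (by have := Finset.mem_range.1 hs; omega)]
    simp

theorem b₂_eq_zero (φ : ℝ) (i : ℕ) : b₂ φ i = 0 := by
  refine Finset.sum_eq_zero fun s hs => ?_
  have h : iteratedDeriv 2 (arCoeff (i - s)) φ = 0 := by
    have hs' := Finset.mem_range.1 hs
    rcases Nat.lt_or_ge (i - s) 2 with h2 | h2
    · have h1 : i - s = 1 := by omega
      rw [h1, arCoeff_one, iteratedDeriv_succ, iteratedDeriv_one]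
      have : deriv (fun φ : ℝ => -φ) = fun _ => -1 := by funext x; simp
      simp [this]
    · rw [arCoeff_of_two_le h2, iteratedDeriv_succ, iteratedDeriv_one]
      simp
  rw [h, mul_zero]

theorem coefA_eq {φ : ℝ} (hφ : |φ| < 1) : coefA φ = (1 - φ ^ 2)⁻¹ := by
  have h2 : φ ^ 2 < 1 := (sq_lt_one_iff_abs_lt_one φ).2 hφ
  rw [coefA, ← tsum_geometric_of_lt_one (sq_nonneg φ) h2]
  refine tsum_congr fun j => ?_
  rw [b₁_succ]; ring

theorem coefF_eq (φ : ℝ) : coefF φ = 0 := by simp [coefF, b₂_eq_zero]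

theorem coefC_eq (φ : ℝ) : coefC φ = 0 := by simp [coefC, b₂_eq_zero]

theorem coefG_eq {φ : ℝ} (hφ : |φ| < 1) : coefG φ = -2 * φ * ((1 - φ ^ 2)⁻¹) ^ 2 := by
  have h2 : φ ^ 2 < 1 := (sq_lt_one_iff_abs_lt_one φ).2 hφ
  have h (k : ℕ) : ∑' s : ℕ,
      (b₁ φ (s + 1) * b₁ φ ((s + 1) + (k + 1)) + b₁ φ ((s + 1) + (k + 1)) * b₁ φ (s + 1)) *
        b₁ φ (k + 1) = (-2 * φ * (1 - φ ^ 2)⁻¹) * (φ ^ 2) ^ k := by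
    rw [← tsum_geometric_of_lt_one (sq_nonneg φ) h2, mul_right_comm, ← tsum_mul_left]
    refine tsum_congr fun s => ?_
    rw [b₁_succ, b₁_succ, show s + 1 + (k + 1) = (s + k + 1) + 1 by ring, b₁_succ]
    ring
  rw [coefG, tsum_congr h, tsum_mul_left, tsum_geometric_of_lt_one (sq_nonneg φ) h2]
  ring

theorem arPoly_one (φ : ℝ) : arPoly 1 φ = 1 - φ := by
  rw [arPoly, tsum_eq_sum (s := Finset.range 2)]
  · simp [Finset.sum_range_succ, arCoeff_zero, arCoeff_one, sub_eq_add_neg]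
  · intro j hj
    rw [arCoeff_of_two_le (by rw [Finset.mem_range] at hj; omega), zero_mul]

theorem deriv_arPoly_one (φ : ℝ) : deriv (arPoly 1) φ = -1 := by
  have : arPoly 1 = fun φ => 1 - φ := funext arPoly_one
  rw [this]; simp

theorem one_sub_sq_pos {φ : ℝ} (hφ : |φ| < 1) : 0 < 1 - φ ^ 2 := by
  have := (sq_lt_one_iff_abs_lt_one φ).2 hφ
  linarith

theorem mul_approxIntrinsicBias {φ : ℝ} (hφ : |φ| < 1) {T : ℕ} (hT : 1 ≤ T) :
    (T : ℝ) * approxIntrinsicBias φ T = -2 * φ := by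
  have h1 := (one_sub_sq_pos hφ).ne'
  have hT' : (T : ℝ) ≠ 0 := by positivity
  rw [approxIntrinsicBias, coefA_eq hφ, coefG_eq hφ, coefF_eq, coefC_eq]
  field_simp
  ring

theorem mul_approxScoreBias {φ : ℝ} (hφ : |φ| < 1) {T : ℕ} (hT : 1 ≤ T) :
    (T : ℝ) * approxScoreBias φ T = -(1 + φ) := by
  have h1 : 1 - φ ≠ 0 := by have := (abs_lt.1 hφ).2; linarith
  have hT' : (T : ℝ) ≠ 0 := by positivity
  rw [approxScoreBias, coefA_eq hφ, deriv_arPoly_one, arPoly_one]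
  field_simp
  ring

/-! ### The objective functions without differencing -/

theorem fracCoeff_zero_succ (i : ℕ) : fracCoeff 0 (i + 1) = 0 := by
  induction i with
  | zero => simp [fracCoeff]
  | succ i ih => rw [fracCoeff, ih, mul_zero]

theorem fracDiff_zero_succ (v : ℕ → ℝ) (t : ℕ) : fracDiff 0 v (t + 1) = v (t + 1) := by
  rw [fracDiff, neg_zero, Finset.sum_range_succ', Finset.sum_eq_zero]
  · simp [fracCoeff]
  · intro i _
    rw [fracCoeff_zero_succ, zero_mul]

theorem filtered_zero_one (φ : ℝ) (x : ℕ → ℝ) : filtered 0 φ x 1 = x 1 := by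
  simp [filtered, arCoeff_zero, fracDiff_zero_succ]

theorem filtered_zero_add_two (φ : ℝ) (x : ℕ → ℝ) (t : ℕ) :
    filtered 0 φ x (t + 2) = x (t + 2) - φ * x (t + 1) := by
  rw [filtered, Finset.sum_range_succ', Finset.sum_range_succ', Finset.sum_eq_zero]
  · simp only [zero_add, arCoeff_zero, arCoeff_one, Nat.sub_zero]
    rw [show t + 2 - 1 = t + 1 by omega, fracDiff_zero_succ, fracDiff_zero_succ]
    ring
  · intro j _
    rw [arCoeff_add_two, zero_mul]

theorem convCoeff_zero_one (φ : ℝ) : convCoeff 0 φ 1 = 1 := by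
  simp [convCoeff, filtered_zero_one]

theorem convCoeff_zero_add_two (φ : ℝ) (t : ℕ) : convCoeff 0 φ (t + 2) = 1 - φ := by
  simp [convCoeff, filtered_zero_add_two]

theorem sum_Icc_one_eq (f : ℕ → ℝ) (T : ℕ) :
    ∑ t ∈ Finset.Icc 1 T, f t = ∑ s ∈ Finset.range T, f (s + 1) := by
  rw [Finset.range_eq_Ico, Finset.sum_Ico_add' f 0 T 1]
  rfl

theorem sumSqCoeff_zero_succ (φ : ℝ) (n : ℕ) :
    sumSqCoeff (n + 1) 0 φ = 1 + n * (1 - φ) ^ 2 := by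
  rw [sumSqCoeff, sum_Icc_one_eq, Finset.sum_range_succ']
  simp only [zero_add, convCoeff_zero_one, add_assoc, one_add_one_eq_two, convCoeff_zero_add_two]
  simp [add_comm]

theorem observation_zero_succ (μ φ : ℝ) (e : ℕ → ℝ) (t : ℕ) :
    observation 0 μ φ e (t + 1) = μ + arError φ e (t + 1) := by
  rw [observation, neg_zero, fracDiff_zero_succ]
  simp

theorem filtered_observation {μ φ₀ : ℝ} {e x : ℕ → ℝ} (hx : ∀ t, x t = observation 0 μ φ₀ e t)
    (φ : ℝ) (t : ℕ) : filtered 0 φ x (t + 1) =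
      μ * convCoeff 0 φ (t + 1) + (e (t + 1) - (φ - φ₀) * arError φ₀ e t) := by
  cases t with
  | zero =>
    rw [filtered_zero_one, convCoeff_zero_one, hx, observation_zero_succ]
    simp [arError]
  | succ t =>
    rw [filtered_zero_add_two, convCoeff_zero_add_two, hx, hx, observation_zero_succ,
      observation_zero_succ, arError]
    ring

/-- At the true level the residual is affine in `φ`. -/
theorem cssResidual_observation {μ φ₀ : ℝ} {e x : ℕ → ℝ}
    (hx : ∀ t, x t = observation 0 μ φ₀ e t) (φ : ℝ) (t : ℕ) :
    cssResidual 0 φ μ x (t + 1) = e (t + 1) - (φ - φ₀) * arError φ₀ e t := by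
  rw [cssResidual, filtered_observation hx]
  ring

theorem knownLevelObj_observation {μ φ₀ : ℝ} {e x : ℕ → ℝ}
    (hx : ∀ t, x t = observation 0 μ φ₀ e t) (T : ℕ) (φ : ℝ) :
    knownLevelObj μ T x 0 φ = 1 / 2 * (∑ s ∈ Finset.range T, e (s + 1) ^ 2) +
      (1 / 2 * (∑ s ∈ Finset.range T, arError φ₀ e s ^ 2) * (φ - φ₀) ^ 2 -
      (∑ s ∈ Finset.range T, e (s + 1) * arError φ₀ e s) * (φ - φ₀)) := by
  rw [knownLevelObj, cssObj, sum_Icc_one_eq]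
  simp only [cssResidual_observation hx, Finset.mul_sum, Finset.sum_mul]
  rw [← Finset.sum_sub_distrib, ← Finset.sum_add_distrib]
  refine Finset.sum_congr rfl fun s _ => ?_
  ring

/-- The inner product `∑ c_t(φ) ε_t(φ, μ₀)` of the residuals with the coefficients of the level. -/
theorem sum_residual_mul_convCoeff (φ₀ : ℝ) (e : ℕ → ℝ) (φ : ℝ) (n : ℕ) :
    ∑ s ∈ Finset.range (n + 1), (e (s + 1) - (φ - φ₀) * arError φ₀ e s) * convCoeff 0 φ (s + 1) =
      φ * arError φ₀ e 1 + (1 - φ) * arError φ₀ e (n + 1) +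
        (1 - φ) ^ 2 * ∑ s ∈ Finset.range (n + 1), arError φ₀ e s := by
  induction n with
  | zero => simp [convCoeff_zero_one, arError]; ring
  | succ n ih =>
    rw [Finset.sum_range_succ, ih, convCoeff_zero_add_two, Finset.sum_range_succ _ (n + 1)]
    have h : arError φ₀ e (n + 1 + 1) = φ₀ * arError φ₀ e (n + 1) + e (n + 1 + 1) := rfl
    rw [h]
    ring

theorem sum_sq_sub_mul_div {ι : Type*} (s : Finset ι) (a c : ι → ℝ) (hS : ∑ i ∈ s, c i ^ 2 ≠ 0) :
    ∑ i ∈ s, (a i - (∑ j ∈ s, a j * c j) / (∑ j ∈ s, c j ^ 2) * c i) ^ 2 =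
      ∑ i ∈ s, a i ^ 2 - (∑ j ∈ s, a j * c j) ^ 2 / ∑ j ∈ s, c j ^ 2 := by
  set S := ∑ j ∈ s, c j ^ 2 with hSd
  set B := ∑ j ∈ s, a j * c j with hB
  have h (i : ι) : (a i - B / S * c i) ^ 2 =
      a i ^ 2 - 2 * (B / S) * (a i * c i) + (B / S) ^ 2 * c i ^ 2 := by ring
  simp only [h, Finset.sum_add_distrib, Finset.sum_sub_distrib, ← Finset.mul_sum, ← hSd, ← hB]
  field_simp
  ring

theorem profileObj_observation {μ φ₀ : ℝ} {e x : ℕ → ℝ}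
    (hx : ∀ t, x t = observation 0 μ φ₀ e t) (n : ℕ) (φ : ℝ) :
    profileObj (n + 1) x 0 φ = knownLevelObj μ (n + 1) x 0 φ -
      1 / 2 * ((φ * arError φ₀ e 1 + (1 - φ) * arError φ₀ e (n + 1) +
        (1 - φ) ^ 2 * ∑ s ∈ Finset.range (n + 1), arError φ₀ e s) ^ 2 /
          (1 + n * (1 - φ) ^ 2)) := by
  have hS : sumSqCoeff (n + 1) 0 φ ≠ 0 := by
    rw [sumSqCoeff_zero_succ]; positivity
  have hS' : ∑ s ∈ Finset.range (n + 1), convCoeff 0 φ (s + 1) ^ 2 = sumSqCoeff (n + 1) 0 φ := by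
    rw [sumSqCoeff, sum_Icc_one_eq]
  have hl : levelEstimate (n + 1) x 0 φ = μ +
      (∑ s ∈ Finset.range (n + 1), (e (s + 1) - (φ - φ₀) * arError φ₀ e s) *
        convCoeff 0 φ (s + 1)) / sumSqCoeff (n + 1) 0 φ := by
    rw [levelEstimate, sum_Icc_one_eq, ← sub_eq_iff_eq_add', eq_comm]
    nth_rewrite 1 [← mul_div_cancel_right₀ μ hS]
    rw [← sub_div]
    congr 1
    rw [← hS', Finset.mul_sum, ← Finset.sum_sub_distrib]
    refine Finset.sum_congr rfl fun s _ => ?_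
    rw [filtered_observation hx]
    ring
  rw [← sum_residual_mul_convCoeff, ← sumSqCoeff_zero_succ, ← hS', profileObj, hl,
    knownLevelObj, cssObj, cssObj, sum_Icc_one_eq, sum_Icc_one_eq, ← mul_sub]
  simp only [cssResidual_observation hx]
  rw [← sum_sq_sub_mul_div _ _ _ (by rwa [hS'])]
  congr 1
  refine Finset.sum_congr rfl fun s _ => ?_
  rw [cssResidual, filtered_observation hx, hS']
  ring

/-! ### Weighted sums of innovations -/

/-- The sequence `e` consists of independent, identically distributed, centred innovations with
variance `σ²` and finite fourth moments. -/
structure IsInnovation {Ω : Type*} [MeasurableSpace Ω] (P : Measure Ω) (e : ℕ → Ω → ℝ) (σ : ℝ) :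
    Prop where
  meas : ∀ t, Measurable (e t)
  indep : iIndepFun e P
  ident : ∀ t, IdentDistrib (e t) (e 0) P P
  mom : MemLp (e 0) 4 P
  mean : ∫ w, e 0 w ∂P = 0
  var : ∫ w, e 0 w ^ 2 ∂P = σ ^ 2

/-- The σ-algebra generated by `e 0, …, e (t - 1)`. -/
@[reducible] def past {Ω : Type*} (e : ℕ → Ω → ℝ) (t : ℕ) : MeasurableSpace Ω :=
  ⨆ i ∈ Set.Iio t, MeasurableSpace.comap (e i) inferInstance

/-- The sum `∑_{s < T} g(e_s) h_s`; it is a martingale in `T` if `g(e_s)` is centred and each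
weight `h_s` depends on `e_0, …, e_{s-1}` only. -/
def weightedSum {Ω : Type*} (g : ℝ → ℝ) (h : ℕ → Ω → ℝ) (e : ℕ → Ω → ℝ) (T : ℕ) (w : Ω) : ℝ :=
  ∑ s ∈ Finset.range T, g (e s w) * h s w

section

variable {Ω : Type*} [mΩ : MeasurableSpace Ω] {P : Measure Ω} [IsProbabilityMeasure P]
  {e : ℕ → Ω → ℝ} {σ : ℝ}

theorem integrable_sq_of_pow_four {X : Ω → ℝ} (hX : Measurable X)
    (h : Integrable (fun w => X w ^ 4) P) : Integrable (fun w => X w ^ 2) P := by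
  refine ((integrable_const (1 : ℝ)).add h).mono' (hX.pow_const 2).aestronglyMeasurable
    (ae_of_all _ fun w => ?_)
  rw [Real.norm_of_nonneg (sq_nonneg _)]
  change _ ≤ 1 + X w ^ 4
  nlinarith [sq_nonneg (X w ^ 2 - 1), sq_nonneg (X w ^ 2)]

theorem memLp_two_of_pow_four {X : Ω → ℝ} (hX : Measurable X)
    (h : Integrable (fun w => X w ^ 4) P) : MemLp X 2 P :=
  (memLp_two_iff_integrable_sq hX.aestronglyMeasurable).2 (integrable_sq_of_pow_four hX h)

theorem integrable_mul_of_sq {X Y : Ω → ℝ} (hX : MemLp X 2 P) (hY : MemLp Y 2 P) :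
    Integrable (fun w => X w * Y w) P :=
  MemLp.integrable_mul hX hY

theorem past_le (he : ∀ t, Measurable (e t)) (t : ℕ) : past e t ≤ mΩ :=
  iSup₂_le fun i _ => (he i).comap_le

theorem past_mono {s t : ℕ} (h : s ≤ t) : past e s ≤ past e t :=
  biSup_mono fun _ hi => lt_of_lt_of_le hi h

theorem measurable_past_succ (t : ℕ) : Measurable[past e (t + 1)] (e t) :=
  (comap_measurable (e t)).mono
    (le_iSup₂_of_le (f := fun i (_ : i ∈ Set.Iio (t + 1)) =>
      MeasurableSpace.comap (e i) inferInstance) t (Nat.lt_succ_self t) le_rfl) le_rfl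

theorem measurable_weightedSum {g : ℝ → ℝ} {h : ℕ → Ω → ℝ} (hg : Measurable g)
    (hh : ∀ s, Measurable[past e s] (h s)) (T : ℕ) :
    Measurable[past e T] (weightedSum g h e T) := by
  have : weightedSum g h e T = fun w => ∑ s ∈ Finset.range T, g (e s w) * h s w := rfl
  rw [this]
  refine Finset.measurable_fun_sum _ fun s hs => ?_
  have hs' : s + 1 ≤ T := Finset.mem_range.1 hs
  exact (hg.comp ((measurable_past_succ s).mono (past_mono hs') le_rfl)).mul
    ((hh s).mono (past_mono (by omega)) le_rfl)

theorem weightedSum_succ (g : ℝ → ℝ) (h : ℕ → Ω → ℝ) (T : ℕ) (w : Ω) :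
    weightedSum g h e (T + 1) w = weightedSum g h e T w + g (e T w) * h T w :=
  Finset.sum_range_succ _ _

namespace IsInnovation

variable (H : IsInnovation P e σ)
include H

theorem indep_past (t : ℕ) :
    Indep (past e t) (MeasurableSpace.comap (e t) inferInstance) P := by
  have h := indep_iSup_of_disjoint (fun i => (H.meas i).comap_le) H.indep
    (S := Set.Iio t) (T := {t}) (by simp)
  simpa only [Set.mem_singleton_iff, iSup_iSup_eq_left] using h

theorem indepFun {X : Ω → ℝ} {g : ℝ → ℝ} {t : ℕ} (hX : Measurable[past e t] X)
    (hg : Measurable g) : IndepFun X (fun w => g (e t w)) P := by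
  rw [IndepFun_iff_Indep]
  refine indep_of_indep_of_le_right (indep_of_indep_of_le_left (H.indep_past t) hX.comap_le) ?_
  exact (hg.comp (comap_measurable (e t))).comap_le

theorem measurable {X : Ω → ℝ} {t : ℕ} (hX : Measurable[past e t] X) : Measurable X :=
  hX.mono (past_le H.meas t) le_rfl

theorem integral_comp {g : ℝ → ℝ} (hg : Measurable g) (t : ℕ) :
    ∫ w, g (e t w) ∂P = ∫ w, g (e 0 w) ∂P :=
  ((H.ident t).comp hg).integral_eq

theorem integrable_comp {g : ℝ → ℝ} (hg : Measurable g)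
    (h : Integrable (fun w => g (e 0 w)) P) (t : ℕ) : Integrable (fun w => g (e t w)) P :=
  ((H.ident t).comp hg).integrable_iff.2 h

theorem integrable_mul {X : Ω → ℝ} {g : ℝ → ℝ} {t : ℕ} (hX : Measurable[past e t] X)
    (hg : Measurable g) (hXi : Integrable X P) (hgi : Integrable (fun w => g (e 0 w)) P) :
    Integrable (fun w => X w * g (e t w)) P :=
  (H.indepFun hX hg).integrable_mul hXi (H.integrable_comp hg hgi t)

theorem integral_mul {X : Ω → ℝ} {g : ℝ → ℝ} {t : ℕ} (hX : Measurable[past e t] X)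
    (hg : Measurable g) :
    ∫ w, X w * g (e t w) ∂P = (∫ w, X w ∂P) * ∫ w, g (e 0 w) ∂P := by
  rw [← H.integral_comp hg t]
  exact (H.indepFun hX hg).integral_fun_mul_eq_mul_integral
    (H.measurable hX).aestronglyMeasurable (hg.comp (H.meas t)).aestronglyMeasurable

theorem memLp_two_mul {X : Ω → ℝ} {g : ℝ → ℝ} {t : ℕ} (hX : Measurable[past e t] X)
    (hg : Measurable g) (hX2 : MemLp X 2 P) (hg2 : MemLp (fun w => g (e 0 w)) 2 P) :
    MemLp (fun w => g (e t w) * X w) 2 P := by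
  refine (memLp_two_iff_integrable_sq (((hg.comp (H.meas t)).mul
    (H.measurable hX)).aestronglyMeasurable (f := fun w => g (e t w) * X w))).2 ?_
  refine (H.integrable_mul (X := fun w => X w ^ 2) (g := fun x => g x ^ 2) (hX.pow_const 2)
    (hg.pow_const 2) hX2.integrable_sq hg2.integrable_sq).congr (ae_of_all _ fun w => ?_)
  simp only
  ring

theorem memLp_weightedSum {g : ℝ → ℝ} {h : ℕ → Ω → ℝ} (hg : Measurable g)
    (hh : ∀ s, Measurable[past e s] (h s)) (hg2 : MemLp (fun w => g (e 0 w)) 2 P)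
    (hh2 : ∀ s, MemLp (h s) 2 P) (T : ℕ) : MemLp (weightedSum g h e T) 2 P :=
  memLp_finsetSum _ fun s _ => H.memLp_two_mul (hh s) hg (hh2 s) hg2

theorem integral_weightedSum {g : ℝ → ℝ} {h : ℕ → Ω → ℝ} (hg : Measurable g)
    (hh : ∀ s, Measurable[past e s] (h s)) (hg2 : MemLp (fun w => g (e 0 w)) 2 P)
    (hh2 : ∀ s, MemLp (h s) 2 P) (hg0 : ∫ w, g (e 0 w) ∂P = 0) (T : ℕ) :
    ∫ w, weightedSum g h e T w ∂P = 0 := by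
  unfold weightedSum
  rw [integral_finsetSum _ fun s _ =>
    (H.memLp_two_mul (hh s) hg (hh2 s) hg2).integrable one_le_two]
  refine Finset.sum_eq_zero fun s _ => ?_
  simp only [mul_comm (g _)]
  rw [H.integral_mul (hh s) hg, hg0, mul_zero]

/-- Orthogonality of martingale differences. -/
theorem integral_weightedSum_mul {g g' : ℝ → ℝ} {h h' : ℕ → Ω → ℝ}
    (hg : Measurable g) (hg' : Measurable g')
    (hh : ∀ s, Measurable[past e s] (h s)) (hh' : ∀ s, Measurable[past e s] (h' s))
    (hg2 : MemLp (fun w => g (e 0 w)) 2 P) (hg2' : MemLp (fun w => g' (e 0 w)) 2 P)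
    (hh2 : ∀ s, MemLp (h s) 2 P) (hh2' : ∀ s, MemLp (h' s) 2 P)
    (hg0 : ∫ w, g (e 0 w) ∂P = 0) (hg0' : ∫ w, g' (e 0 w) ∂P = 0) (T : ℕ) :
    ∫ w, weightedSum g h e T w * weightedSum g' h' e T w ∂P =
      (∫ w, g (e 0 w) * g' (e 0 w) ∂P) * ∑ s ∈ Finset.range T, ∫ w, h s w * h' s w ∂P := by
  induction T with
  | zero => simp [weightedSum]
  | succ T ih =>
    have hX := measurable_weightedSum hg hh T
    have hX' := measurable_weightedSum hg' hh' T
    have hX2 := H.memLp_weightedSum hg hh hg2 hh2 T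
    have hX2' := H.memLp_weightedSum hg' hh' hg2' hh2' T
    have i1 := integrable_mul_of_sq hX2 hX2'
    have i2 : Integrable (fun w => (weightedSum g h e T w * h' T w) * g' (e T w)) P :=
      H.integrable_mul (hX.mul (hh' T)) hg' (integrable_mul_of_sq hX2 (hh2' T))
        (hg2'.integrable one_le_two)
    have i3 : Integrable (fun w => (weightedSum g' h' e T w * h T w) * g (e T w)) P :=
      H.integrable_mul (hX'.mul (hh T)) hg (integrable_mul_of_sq hX2' (hh2 T))
        (hg2.integrable one_le_two)
    have i4 : Integrable (fun w => (h T w * h' T w) * (g (e T w) * g' (e T w))) P :=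
      H.integrable_mul (g := fun x => g x * g' x) ((hh T).mul (hh' T)) (hg.mul hg')
        (integrable_mul_of_sq (hh2 T) (hh2' T)) (integrable_mul_of_sq hg2 hg2')
    have e2 := H.integral_mul (hX.mul (hh' T)) hg'
    have e3 := H.integral_mul (hX'.mul (hh T)) hg
    have e4 := H.integral_mul (g := fun x => g x * g' x) ((hh T).mul (hh' T)) (hg.mul hg')
    simp only [Pi.mul_apply] at e2 e3 e4
    have hexp (w : Ω) : weightedSum g h e (T + 1) w * weightedSum g' h' e (T + 1) w =
        weightedSum g h e T w * weightedSum g' h' e T w +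
        (weightedSum g h e T w * h' T w) * g' (e T w) +
        (weightedSum g' h' e T w * h T w) * g (e T w) +
        (h T w * h' T w) * (g (e T w) * g' (e T w)) := by
      rw [weightedSum_succ, weightedSum_succ]; ring
    simp only [hexp]
    rw [integral_add (by exact (i1.add i2).add i3) i4, integral_add (by exact i1.add i2) i3,
      integral_add i1 i2,
      e2, e3, e4, hg0, hg0', ih, Finset.sum_range_succ]
    ring

theorem integrable_pow_four_weightedSum {g : ℝ → ℝ} {h : ℕ → Ω → ℝ}
    (hg : Measurable g) (hh : ∀ s, Measurable[past e s] (h s))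
    (hg4 : Integrable (fun w => g (e 0 w) ^ 4) P) (hh4 : ∀ s, Integrable (fun w => h s w ^ 4) P)
    (T : ℕ) : Integrable (fun w => weightedSum g h e T w ^ 4) P := by
  induction T with
  | zero => simp [weightedSum]
  | succ T ih =>
    have hX := H.measurable (measurable_weightedSum hg hh (T + 1))
    have i4 : Integrable (fun w => (h T w ^ 4) * (g (e T w) ^ 4)) P :=
      H.integrable_mul (X := fun w => h T w ^ 4) (g := fun x => g x ^ 4) ((hh T).pow_const 4)
        (hg.pow_const 4) (hh4 T) hg4
    refine ((ih.const_mul 8).add (i4.const_mul 8)).mono' (hX.pow_const 4).aestronglyMeasurable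
      (ae_of_all _ fun w => ?_)
    rw [Real.norm_of_nonneg (by positivity), weightedSum_succ]
    change _ ≤ 8 * weightedSum g h e T w ^ 4 + 8 * (h T w ^ 4 * g (e T w) ^ 4)
    refine (Even.add_pow_le (n := 4) (by decide)).trans (le_of_eq ?_)
    ring

set_option maxHeartbeats 1000000 in
/-- Fourth moments of martingale sums grow at most quadratically: by expansion,
`E X_{T+1}⁴ ≤ E X_T⁴ + O(E X_T² h_T²) + O(1)`, as the term of order `X_T³` is centred. -/
theorem exists_integral_pow_four_le {g : ℝ → ℝ} {h : ℕ → Ω → ℝ}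
    (hg : Measurable g) (hh : ∀ s, Measurable[past e s] (h s))
    (hg4 : Integrable (fun w => g (e 0 w) ^ 4) P) (hh4 : ∀ s, Integrable (fun w => h s w ^ 4) P)
    (hg0 : ∫ w, g (e 0 w) ∂P = 0) {B : ℝ} (hB : ∀ s, ∫ w, h s w ^ 4 ∂P ≤ B) :
    ∃ C, 0 ≤ C ∧ ∀ T : ℕ, ∫ w, weightedSum g h e T w ^ 4 ∂P ≤ C * (T : ℝ) ^ 2 := by
  set m₂ := ∫ w, g (e 0 w) ^ 2 ∂P with hm₂
  set m₄ := ∫ w, g (e 0 w) ^ 4 ∂P with hm₄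
  have hm₂0 : 0 ≤ m₂ := integral_nonneg fun w => sq_nonneg _
  have hm₄0 : 0 ≤ m₄ := integral_nonneg fun w => by positivity
  have hB0 : 0 ≤ B := (integral_nonneg fun w => by positivity).trans (hB 0)
  set β := 4 * m₂ + 1 with hβ
  have hβ0 : 0 < β := by positivity
  set C := 4 * m₂ * B * β + 3 * m₄ * B with hC
  have hC0 : 0 ≤ C := by positivity
  refine ⟨C, hC0, fun T => ?_⟩
  have hgm : Measurable fun w => g (e 0 w) := hg.comp (H.meas 0)
  have hg2 := memLp_two_of_pow_four hgm hg4
  induction T with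
  | zero => simp [weightedSum]
  | succ T ih =>
    have hXp := measurable_weightedSum hg hh T
    have hX := H.measurable hXp
    have hX4 := H.integrable_pow_four_weightedSum hg hh hg4 hh4 T
    have hX4' := H.integrable_pow_four_weightedSum hg hh hg4 hh4 (T + 1)
    have hhm := H.measurable (hh T)
    have j2 : Integrable (fun w => weightedSum g h e T w ^ 3 * h T w) P := by
      refine (hX4.add (hh4 T)).mono' ((hX.pow_const 3).mul hhm).aestronglyMeasurable
        (ae_of_all _ fun w => ?_)
      change |_| ≤ weightedSum g h e T w ^ 4 + h T w ^ 4
      generalize weightedSum g h e T w = a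
      generalize h T w = b
      rw [abs_le]
      constructor <;>
      nlinarith [sq_nonneg (a ^ 2 - a * b), sq_nonneg (a ^ 2 + a * b), sq_nonneg (a ^ 2 - b ^ 2),
        sq_nonneg (a ^ 2), sq_nonneg (b ^ 2)]
    have j3 : Integrable (fun w => weightedSum g h e T w ^ 2 * h T w ^ 2) P := by
      refine (hX4.add (hh4 T)).mono' ((hX.pow_const 2).mul
        (hhm.pow_const 2)).aestronglyMeasurable (ae_of_all _ fun w => ?_)
      change |_| ≤ weightedSum g h e T w ^ 4 + h T w ^ 4
      rw [abs_of_nonneg (by positivity)]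
      nlinarith [sq_nonneg (weightedSum g h e T w ^ 2 - h T w ^ 2),
        sq_nonneg (weightedSum g h e T w ^ 2), sq_nonneg (h T w ^ 2)]
    have m2 : Measurable[past e T] fun w => weightedSum g h e T w ^ 3 * h T w :=
      (hXp.pow_const 3).mul (hh T)
    have m3 : Measurable[past e T] fun w => weightedSum g h e T w ^ 2 * h T w ^ 2 :=
      (hXp.pow_const 2).mul ((hh T).pow_const 2)
    have m4 : Measurable[past e T] fun w => h T w ^ 4 := (hh T).pow_const 4
    have i2 := H.integrable_mul m2 hg j2 (hg2.integrable one_le_two)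
    have i3 := H.integrable_mul (g := fun x => g x ^ 2) m3 (hg.pow_const 2) j3 hg2.integrable_sq
    have i4 := H.integrable_mul (g := fun x => g x ^ 4) m4 (hg.pow_const 4) (hh4 T) hg4
    have e2 := H.integral_mul m2 hg
    have e3 := H.integral_mul (g := fun x => g x ^ 2) m3 (hg.pow_const 2)
    have e4 := H.integral_mul (g := fun x => g x ^ 4) m4 (hg.pow_const 4)
    have hint := integral_mono hX4' (((hX4.add (i2.const_mul 4)).add (i3.const_mul 8)).add
      (i4.const_mul 3)) (fun w => by
        change weightedSum g h e (T + 1) w ^ 4 ≤ weightedSum g h e T w ^ 4 +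
          4 * (weightedSum g h e T w ^ 3 * h T w * g (e T w)) +
          8 * (weightedSum g h e T w ^ 2 * h T w ^ 2 * g (e T w) ^ 2) +
          3 * (h T w ^ 4 * g (e T w) ^ 4)
        rw [weightedSum_succ]
        generalize weightedSum g h e T w = a
        generalize h T w = b
        generalize g (e T w) = c
        -- the term `4 a b³ c³` is absorbed by its neighbours, so third moments do not enter
        nlinarith [sq_nonneg (b * c * (a - b * c))])
    rw [integral_add' ((hX4.add (i2.const_mul 4)).add (i3.const_mul 8)) (i4.const_mul 3),
      integral_add' (hX4.add (i2.const_mul 4)) (i3.const_mul 8),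
      integral_add' hX4 (i2.const_mul 4), integral_const_mul, integral_const_mul,
      integral_const_mul, e2, e3, e4, hg0, ← hm₂, ← hm₄] at hint
    -- the weight `1 / (β (T + 1))` balances the two summands of Young's inequality
    have hcross : ∫ w, weightedSum g h e T w ^ 2 * h T w ^ 2 ∂P ≤
        1 / 2 * (1 / (β * (T + 1)) * ∫ w, weightedSum g h e T w ^ 4 ∂P) +
          1 / 2 * (β * (T + 1) * ∫ w, h T w ^ 4 ∂P) := by
      rw [← integral_const_mul, ← integral_const_mul, ← integral_const_mul, ← integral_const_mul,
        ← integral_add ((hX4.const_mul _).const_mul _) (((hh4 T).const_mul _).const_mul _)]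
      refine integral_mono j3 (((hX4.const_mul _).const_mul _).add
        (((hh4 T).const_mul _).const_mul _)) fun w => ?_
      simp only
      have hp : 0 < β * ((T : ℝ) + 1) := by positivity
      generalize β * ((T : ℝ) + 1) = r at hp
      generalize weightedSum g h e T w = a
      generalize h T w = b
      have : 0 ≤ 1 / (2 * r) * (a ^ 2 - r * b ^ 2) ^ 2 := by positivity
      have e : 1 / (2 * r) * (a ^ 2 - r * b ^ 2) ^ 2 =
        1 / 2 * (1 / r * a ^ 4) + 1 / 2 * (r * b ^ 4) - a ^ 2 * b ^ 2 := by
        field_simp; ring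
      linarith
    have h1 : 1 / (β * ((T : ℝ) + 1)) * ∫ w, weightedSum g h e T w ^ 4 ∂P ≤ C * T / β := by
      rw [div_mul_eq_mul_div, one_mul, div_le_div_iff₀ (by positivity) hβ0]
      have : C * (T : ℝ) ^ 2 ≤ C * T * (T + 1) := by nlinarith [mul_nonneg hC0 (Nat.cast_nonneg (α := ℝ) T)]
      nlinarith
    have h2 : β * ((T : ℝ) + 1) * ∫ w, h T w ^ 4 ∂P ≤ β * (T + 1) * B :=
      mul_le_mul_of_nonneg_left (hB T) (by positivity)
    have h3 : 4 * m₂ * (C * T / β) ≤ C * T := by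
      rw [mul_div_assoc', div_le_iff₀ hβ0]
      nlinarith [mul_nonneg hC0 (Nat.cast_nonneg (α := ℝ) T)]
    have h4 : (∫ w, h T w ^ 4 ∂P) * m₄ ≤ B * m₄ := mul_le_mul_of_nonneg_right (hB T) hm₄0
    have h5 : 8 * ((∫ w, weightedSum g h e T w ^ 2 * h T w ^ 2 ∂P) * m₂) ≤
        4 * m₂ * (C * T / β) + 4 * m₂ * (β * (T + 1) * B) := by nlinarith
    push_cast
    have h6 : C * (T + 1) = 4 * m₂ * (β * (T + 1) * B) + 3 * m₄ * B * (T + 1) := by rw [hC]; ring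
    have h7 : 3 * (B * m₄) ≤ 3 * m₄ * B * (T + 1) := by
      nlinarith [mul_nonneg (mul_nonneg hB0 hm₄0) (Nat.cast_nonneg (α := ℝ) T)]
    clear_value C β m₂ m₄
    have h8 : C * ((T : ℝ) + 1) ^ 2 = C * (T : ℝ) ^ 2 + C * T + C * (T + 1) := by ring
    linarith

end IsInnovation

end

/-! ### Uniform integrability of normalised squares -/

/-- The family `X_T` is bounded in `L²` for large `T`. -/
structure L2Bounded {Ω : Type*} [MeasurableSpace Ω] (P : Measure Ω) (X : ℕ → Ω → ℝ) : Prop where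
  memLp : ∀ T, MemLp (X T) 2 P
  bdd : ∃ C, ∀ᶠ T : ℕ in atTop, ∫ w, X T w ^ 2 ∂P ≤ C

/-- The family `X_T² / T` is bounded in `L¹` and uniformly integrable, both for large `T`. -/
structure SqUI {Ω : Type*} [MeasurableSpace Ω] (P : Measure Ω) (X : ℕ → Ω → ℝ) : Prop where
  memLp : ∀ T, MemLp (X T) 2 P
  bdd : ∃ C, ∀ᶠ T : ℕ in atTop, ∫ w, X T w ^ 2 ∂P ≤ C * T
  unif : ∀ η > 0, ∃ δ > 0, ∀ᶠ T : ℕ in atTop, ∀ s, MeasurableSet s → P.real s ≤ δ →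
    ∫ w in s, X T w ^ 2 ∂P ≤ η * T

section

variable {Ω : Type*} [mΩ : MeasurableSpace Ω] {P : Measure Ω} [IsProbabilityMeasure P]
  {e : ℕ → Ω → ℝ} {σ φ : ℝ}

theorem SqUI.of_approx {X : ℕ → Ω → ℝ} (hX : ∀ T, MemLp (X T) 2 P)
    (h : ∀ η > 0, ∃ Y : ℕ → Ω → ℝ, SqUI P Y ∧
      ∀ᶠ T : ℕ in atTop, ∫ w, (X T w - Y T w) ^ 2 ∂P ≤ η * T) : SqUI P X := by
  have key {Y : ℕ → Ω → ℝ} (hY : SqUI P Y) (T : ℕ) (s : Set Ω) :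
      ∫ w in s, X T w ^ 2 ∂P ≤
        2 * (∫ w in s, Y T w ^ 2 ∂P) + 2 * ∫ w, (X T w - Y T w) ^ 2 ∂P := by
    have i1 := ((hX T).sub (hY.memLp T)).integrable_sq
    have i2 := (hY.memLp T).integrable_sq
    have i3 := (hX T).integrable_sq
    have h1 : ∫ w in s, (X T w - Y T w) ^ 2 ∂P ≤ ∫ w, (X T w - Y T w) ^ 2 ∂P :=
      setIntegral_le_integral i1 (ae_of_all _ fun w => sq_nonneg _)
    have h2 : ∫ w in s, X T w ^ 2 ∂P ≤
        ∫ w in s, (2 * Y T w ^ 2 + 2 * (X T w - Y T w) ^ 2) ∂P := by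
      refine integral_mono i3.integrableOn
        ((i2.integrableOn.const_mul 2).add (i1.integrableOn.const_mul 2)) fun w => ?_
      change X T w ^ 2 ≤ 2 * Y T w ^ 2 + 2 * (X T w - Y T w) ^ 2
      nlinarith [sq_nonneg (X T w - 2 * Y T w)]
    rw [integral_add (i2.integrableOn.const_mul 2) (by exact i1.integrableOn.const_mul 2),
      integral_const_mul, integral_const_mul] at h2
    linarith
  refine ⟨hX, ?_, fun η hη => ?_⟩
  · obtain ⟨Y, hY, hXY⟩ := h 1 one_pos
    obtain ⟨C, hC⟩ := hY.bdd
    refine ⟨2 * C + 2, ?_⟩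
    filter_upwards [hXY, hC] with T h1 h2
    have := key hY T univ
    simp only [setIntegral_univ] at this
    nlinarith
  · obtain ⟨Y, hY, hXY⟩ := h (η / 4) (by positivity)
    obtain ⟨δ, hδ, hu⟩ := hY.unif (η / 4) (by positivity)
    refine ⟨δ, hδ, ?_⟩
    filter_upwards [hXY, hu] with T h1 h2 s hs hPs
    have h3 := key hY T s
    have h4 := h2 s hs hPs
    linarith

theorem SqUI.const_mul {X : ℕ → Ω → ℝ} (hX : SqUI P X) (c : ℝ) :
    SqUI P fun T w => c * X T w := by
  refine ⟨fun T => (hX.memLp T).const_mul c, ?_, fun η hη => ?_⟩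
  · obtain ⟨C, hC⟩ := hX.bdd
    refine ⟨c ^ 2 * C, ?_⟩
    filter_upwards [hC] with T h
    simp only [mul_pow, integral_const_mul]
    rw [mul_assoc]
    exact mul_le_mul_of_nonneg_left h (sq_nonneg c)
  · obtain ⟨δ, hδ, hu⟩ := hX.unif (η / (c ^ 2 + 1)) (by positivity)
    refine ⟨δ, hδ, ?_⟩
    filter_upwards [hu] with T h s hs hPs
    simp only [mul_pow, integral_const_mul]
    have h1 := mul_le_mul_of_nonneg_left (h s hs hPs) (sq_nonneg c)
    refine h1.trans ?_
    rw [← mul_assoc]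
    refine mul_le_mul_of_nonneg_right ?_ (Nat.cast_nonneg T)
    rw [mul_div_assoc', div_le_iff₀ (by positivity)]
    nlinarith

theorem SqUI.add {X Y : ℕ → Ω → ℝ} (hX : SqUI P X) (hY : SqUI P Y) :
    SqUI P fun T w => X T w + Y T w := by
  have key (T : ℕ) (s : Set Ω) : ∫ w in s, (X T w + Y T w) ^ 2 ∂P ≤
        2 * (∫ w in s, X T w ^ 2 ∂P) + 2 * ∫ w in s, Y T w ^ 2 ∂P := by
    have i1 := (hX.memLp T).integrable_sq
    have i2 := (hY.memLp T).integrable_sq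
    have i3 := ((hX.memLp T).add (hY.memLp T)).integrable_sq
    rw [← integral_const_mul, ← integral_const_mul, ← integral_add (i1.integrableOn.const_mul 2)
      (i2.integrableOn.const_mul 2)]
    refine integral_mono i3.integrableOn
      ((i1.integrableOn.const_mul 2).add (i2.integrableOn.const_mul 2)) fun w => ?_
    change (X T w + Y T w) ^ 2 ≤ 2 * X T w ^ 2 + 2 * Y T w ^ 2
    nlinarith [sq_nonneg (X T w - Y T w)]
  refine ⟨fun T => (hX.memLp T).add (hY.memLp T), ?_, fun η hη => ?_⟩
  · obtain ⟨C, hC⟩ := hX.bdd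
    obtain ⟨D, hD⟩ := hY.bdd
    refine ⟨2 * C + 2 * D, ?_⟩
    filter_upwards [hC, hD] with T h1 h2
    have := key T univ
    simp only [setIntegral_univ] at this
    nlinarith
  · obtain ⟨δ, hδ, hu⟩ := hX.unif (η / 4) (by positivity)
    obtain ⟨δ', hδ', hu'⟩ := hY.unif (η / 4) (by positivity)
    refine ⟨min δ δ', lt_min hδ hδ', ?_⟩
    filter_upwards [hu, hu'] with T h1 h2 s hs hPs
    have h3 := h1 s hs (hPs.trans (min_le_left _ _))
    have h4 := h2 s hs (hPs.trans (min_le_right _ _))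
    have h5 := key T s
    linarith

theorem L2Bounded.sqUI {X : ℕ → Ω → ℝ} (hX : L2Bounded P X) : SqUI P X := by
  obtain ⟨C, hC⟩ := hX.bdd
  have h (η : ℝ) (hη : 0 < η) : ∀ᶠ T : ℕ in atTop, ∫ w, X T w ^ 2 ∂P ≤ η * T := by
    have : Tendsto (fun T : ℕ => η * (T : ℝ)) atTop atTop :=
      tendsto_natCast_atTop_atTop.const_mul_atTop hη
    filter_upwards [hC, this.eventually_ge_atTop C] with T h1 h2
    exact h1.trans h2
  refine ⟨hX.memLp, ⟨1, h 1 one_pos⟩, fun η hη => ⟨1, one_pos, ?_⟩⟩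
  filter_upwards [h η hη] with T h1 s hs _
  exact (setIntegral_le_integral (hX.memLp T).integrable_sq
    (ae_of_all _ fun w => sq_nonneg _)).trans h1

theorem L2Bounded.const_mul {X : ℕ → Ω → ℝ} (hX : L2Bounded P X) (c : ℝ) :
    L2Bounded P fun T w => c * X T w := by
  obtain ⟨C, hC⟩ := hX.bdd
  refine ⟨fun T => (hX.memLp T).const_mul c, c ^ 2 * C, ?_⟩
  filter_upwards [hC] with T h
  simp only [mul_pow, integral_const_mul]
  exact mul_le_mul_of_nonneg_left h (sq_nonneg c)

theorem L2Bounded.add {X Y : ℕ → Ω → ℝ} (hX : L2Bounded P X) (hY : L2Bounded P Y) :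
    L2Bounded P fun T w => X T w + Y T w := by
  obtain ⟨C, hC⟩ := hX.bdd
  obtain ⟨D, hD⟩ := hY.bdd
  refine ⟨fun T => (hX.memLp T).add (hY.memLp T), 2 * C + 2 * D, ?_⟩
  filter_upwards [hC, hD] with T h1 h2
  have i1 := (hX.memLp T).integrable_sq
  have i2 := (hY.memLp T).integrable_sq
  have h3 : ∫ w, (X T w + Y T w) ^ 2 ∂P ≤ ∫ w, (2 * X T w ^ 2 + 2 * Y T w ^ 2) ∂P := by
    refine integral_mono ((hX.memLp T).add (hY.memLp T)).integrable_sq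
      ((i1.const_mul 2).add (i2.const_mul 2)) fun w => ?_
    change (X T w + Y T w) ^ 2 ≤ 2 * X T w ^ 2 + 2 * Y T w ^ 2
    nlinarith [sq_nonneg (X T w - Y T w)]
  rw [integral_add (i1.const_mul 2) (i2.const_mul 2), integral_const_mul,
    integral_const_mul] at h3
  linarith

theorem L2Bounded.abs {X : ℕ → Ω → ℝ} (hX : L2Bounded P X) : L2Bounded P fun T w => |X T w| := by
  obtain ⟨C, hC⟩ := hX.bdd
  refine ⟨fun T => (hX.memLp T).abs, C, ?_⟩
  simpa only [sq_abs] using hC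

theorem L2Bounded.const {X : Ω → ℝ} (hX : MemLp X 2 P) : L2Bounded P fun _ => X :=
  ⟨fun _ => hX, _, Eventually.of_forall fun _ => le_rfl⟩

/-- Young's inequality with weight `√T`. -/
theorem SqUI.tendsto_integral_mul {X Y : ℕ → Ω → ℝ} (hX : SqUI P X) (hY : L2Bounded P Y) :
    Tendsto (fun T : ℕ => (∫ w, X T w * Y T w ∂P) / T) atTop (𝓝 0) := by
  obtain ⟨C, hC⟩ := hX.bdd
  obtain ⟨D, hD⟩ := hY.bdd
  have hs : Tendsto (fun T : ℕ => (C + D) / Real.sqrt T) atTop (𝓝 0) :=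
    tendsto_const_nhds.div_atTop (Real.tendsto_sqrt_atTop.comp tendsto_natCast_atTop_atTop)
  refine squeeze_zero_norm' ?_ hs
  filter_upwards [hC, hD, eventually_ge_atTop 1] with T h3 h4 hT
  have hT' : (0 : ℝ) < T := by exact_mod_cast hT
  have hr : 0 < Real.sqrt T := Real.sqrt_pos.2 hT'
  have hr2 : Real.sqrt T * Real.sqrt T = T := Real.mul_self_sqrt hT'.le
  have i1 := (hX.memLp T).integrable_sq
  have i2 := (hY.memLp T).integrable_sq
  have h5 : ‖∫ w, X T w * Y T w ∂P‖ ≤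
      ∫ w, ((Real.sqrt T)⁻¹ * X T w ^ 2 + Real.sqrt T * Y T w ^ 2) ∂P := by
    refine norm_integral_le_of_norm_le ((i1.const_mul _).add (i2.const_mul _))
      (ae_of_all _ fun w => ?_)
    generalize Real.sqrt T = r at hr
    have h6 : 0 ≤ r⁻¹ * ((|X T w| - r * |Y T w|) ^ 2 + |X T w| * (r * |Y T w|)) := by positivity
    have h7 : r⁻¹ * ((|X T w| - r * |Y T w|) ^ 2 + |X T w| * (r * |Y T w|)) =
        r⁻¹ * X T w ^ 2 + r * Y T w ^ 2 - |X T w| * |Y T w| := by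
      rw [← sq_abs (X T w), ← sq_abs (Y T w)]
      field_simp
      ring
    rw [norm_mul, Real.norm_eq_abs, Real.norm_eq_abs]
    linarith
  rw [integral_add (i1.const_mul _) (i2.const_mul _), integral_const_mul,
    integral_const_mul] at h5
  rw [norm_div, Real.norm_of_nonneg hT'.le, div_le_div_iff₀ hT' hr]
  have h8 := mul_le_mul_of_nonneg_left h4 hr.le
  have h9 := mul_le_mul_of_nonneg_left h3 (inv_pos.2 hr).le
  have h10 : ‖∫ w, X T w * Y T w ∂P‖ * Real.sqrt T ≤
      ((Real.sqrt T)⁻¹ * (C * T) + Real.sqrt T * D) * Real.sqrt T :=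
    mul_le_mul_of_nonneg_right (by linarith) hr.le
  refine h10.trans (le_of_eq ?_)
  rw [add_mul, mul_right_comm, inv_mul_cancel₀ hr.ne', mul_right_comm, hr2]
  ring

theorem SqUI.of_pow_four {X : ℕ → Ω → ℝ} (hX : ∀ T, Measurable (X T))
    (h4 : ∀ T, Integrable (fun w => X T w ^ 4) P) {C : ℝ} (hC0 : 0 ≤ C)
    (hC : ∀ T : ℕ, ∫ w, X T w ^ 4 ∂P ≤ C * (T : ℝ) ^ 2) : SqUI P X := by
  have key (α : ℝ) (hα : 0 < α) (T : ℕ) (hT : 1 ≤ T) (s : Set Ω) (hs : MeasurableSet s) :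
      ∫ w in s, X T w ^ 2 ∂P ≤ (α * C + P.real s / α) * T := by
    have hT' : (0 : ℝ) < T := by exact_mod_cast hT
    have h1 : ∫ w in s, X T w ^ 2 ∂P ≤ ∫ w in s, (α / T * X T w ^ 4 + T / α) ∂P := by
      refine integral_mono (integrable_sq_of_pow_four (hX T) (h4 T)).integrableOn
        (((h4 T).integrableOn.const_mul _).add (integrable_const _)) fun w => ?_
      change X T w ^ 2 ≤ α / T * X T w ^ 4 + T / α
      generalize X T w = a
      have h2 : 0 ≤ α / T * (a ^ 2 - T / α) ^ 2 := by positivity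
      have h3 : α / T * (a ^ 2 - T / α) ^ 2 = α / T * a ^ 4 + T / α - 2 * a ^ 2 := by
        field_simp
        ring
      nlinarith [sq_nonneg a]
    rw [integral_add ((h4 T).integrableOn.const_mul _) (integrable_const _), integral_const_mul,
      setIntegral_const, smul_eq_mul] at h1
    have h2 : ∫ w in s, X T w ^ 4 ∂P ≤ C * (T : ℝ) ^ 2 :=
      (setIntegral_le_integral (h4 T) (ae_of_all _ fun w => by
        change 0 ≤ X T w ^ 4; positivity)).trans (hC T)
    have h3 : α / T * ∫ w in s, X T w ^ 4 ∂P ≤ α / T * (C * (T : ℝ) ^ 2) :=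
      mul_le_mul_of_nonneg_left h2 (by positivity)
    have h4 : α / T * (C * (T : ℝ) ^ 2) = α * C * T := by field_simp
    have h5 : P.real s * (T / α) = P.real s / α * T := by ring
    linarith
  refine ⟨fun T => memLp_two_of_pow_four (hX T) (h4 T), ⟨C + 1, ?_⟩, fun η hη => ?_⟩
  · filter_upwards [eventually_ge_atTop 1] with T hT
    simpa using key 1 one_pos T hT univ MeasurableSet.univ
  · set α := η / (2 * (C + 1)) with hα
    have hα0 : 0 < α := by positivity
    refine ⟨η * α / 2, by positivity, ?_⟩
    filter_upwards [eventually_ge_atTop 1] with T hT s hs hPs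
    refine (key α hα0 T hT s hs).trans (mul_le_mul_of_nonneg_right ?_ (Nat.cast_nonneg T))
    have h1 : P.real s / α ≤ η / 2 := by
      rw [div_le_iff₀ hα0]; linarith
    have h2 : α * C ≤ η / 2 := by
      have : α * (C + 1) = η / 2 := by rw [hα]; field_simp
      nlinarith
    linarith

/-- Chebyshev's inequality sharpened by uniform integrability. -/
theorem SqUI.tendsto_mul_measure {X : ℕ → Ω → ℝ} (hX : SqUI P X) {c : ℝ} (hc : 0 < c) :
    Tendsto (fun T : ℕ => (T : ℝ) * P.real {w | c * T ≤ |X T w|}) atTop (𝓝 0) := by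
  have hcheb (T : ℕ) (Y : Ω → ℝ) (hY : MemLp Y 2 P) (hT : 1 ≤ T) :
      (c * T) ^ 2 * P.real {w | c * T ≤ |Y w|} ≤ ∫ w in {w | c * T ≤ |Y w|}, Y w ^ 2 ∂P := by
    have hms : NullMeasurableSet {w | c * T ≤ |Y w|} P :=
      nullMeasurableSet_le aemeasurable_const hY.1.aemeasurable.abs
    have h1 : ∫ w in {w | c * T ≤ |Y w|}, (c * T) ^ 2 ∂P ≤
        ∫ w in {w | c * T ≤ |Y w|}, Y w ^ 2 ∂P := by
      refine setIntegral_mono_on₀ (integrable_const _) hY.integrable_sq.integrableOn hms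
        fun w hw => ?_
      rw [← sq_abs (Y w)]
      exact pow_le_pow_left₀ (by positivity) hw 2
    rwa [setIntegral_const, smul_eq_mul, mul_comm] at h1
  rw [Metric.tendsto_nhds]
  intro η hη
  obtain ⟨δ, hδ, hu⟩ := hX.unif (η * c ^ 2 / 2) (by positivity)
  obtain ⟨C, hC⟩ := hX.bdd
  have hlim : Tendsto (fun T : ℕ => (δ * c ^ 2) * (T : ℝ)) atTop atTop :=
    tendsto_natCast_atTop_atTop.const_mul_atTop (by positivity)
  filter_upwards [hu, hC, hlim.eventually_ge_atTop C, eventually_ge_atTop 1] with T h1 h2 h3 hT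
  have hT' : (0 : ℝ) < T := by exact_mod_cast hT
  have hc1 := hcheb T (X T) (hX.memLp T) hT
  have hms : NullMeasurableSet {w | c * T ≤ |X T w|} P :=
    nullMeasurableSet_le aemeasurable_const (hX.memLp T).1.aemeasurable.abs
  obtain ⟨s, hs, hse⟩ := hms.exists_measurable_superset_ae_eq.imp fun s h => h.2
  have hP : P.real {w | c * T ≤ |X T w|} ≤ δ := by
    have h4 : (c * T) ^ 2 * P.real {w | c * T ≤ |X T w|} ≤ C * T :=
      (hc1.trans (setIntegral_le_integral (hX.memLp T).integrable_sq
        (ae_of_all _ fun w => sq_nonneg _))).trans h2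
    have h5 : C * T ≤ (c * T) ^ 2 * δ := by nlinarith
    exact le_of_mul_le_mul_left (h4.trans h5) (by positivity)
  have h6 := h1 s hs (by rwa [measureReal_congr hse])
  rw [setIntegral_congr_set hse] at h6
  rw [Real.dist_eq, sub_zero, abs_of_nonneg (by positivity)]
  have h7 : (T : ℝ) * P.real {w | c * T ≤ |X T w|} ≤ η / 2 := by
    have h8 : (c ^ 2 * T) * (T * P.real {w | c * T ≤ |X T w|}) ≤ (c ^ 2 * T) * (η / 2) := by
      nlinarith
    exact le_of_mul_le_mul_left h8 (by positivity)
  linarith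

theorem SqUI.tendsto_setIntegral {X : ℕ → Ω → ℝ} (hX : SqUI P X) {s : ℕ → Set Ω}
    (hs : ∀ T, MeasurableSet (s T)) (hP : Tendsto (fun T => P.real (s T)) atTop (𝓝 0)) :
    Tendsto (fun T : ℕ => (∫ w in s T, X T w ^ 2 ∂P) / T) atTop (𝓝 0) := by
  rw [Metric.tendsto_nhds]
  intro η hη
  obtain ⟨δ, hδ, hu⟩ := hX.unif (η / 2) (by positivity)
  filter_upwards [hu, hP.eventually_le_const hδ, eventually_ge_atTop 1] with T h1 h2 hT
  have hT' : (0 : ℝ) < T := by exact_mod_cast hT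
  rw [Real.dist_eq, sub_zero, abs_of_nonneg (div_nonneg (integral_nonneg fun w => sq_nonneg _)
    hT'.le), div_lt_iff₀ hT']
  nlinarith [h1 (s T) (hs T) h2]

/-- Sums of square integrable i.i.d. variables: by truncation they are within `√(η T)` in `L²` of
sums of bounded variables, whose fourth moments are `O(T²)`. -/
theorem IsInnovation.sqUI_sum (H : IsInnovation P e σ) {g : ℝ → ℝ} (hg : Measurable g)
    (hg2 : MemLp (fun w => g (e 0 w)) 2 P) (hg0 : ∫ w, g (e 0 w) ∂P = 0) :
    SqUI P (weightedSum g (fun _ _ => 1) e) := by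
  have hm1 (s : ℕ) : Measurable[past e s] fun _ : Ω => (1 : ℝ) := measurable_const
  have h12 (_ : ℕ) : MemLp (fun _ : Ω => (1 : ℝ)) 2 P := memLp_const 1
  refine SqUI.of_approx (fun T => H.memLp_weightedSum hg hm1 hg2 h12 T) fun η hη => ?_
  -- truncation of `g` where it exceeds `k` in absolute value
  let f (k : ℕ) (x : ℝ) : ℝ := if |g x| ≤ k then g x else 0
  have hf (k : ℕ) : Measurable (f k) :=
    Measurable.ite (measurableSet_le hg.abs measurable_const) hg measurable_const
  have hfb (k : ℕ) (x : ℝ) : |f k x| ≤ k := by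
    simp only [f]; split_ifs with h
    · exact h
    · simp
  have hlim : Tendsto (fun k : ℕ => ∫ w, (g (e 0 w) - f k (e 0 w)) ^ 2 ∂P) atTop
      (𝓝 (∫ _, 0 ∂P)) := by
    refine tendsto_integral_of_dominated_convergence (fun w => g (e 0 w) ^ 2)
      (fun k => (((hg.sub (hf k)).comp (H.meas 0)).pow_const 2).aestronglyMeasurable)
      hg2.integrable_sq (fun k => ae_of_all _ fun w => ?_) (ae_of_all _ fun w => ?_)
    · rw [Real.norm_of_nonneg (sq_nonneg _)]
      simp only [f]; split_ifs
      · simp [sq_nonneg]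
      · simp
    · refine tendsto_const_nhds.congr' ?_
      filter_upwards [eventually_ge_atTop ⌈|g (e 0 w)|⌉₊] with k hk
      have : |g (e 0 w)| ≤ k := Nat.ceil_le.1 hk
      simp [f, this]
  rw [integral_zero] at hlim
  obtain ⟨k, hk⟩ := (hlim.eventually_le_const hη).exists
  set c := ∫ w, f k (e 0 w) ∂P with hc
  have hfi : MemLp (fun w => f k (e 0 w)) 2 P :=
    MemLp.of_bound ((hf k).comp (H.meas 0)).aestronglyMeasurable k
      (ae_of_all _ fun w => hfb k _)
  have hgk : Measurable fun x => f k x - c := (hf k).sub_const c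
  have hgk0 : ∫ w, (f k (e 0 w) - c) ∂P = 0 := by
    rw [integral_sub (hfi.integrable one_le_two) (integrable_const _)]; simp [hc]
  have hgk4 : Integrable (fun w => (f k (e 0 w) - c) ^ 4) P := by
    refine Integrable.of_bound ((hgk.comp (H.meas 0)).pow_const 4).aestronglyMeasurable
      ((k + |c|) ^ 4) (ae_of_all _ fun w => ?_)
    rw [norm_pow]
    refine pow_le_pow_left₀ (norm_nonneg _) ?_ 4
    exact (norm_sub_le _ _).trans (add_le_add_left (hfb k _) _)
  obtain ⟨C, hC0, hC⟩ := H.exists_integral_pow_four_le hgk hm1 hgk4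
    (fun _ => by simp) hgk0 (B := 1) (fun _ => by simp)
  refine ⟨weightedSum (fun x => f k x - c) (fun _ _ => 1) e, SqUI.of_pow_four
    (fun T => H.measurable (measurable_weightedSum hgk hm1 T))
    (H.integrable_pow_four_weightedSum hgk hm1 hgk4 (fun _ => by simp)) hC0 hC,
    Eventually.of_forall fun T => ?_⟩
  set r : ℝ → ℝ := fun x => g x - (f k x - c) with hr
  have hrm : Measurable r := hg.sub hgk
  have hr2 : MemLp (fun w => r (e 0 w)) 2 P := hg2.sub (hfi.sub (memLp_const c))
  have hr0 : ∫ w, r (e 0 w) ∂P = 0 := by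
    simp only [hr]
    rw [integral_sub (hg2.integrable one_le_two)
      (by exact (hfi.sub (memLp_const c)).integrable one_le_two), hg0, hgk0, sub_zero]
  have hsq := H.integral_weightedSum_mul hrm hrm hm1 hm1 hr2 hr2 h12 h12 hr0 hr0 T
  have hd (w : Ω) : weightedSum g (fun _ _ => 1) e T w -
      weightedSum (fun x => f k x - c) (fun _ _ => 1) e T w =
        weightedSum r (fun _ _ => 1) e T w := by
    simp only [weightedSum, hr, mul_one, Finset.sum_sub_distrib]
  simp only [hd, pow_two]
  rw [hsq]
  simp only [mul_one, integral_const, probReal_univ, smul_eq_mul, Finset.sum_const,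
    Finset.card_range, nsmul_eq_mul]
  refine mul_le_mul_of_nonneg_right ?_ (Nat.cast_nonneg T)
  -- centring can only decrease the second moment
  have hu : MemLp (fun w => g (e 0 w) - f k (e 0 w)) 2 P := hg2.sub hfi
  have hu0 : ∫ w, (g (e 0 w) - f k (e 0 w)) ∂P = -c := by
    rw [integral_sub (hg2.integrable one_le_two) (hfi.integrable one_le_two), hg0, hc]; ring
  have hexp (w : Ω) : r (e 0 w) * r (e 0 w) =
      (g (e 0 w) - f k (e 0 w)) ^ 2 + 2 * c * (g (e 0 w) - f k (e 0 w)) + c ^ 2 := by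
    simp only [hr]; ring
  simp only [hexp]
  rw [integral_add (by exact hu.integrable_sq.add ((hu.integrable one_le_two).const_mul _))
    (integrable_const _), integral_add hu.integrable_sq
    ((hu.integrable one_le_two).const_mul _), integral_const_mul, hu0]
  simp only [integral_const, probReal_univ, smul_eq_mul]
  nlinarith [sq_nonneg c]

end

/-! ### Moments of the autoregressive process -/

/-- The AR(1) process driven by `e`, started at `0`. The innovation entering at time `t + 1` has
index `t`, so that the value at time `t` depends on `e 0, …, e (t - 1)`. -/
def arProc {Ω : Type*} (φ : ℝ) (e : ℕ → Ω → ℝ) (t : ℕ) (w : Ω) : ℝ :=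
  arError φ (fun s => e (s - 1) w) t

/-- The sum `∑ e_s u_s` over times below `T`, which is minus the score of the sum of squares. -/
@[reducible] def scoreSum {Ω : Type*} (φ : ℝ) (e : ℕ → Ω → ℝ) : ℕ → Ω → ℝ :=
  weightedSum (fun x => x) (arProc φ e) e

/-- The sum `∑ e_s` of the first `T` innovations. -/
@[reducible] def innovSum {Ω : Type*} (e : ℕ → Ω → ℝ) : ℕ → Ω → ℝ :=
  weightedSum (fun x => x) (fun _ _ => 1) e

/-- The sum `∑ u_s²` over times below `T`, which is the curvature of the sum of squares. -/
def sqSum {Ω : Type*} (φ : ℝ) (e : ℕ → Ω → ℝ) (T : ℕ) (w : Ω) : ℝ :=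
  ∑ s ∈ Finset.range T, arProc φ e s w ^ 2

/-- The sum `∑ u_s` over times below `T`. -/
def levelSum {Ω : Type*} (φ : ℝ) (e : ℕ → Ω → ℝ) (T : ℕ) (w : Ω) : ℝ :=
  ∑ s ∈ Finset.range T, arProc φ e s w

/-- The stationary variance `σ² / (1 - φ²)` of the AR(1) process. -/
noncomputable def statVar (φ σ : ℝ) : ℝ := σ ^ 2 / (1 - φ ^ 2)

/-- Convexity of the fourth power, with weights `|φ|` and `1 - |φ|`. -/
theorem affine_pow_four_le {φ : ℝ} (hφ : |φ| < 1) (a b : ℝ) :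
    (φ * a + b) ^ 4 ≤ |φ| * a ^ 4 + b ^ 4 / (1 - |φ|) ^ 3 := by
  have hp : 0 < 1 - |φ| := by linarith
  have h1 : (φ * a + b) ^ 4 ≤ (|φ| * |a| + (1 - |φ|) * (|b| / (1 - |φ|))) ^ 4 := by
    rw [← Even.pow_abs (n := 4) (by decide) (φ * a + b), mul_div_cancel₀ _ hp.ne']
    refine pow_le_pow_left₀ (abs_nonneg _) ?_ 4
    rw [← abs_mul]
    exact abs_add_le _ _
  have h2 := (Even.convexOn_pow (𝕜 := ℝ) (n := 4) (by decide)).2 (mem_univ |a|)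
    (mem_univ (|b| / (1 - |φ|))) (abs_nonneg φ) hp.le (by ring)
  simp only [smul_eq_mul] at h2
  refine h1.trans (h2.trans (le_of_eq ?_))
  rw [Even.pow_abs (by decide), div_pow, Even.pow_abs (by decide)]
  field_simp

section

variable {Ω : Type*} [mΩ : MeasurableSpace Ω] {P : Measure Ω} [IsProbabilityMeasure P]
  {e : ℕ → Ω → ℝ} {σ φ : ℝ}

theorem arProc_zero (w : Ω) : arProc φ e 0 w = 0 := rfl

theorem arProc_succ (t : ℕ) (w : Ω) : arProc φ e (t + 1) w = φ * arProc φ e t w + e t w := rfl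

theorem measurable_arProc (t : ℕ) : Measurable[past e t] (arProc φ e t) := by
  induction t with
  | zero =>
    have : arProc φ e 0 = fun _ => 0 := funext fun w => arProc_zero w
    rw [this]; exact measurable_const
  | succ t ih =>
    have : arProc φ e (t + 1) = fun w => φ * arProc φ e t w + e t w :=
      funext fun w => arProc_succ t w
    rw [this]
    exact ((ih.mono (past_mono t.le_succ) le_rfl).const_mul φ).add (measurable_past_succ t)

theorem scoreSum_succ (T : ℕ) (w : Ω) :
    scoreSum φ e (T + 1) w = scoreSum φ e T w + e T w * arProc φ e T w :=
  weightedSum_succ _ _ T w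

theorem innovSum_succ (T : ℕ) (w : Ω) : innovSum e (T + 1) w = innovSum e T w + e T w * 1 :=
  weightedSum_succ _ _ T w

/-- The sum of the squared recursion `u_{t+1}² = φ² u_t² + 2 φ u_t e_t + e_t²`. -/
theorem sqSum_eq (σ : ℝ) (T : ℕ) (w : Ω) : (1 - φ ^ 2) * sqSum φ e T w =
    2 * φ * scoreSum φ e T w + weightedSum (fun x => x ^ 2 - σ ^ 2) (fun _ _ => 1) e T w +
      T * σ ^ 2 - arProc φ e T w ^ 2 := by
  induction T with
  | zero => simp [sqSum, weightedSum, arProc_zero]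
  | succ T ih =>
    have h : sqSum φ e (T + 1) w = sqSum φ e T w + arProc φ e T w ^ 2 := Finset.sum_range_succ _ _
    rw [h, mul_add, ih, scoreSum_succ, weightedSum_succ, arProc_succ]
    push_cast
    ring

theorem levelSum_eq (T : ℕ) (w : Ω) :
    (1 - φ) * levelSum φ e T w = innovSum e T w - arProc φ e T w := by
  induction T with
  | zero => simp [levelSum, weightedSum, arProc_zero]
  | succ T ih =>
    have h : levelSum φ e (T + 1) w = levelSum φ e T w + arProc φ e T w :=
      Finset.sum_range_succ _ _
    rw [h, mul_add, ih, innovSum_succ, arProc_succ]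
    ring

namespace IsInnovation

variable (H : IsInnovation P e σ)
include H

theorem integrable_pow_four : Integrable (fun w => e 0 w ^ 4) P := by
  have h := H.mom.integrable_norm_pow (p := 4) (by norm_num)
  refine h.congr (ae_of_all _ fun w => ?_)
  simp only [Real.norm_eq_abs]
  exact Even.pow_abs (by decide) _

theorem memLp_two : MemLp (e 0) 2 P := memLp_two_of_pow_four (H.meas 0) H.integrable_pow_four

theorem memLp_sq_sub : MemLp (fun w => e 0 w ^ 2 - σ ^ 2) 2 P := by
  refine MemLp.sub ?_ (memLp_const _)
  rw [memLp_two_iff_integrable_sq ((H.meas 0).pow_const 2).aestronglyMeasurable]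
  refine H.integrable_pow_four.congr (ae_of_all _ fun w => ?_)
  simp only
  ring

theorem integral_sq_sub : ∫ w, (e 0 w ^ 2 - σ ^ 2) ∂P = 0 := by
  rw [integral_sub H.memLp_two.integrable_sq (integrable_const _), H.var]
  simp

theorem measurable_ar (t : ℕ) : Measurable (arProc φ e t) := H.measurable (measurable_arProc t)

theorem integrable_arProc_pow_four (hφ : |φ| < 1) (t : ℕ) :
    Integrable (fun w => arProc φ e t w ^ 4) P := by
  induction t with
  | zero => simp [arProc_zero]
  | succ t ih =>
    have h4 := H.integrable_comp (g := fun x => x ^ 4) (measurable_id.pow_const 4)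
      H.integrable_pow_four t
    refine ((ih.const_mul |φ|).add (h4.div_const ((1 - |φ|) ^ 3))).mono'
      ((H.measurable_ar _).pow_const 4).aestronglyMeasurable (ae_of_all _ fun w => ?_)
    rw [Real.norm_of_nonneg (by positivity), arProc_succ]
    exact affine_pow_four_le hφ _ _

theorem exists_integral_arProc_pow_four_le (hφ : |φ| < 1) :
    ∃ B, 0 ≤ B ∧ ∀ t, ∫ w, arProc φ e t w ^ 4 ∂P ≤ B := by
  have hp : 0 < 1 - |φ| := by linarith
  set m := ∫ w, e 0 w ^ 4 ∂P with hm
  have hm0 : 0 ≤ m := integral_nonneg fun w => by positivity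
  refine ⟨m / (1 - |φ|) ^ 4, by positivity, fun t => ?_⟩
  induction t with
  | zero => simp only [arProc_zero]; simp; positivity
  | succ t ih =>
    have h4 := H.integrable_comp (g := fun x => x ^ 4) (measurable_id.pow_const 4)
      H.integrable_pow_four t
    have e4 := H.integral_comp (g := fun x => x ^ 4) (measurable_id.pow_const 4) t
    have h1 := integral_mono (H.integrable_arProc_pow_four hφ (t + 1))
      (((H.integrable_arProc_pow_four hφ t).const_mul |φ|).add (h4.div_const ((1 - |φ|) ^ 3)))
      fun w => by
        rw [arProc_succ]
        exact affine_pow_four_le hφ _ _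
    rw [integral_add' ((H.integrable_arProc_pow_four hφ t).const_mul |φ|)
      (h4.div_const ((1 - |φ|) ^ 3)), integral_const_mul, integral_div, e4] at h1
    have h2 := mul_le_mul_of_nonneg_left ih (abs_nonneg φ)
    have h3 : |φ| * (m / (1 - |φ|) ^ 4) + m / (1 - |φ|) ^ 3 = m / (1 - |φ|) ^ 4 := by
      field_simp; ring
    linarith

theorem memLp_arProc (hφ : |φ| < 1) (t : ℕ) : MemLp (arProc φ e t) 2 P :=
  memLp_two_of_pow_four (H.measurable_ar t) (H.integrable_arProc_pow_four hφ t)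

theorem integral_arProc (hφ : |φ| < 1) (t : ℕ) : ∫ w, arProc φ e t w ∂P = 0 := by
  induction t with
  | zero => simp [arProc_zero]
  | succ t ih =>
    simp only [arProc_succ]
    rw [integral_add (((H.memLp_arProc hφ t).integrable one_le_two).const_mul φ)
      (H.integrable_comp (g := fun x => x) measurable_id (H.memLp_two.integrable one_le_two) t),
      integral_const_mul, ih, H.integral_comp (g := fun x => x) measurable_id t, H.mean]
    simp

theorem integral_arProc_sq (hφ : |φ| < 1) (t : ℕ) :
    ∫ w, arProc φ e t w ^ 2 ∂P = statVar φ σ * (1 - (φ ^ 2) ^ t) := by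
  have h1 := (one_sub_sq_pos hφ).ne'
  induction t with
  | zero => simp [arProc_zero]
  | succ t ih =>
    have i1 := (H.memLp_arProc hφ t).integrable_sq
    have i2 : Integrable (fun w => arProc φ e t w * e t w) P :=
      H.integrable_mul (g := fun x => x) (measurable_arProc t) measurable_id
      ((H.memLp_arProc hφ t).integrable one_le_two) (H.memLp_two.integrable one_le_two)
    have i3 := H.integrable_comp (g := fun x => x ^ 2) (measurable_id.pow_const 2)
      H.memLp_two.integrable_sq t
    have hexp (w : Ω) : arProc φ e (t + 1) w ^ 2 = φ ^ 2 * arProc φ e t w ^ 2 +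
        2 * φ * (arProc φ e t w * e t w) + e t w ^ 2 := by rw [arProc_succ]; ring
    simp only [hexp]
    rw [integral_add (by exact (i1.const_mul _).add (i2.const_mul _)) i3,
      integral_add (i1.const_mul _) (i2.const_mul _), integral_const_mul, integral_const_mul, ih,
      H.integral_mul (g := fun x => x) (measurable_arProc t) measurable_id, H.mean,
      H.integral_comp (g := fun x => x ^ 2) (measurable_id.pow_const 2) t, H.var, statVar]
    field_simp
    ring

theorem memLp_scoreSum (hφ : |φ| < 1) (T : ℕ) : MemLp (scoreSum φ e T) 2 P :=
  H.memLp_weightedSum measurable_id measurable_arProc H.memLp_two (H.memLp_arProc hφ) T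

theorem integral_scoreSum (hφ : |φ| < 1) (T : ℕ) : ∫ w, scoreSum φ e T w ∂P = 0 :=
  H.integral_weightedSum measurable_id measurable_arProc H.memLp_two (H.memLp_arProc hφ) H.mean T

theorem sqUI_scoreSum (hφ : |φ| < 1) : SqUI P (scoreSum φ e) := by
  obtain ⟨B, _, hB⟩ := H.exists_integral_arProc_pow_four_le hφ
  obtain ⟨C, hC0, hC⟩ := H.exists_integral_pow_four_le (g := fun x => x) measurable_id
    measurable_arProc H.integrable_pow_four (H.integrable_arProc_pow_four hφ) H.mean hB
  exact SqUI.of_pow_four (fun T => H.measurable (measurable_weightedSum measurable_id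
    measurable_arProc T)) (H.integrable_pow_four_weightedSum measurable_id measurable_arProc
    H.integrable_pow_four (H.integrable_arProc_pow_four hφ)) hC0 hC

theorem memLp_innovSum (T : ℕ) : MemLp (innovSum e T) 2 P :=
  H.memLp_weightedSum measurable_id (fun _ => measurable_const) H.memLp_two
    (fun _ => memLp_const 1) T

theorem integral_innovSum_sq (T : ℕ) : ∫ w, innovSum e T w ^ 2 ∂P = σ ^ 2 * T := by
  have h := H.integral_weightedSum_mul (g := fun x => x) (g' := fun x => x)
    (h := fun _ _ => 1) (h' := fun _ _ => 1) measurable_id measurable_id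
    (fun _ => measurable_const) (fun _ => measurable_const) H.memLp_two H.memLp_two
    (fun _ => memLp_const 1) (fun _ => memLp_const 1) H.mean H.mean T
  simp only [← pow_two, H.var] at h
  rw [h]; simp

theorem sqUI_innovSum : SqUI P (innovSum e) :=
  H.sqUI_sum measurable_id H.memLp_two H.mean

theorem integrable_innovSum_pow_four (T : ℕ) : Integrable (fun w => innovSum e T w ^ 4) P :=
  H.integrable_pow_four_weightedSum measurable_id (fun _ => measurable_const)
    H.integrable_pow_four (fun _ => by simp) T

theorem exists_integral_innovSum_pow_four_le :
    ∃ C, 0 ≤ C ∧ ∀ T : ℕ, ∫ w, innovSum e T w ^ 4 ∂P ≤ C * (T : ℝ) ^ 2 :=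
  H.exists_integral_pow_four_le (g := fun x => x) (h := fun _ _ => 1) measurable_id
    (fun _ => measurable_const) H.integrable_pow_four (fun _ => by simp) H.mean (B := 1)
    (fun _ => by simp)

theorem memLp_arProc_sq (hφ : |φ| < 1) (t : ℕ) : MemLp (fun w => arProc φ e t w ^ 2) 2 P := by
  refine (memLp_two_iff_integrable_sq ((H.measurable_ar t).pow_const 2).aestronglyMeasurable).2
    ((H.integrable_arProc_pow_four hφ t).congr (ae_of_all _ fun w => ?_))
  simp only
  ring

theorem memLp_sqSum (hφ : |φ| < 1) (T : ℕ) : MemLp (sqSum φ e T) 2 P :=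
  memLp_finsetSum _ fun s _ => H.memLp_arProc_sq hφ s

theorem l2Bounded_arProc_sq (hφ : |φ| < 1) : L2Bounded P (fun T w => arProc φ e T w ^ 2) := by
  obtain ⟨B, _, hB⟩ := H.exists_integral_arProc_pow_four_le hφ
  refine ⟨H.memLp_arProc_sq hφ, B, Eventually.of_forall fun T => ?_⟩
  refine le_of_eq_of_le (integral_congr_ae (ae_of_all _ fun w => ?_)) (hB T)
  simp only
  ring

theorem l2Bounded_arProc (hφ : |φ| < 1) : L2Bounded P (arProc φ e) := by
  refine ⟨H.memLp_arProc hφ, statVar φ σ, Eventually.of_forall fun T => ?_⟩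
  rw [H.integral_arProc_sq hφ]
  have h1 : 0 ≤ (φ ^ 2) ^ T := by positivity
  have h2 : 0 ≤ statVar φ σ := div_nonneg (sq_nonneg σ) (one_sub_sq_pos hφ).le
  nlinarith

theorem sqUI_sum_sq_sub : SqUI P (weightedSum (fun x => x ^ 2 - σ ^ 2) (fun _ _ => 1) e) :=
  H.sqUI_sum ((measurable_id.pow_const 2).sub_const _) H.memLp_sq_sub H.integral_sq_sub

theorem sqUI_sqSum_sub (hφ : |φ| < 1) :
    SqUI P (fun T w => sqSum φ e T w - T * statVar φ σ) := by
  have h1 := (one_sub_sq_pos hφ).ne'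
  have h := ((((H.sqUI_scoreSum hφ).const_mul (2 * φ)).add H.sqUI_sum_sq_sub).add
    ((H.l2Bounded_arProc_sq hφ).sqUI.const_mul (-1))).const_mul (1 - φ ^ 2)⁻¹
  convert h using 3 with T w
  have h2 := sqSum_eq (φ := φ) (e := e) σ T w
  rw [eq_inv_mul_iff_mul_eq₀ h1, mul_sub, h2, statVar]
  field_simp
  ring

/-- The covariance of the two sample moments, which is the source of the intrinsic bias. -/
theorem tendsto_integral_sqSum_mul_scoreSum (hφ : |φ| < 1) :
    Tendsto (fun T : ℕ => (∫ w, (sqSum φ e T w - T * statVar φ σ) * scoreSum φ e T w ∂P) / T)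
      atTop (𝓝 (2 * φ * statVar φ σ ^ 2)) := by
  have h1 := (one_sub_sq_pos hφ).ne'
  have hφ2 : φ ^ 2 < 1 := (sq_lt_one_iff_abs_lt_one φ).2 hφ
  set g : ℝ → ℝ := fun x => x ^ 2 - σ ^ 2 with hg
  have hgm : Measurable g := (measurable_id.pow_const 2).sub_const _
  have h12 (_ : ℕ) : MemLp (fun _ : Ω => (1 : ℝ)) 2 P := memLp_const 1
  have hD2 (T : ℕ) : MemLp (weightedSum g (fun _ _ => 1) e T) 2 P :=
    H.memLp_weightedSum hgm (fun _ => measurable_const) H.memLp_sq_sub h12 T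
  -- the second moment of the score
  have hVV (T : ℕ) : ∫ w, scoreSum φ e T w * scoreSum φ e T w ∂P =
      σ ^ 2 * ∑ s ∈ Finset.range T, statVar φ σ * (1 - (φ ^ 2) ^ s) := by
    refine (H.integral_weightedSum_mul (g := fun x => x) (g' := fun x => x) measurable_id
      measurable_id measurable_arProc measurable_arProc H.memLp_two H.memLp_two (H.memLp_arProc hφ)
      (H.memLp_arProc hφ) H.mean H.mean T).trans ?_
    simp only [← pow_two, H.var, H.integral_arProc_sq hφ]
  have hDV (T : ℕ) : ∫ w, weightedSum g (fun _ _ => 1) e T w * scoreSum φ e T w ∂P = 0 := by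
    refine (H.integral_weightedSum_mul (g' := fun x => x) hgm measurable_id
      (fun _ => measurable_const) measurable_arProc H.memLp_sq_sub H.memLp_two h12
      (H.memLp_arProc hφ) H.integral_sq_sub H.mean T).trans ?_
    simp [H.integral_arProc hφ]
  have hlimV : Tendsto (fun T : ℕ => (∫ w, scoreSum φ e T w * scoreSum φ e T w ∂P) / T) atTop
      (𝓝 (σ ^ 2 * statVar φ σ)) := by
    have h2 : Tendsto (fun s : ℕ => statVar φ σ * (1 - (φ ^ 2) ^ s)) atTop
        (𝓝 (statVar φ σ * (1 - 0))) :=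
      ((tendsto_pow_atTop_nhds_zero_of_lt_one (sq_nonneg φ) hφ2).const_sub 1).const_mul _
    rw [sub_zero, mul_one] at h2
    refine (h2.cesaro.const_mul (σ ^ 2)).congr fun T => ?_
    rw [hVV]
    ring
  have hlimU := (H.sqUI_scoreSum hφ).tendsto_integral_mul (H.l2Bounded_arProc_sq hφ)
  have hlim := ((hlimV.const_mul (2 * φ)).sub hlimU).const_mul (1 - φ ^ 2)⁻¹
  have hval : (1 - φ ^ 2)⁻¹ * (2 * φ * (σ ^ 2 * statVar φ σ) - 0) = 2 * φ * statVar φ σ ^ 2 := by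
    rw [statVar]; field_simp
    ring
  rw [hval] at hlim
  refine hlim.congr fun T => ?_
  have hexp (w : Ω) : (sqSum φ e T w - T * statVar φ σ) * scoreSum φ e T w =
      (1 - φ ^ 2)⁻¹ * (2 * φ * (scoreSum φ e T w * scoreSum φ e T w) +
        weightedSum g (fun _ _ => 1) e T w * scoreSum φ e T w -
        scoreSum φ e T w * arProc φ e T w ^ 2) := by
    have h2 := sqSum_eq (φ := φ) (e := e) σ T w
    have h3 : sqSum φ e T w - T * statVar φ σ = (1 - φ ^ 2)⁻¹ * (2 * φ * scoreSum φ e T w +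
        weightedSum g (fun _ _ => 1) e T w - arProc φ e T w ^ 2) := by
      rw [eq_inv_mul_iff_mul_eq₀ h1, mul_sub, h2, statVar]
      field_simp
      ring
    rw [h3]; ring
  have i1 := integrable_mul_of_sq (H.memLp_scoreSum hφ T) (H.memLp_scoreSum hφ T)
  have i2 := integrable_mul_of_sq (hD2 T) (H.memLp_scoreSum hφ T)
  have i3 := integrable_mul_of_sq (H.memLp_scoreSum hφ T) (H.memLp_arProc_sq hφ T)
  simp only [hexp]
  rw [integral_const_mul, integral_sub (by exact (i1.const_mul _).add i2) i3,
    integral_add (i1.const_mul _) i2, integral_const_mul, hDV]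
  ring

end IsInnovation

end

/-! ### Second order expansion of the mean of an approximate root -/

section

variable {Ω : Type*} [mΩ : MeasurableSpace Ω] {P : Measure Ω} [IsProbabilityMeasure P]

/-- `θ` is close to the root of the linear equation `(T A + Y) θ = V + r`: it is bounded, satisfies
a crude inequality everywhere and, where it is smaller than `δ₀`, satisfies the equation up to an
error `K |θ|`. -/
structure ApproxRoot (A δ₀ T θ V Y K r : ℝ) : Prop where
  bdd : |θ| ≤ 2
  crude : (T * A + Y) * |θ| ≤ 2 * (|V| + K)
  root : |θ| < δ₀ → |(T * A + Y) * θ - V - r| ≤ K * |θ|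
  bound : |r| ≤ K

/-- Second order expansion of an approximate root. On `|θ| < δ` it comes from inserting the equation
into itself once; elsewhere every term is estimated by itself. -/
theorem ApproxRoot.abs_sub_le {A δ₀ δ T θ V Y K r : ℝ} (h : ApproxRoot A δ₀ T θ V Y K r)
    (hA : 0 < A) (hδ : 0 < δ) (hδ₀ : δ ≤ δ₀) (hT : 0 < T) :
    |T * θ - V / A - r / A + Y * V / (T * A ^ 2)| ≤ (1 + 1 / A + 1 / A ^ 2) *
      (δ * (1 + K ^ 2) + 4 * δ * (Y ^ 2 / T) + (1 / δ + 1) * (K ^ 2 / T) +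
        if δ ≤ |θ| then 4 * T + 2 * (V ^ 2 / T) + Y ^ 2 / T else 0) := by
  have hK : 0 ≤ K := (abs_nonneg r).trans h.bound
  set M := 1 + 1 / A + 1 / A ^ 2 with hM
  have hA1 : 0 < 1 / A := by positivity
  have hA2 : 0 < 1 / A ^ 2 := by positivity
  have young (a b : ℝ) : |a| * |b| / T ≤ (a ^ 2 + b ^ 2) / T := by
    gcongr
    nlinarith [sq_nonneg (|a| - |b|), sq_abs a, sq_abs b]
  have hsmall : 0 ≤ δ * (1 + K ^ 2) + 4 * δ * (Y ^ 2 / T) := by positivity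
  by_cases hθ : δ ≤ |θ|
  · rw [if_pos hθ]
    have h1 : |T * θ| ≤ 2 * T := by
      rw [abs_mul, abs_of_pos hT]; nlinarith [h.bdd]
    have hlin (a : ℝ) (ha : 0 ≤ a) : a ≤ a ^ 2 / T + T := by
      have : a ^ 2 / T + T - a = ((a - T) ^ 2 + a * T) / T := by field_simp; ring
      have h2 : 0 ≤ ((a - T) ^ 2 + a * T) / T := by positivity
      linarith
    have h2 : |V / A| ≤ 1 / A * (V ^ 2 / T + T) := by
      rw [abs_div, abs_of_pos hA, div_eq_mul_one_div, mul_comm, ← sq_abs V]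
      exact mul_le_mul_of_nonneg_left (hlin _ (abs_nonneg V)) hA1.le
    have h3 : |r / A| ≤ 1 / A * (K ^ 2 / T + T) := by
      rw [abs_div, abs_of_pos hA, div_eq_mul_one_div, mul_comm]
      exact mul_le_mul_of_nonneg_left (h.bound.trans (hlin _ hK)) hA1.le
    have h4 : |Y * V / (T * A ^ 2)| ≤ 1 / A ^ 2 * ((Y ^ 2 + V ^ 2) / T) := by
      rw [abs_div, abs_mul, abs_of_pos (show 0 < T * A ^ 2 by positivity), ← div_div,
        div_eq_mul_one_div, mul_comm]
      exact mul_le_mul_of_nonneg_left (young _ _) hA2.le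
    have h5 : |T * θ - V / A - r / A + Y * V / (T * A ^ 2)| ≤
        |T * θ| + |V / A| + |r / A| + |Y * V / (T * A ^ 2)| :=
      (abs_add_le _ _).trans (add_le_add_left ((abs_sub _ _).trans
        (add_le_add_left (abs_sub _ _) _)) _)
    have hV : 0 ≤ V ^ 2 / T := by positivity
    have hY : 0 ≤ Y ^ 2 / T := by positivity
    have hKT : 0 ≤ K ^ 2 / T := by positivity
    have hKT' : 0 ≤ 1 / δ * (K ^ 2 / T) := by positivity
    have hM1 : 0 ≤ M := by positivity
    have h6 : M * (K ^ 2 / T + (4 * T + 2 * (V ^ 2 / T) + Y ^ 2 / T)) ≤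
        M * (δ * (1 + K ^ 2) + 4 * δ * (Y ^ 2 / T) + (1 / δ + 1) * (K ^ 2 / T) +
          (4 * T + 2 * (V ^ 2 / T) + Y ^ 2 / T)) :=
      mul_le_mul_of_nonneg_left (by linarith) hM1
    refine (h5.trans ?_).trans h6
    rw [add_div] at h4
    rw [hM]
    nlinarith [mul_nonneg hA1.le hV, mul_nonneg hA1.le hY, mul_nonneg hA1.le hKT,
      mul_nonneg hA2.le hV, mul_nonneg hA2.le hY, mul_nonneg hA2.le hKT, mul_nonneg hA1.le hT.le,
      mul_nonneg hA2.le hT.le]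
  · rw [if_neg hθ, add_zero]
    rw [not_le] at hθ
    set d := (T * A + Y) * θ - V - r with hd
    have hdK : |d| ≤ K * |θ| := h.root (hθ.trans_le hδ₀)
    have hdδ : |d| ≤ K * δ := hdK.trans (mul_le_mul_of_nonneg_left hθ.le hK)
    have hd2 : |d| ≤ K * 2 := hdK.trans (mul_le_mul_of_nonneg_left h.bdd hK)
    have hid : T * θ - V / A - r / A + Y * V / (T * A ^ 2) =
        1 / A * d - 1 / A ^ 2 * (Y * (r + d) / T) + 1 / A ^ 2 * (Y ^ 2 * θ / T) := by
      rw [hd]; field_simp; ring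
    have h1 : |Y * (r + d) / T| ≤ 3 * (δ * (Y ^ 2 / T) + 1 / (4 * δ) * (K ^ 2 / T)) := by
      have h2 : |r + d| ≤ 3 * K := (abs_add_le _ _).trans (by linarith [h.bound])
      rw [abs_div, abs_mul, abs_of_pos hT]
      have h3 : |Y| * |r + d| / T ≤ |Y| * (3 * K) / T := by gcongr
      refine h3.trans ?_
      have h4 : 3 * (δ * (Y ^ 2 / T) + 1 / (4 * δ) * (K ^ 2 / T)) - |Y| * (3 * K) / T =
          3 * (2 * δ * |Y| - K) ^ 2 / (4 * δ * T) := by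
        rw [← sq_abs Y]; field_simp; ring
      have h5 : 0 ≤ 3 * (2 * δ * |Y| - K) ^ 2 / (4 * δ * T) := by positivity
      linarith
    have h2 : |Y ^ 2 * θ / T| ≤ δ * (Y ^ 2 / T) := by
      rw [abs_div, abs_mul, abs_of_pos hT, abs_of_nonneg (sq_nonneg Y), mul_div_assoc',
        mul_comm δ]
      gcongr
    have h3 : K ≤ 1 + K ^ 2 := by nlinarith
    have h4 : |d| ≤ δ * (1 + K ^ 2) := by nlinarith
    rw [hid]
    have h5 : |1 / A * d - 1 / A ^ 2 * (Y * (r + d) / T) + 1 / A ^ 2 * (Y ^ 2 * θ / T)| ≤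
        1 / A * |d| + 1 / A ^ 2 * |Y * (r + d) / T| + 1 / A ^ 2 * |Y ^ 2 * θ / T| := by
      refine (abs_add_le _ _).trans ((add_le_add_left (abs_sub _ _) _).trans (le_of_eq ?_))
      rw [abs_mul, abs_mul, abs_mul, abs_of_pos hA1, abs_of_pos hA2]
    refine h5.trans ?_
    have hY : 0 ≤ δ * (Y ^ 2 / T) := by positivity
    have hKT : 0 ≤ K ^ 2 / T := by positivity
    have hKd : 1 / (4 * δ) * (K ^ 2 / T) = 1 / 4 * (1 / δ * (K ^ 2 / T)) := by
      field_simp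
    have hKT' : 0 ≤ 1 / δ * (K ^ 2 / T) := by positivity
    rw [hKd] at h1
    have e1 := mul_le_mul_of_nonneg_left h4 hA1.le
    have e2 := mul_le_mul_of_nonneg_left h1 hA2.le
    have e3 := mul_le_mul_of_nonneg_left h2 hA2.le
    have hz : 0 ≤ δ * (1 + K ^ 2) := by positivity
    rw [hM]
    nlinarith [mul_nonneg hA1.le hY, mul_nonneg hA1.le hKT, mul_nonneg hA1.le hKT',
      mul_nonneg hA2.le hY, mul_nonneg hA2.le hKT, mul_nonneg hA2.le hKT', mul_nonneg hA2.le hz]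

/-- An approximate root that is not small forces one of `Y`, `V`, `K` to be of order `T`. -/
theorem ApproxRoot.large {A δ₀ δ T θ V Y K r : ℝ} (h : ApproxRoot A δ₀ T θ V Y K r)
    (hA : 0 < A) (hδ : 0 < δ) (hT : 0 < T) (hθ : δ ≤ |θ|) :
    A * min (1 / 2) (δ / 8) * T ≤ |Y| ∨ A * min (1 / 2) (δ / 8) * T ≤ |V| ∨
      A * min (1 / 2) (δ / 8) * T ≤ |K| := by
  set c := A * min (1 / 2) (δ / 8) with hc
  have hc1 : c ≤ A * (1 / 2) := mul_le_mul_of_nonneg_left (min_le_left _ _) hA.le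
  have hc2 : c ≤ A * (δ / 8) := mul_le_mul_of_nonneg_left (min_le_right _ _) hA.le
  by_contra! hcon
  obtain ⟨hY, hV, hK⟩ := hcon
  have h1 : T * A / 2 ≤ T * A + Y := by
    have := (abs_lt.1 hY).1
    nlinarith
  have h2 : T * A / 2 * δ ≤ (T * A + Y) * |θ| := by
    have : 0 < T * A := by positivity
    exact mul_le_mul h1 hθ hδ.le (by linarith)
  have h3 := h.crude
  have h4 := le_abs_self K
  nlinarith

/-- The mean of an approximate root `θ_T` of the equations `(T A + Y_T) θ = V_T + r_T` is
`(ρ / A - ν / A²) / T + o(1 / T)`, where `ρ = lim E r_T` and `ν = lim E (Y_T V_T) / T`. -/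
theorem tendsto_mul_integral_of_approxRoot_of_measurable {θ V Y K r : ℕ → Ω → ℝ}
    {A δ₀ ρ ν : ℝ} (hA : 0 < A) (hδ₀ : 0 < δ₀) (hθ : ∀ T, Measurable (θ T))
    (hV : SqUI P V) (hV0 : ∀ T, ∫ w, V T w ∂P = 0) (hY : SqUI P Y)
    (hK : L2Bounded P K)
    (hr : ∀ T, Integrable (r T) P)
    (hρ : Tendsto (fun T => ∫ w, r T w ∂P) atTop (𝓝 ρ))
    (hν : Tendsto (fun T : ℕ => (∫ w, Y T w * V T w ∂P) / T) atTop (𝓝 ν))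
    (h : ∀ᶠ T : ℕ in atTop, ∀ᵐ w ∂P,
      ApproxRoot A δ₀ T (θ T w) (V T w) (Y T w) (K T w) (r T w)) :
    Tendsto (fun T : ℕ => (T : ℝ) * ∫ w, θ T w ∂P) atTop (𝓝 (ρ / A - ν / A ^ 2)) := by
  have hKu := hK.sqUI
  obtain ⟨C, hKC⟩ := hK.bdd
  have hC0 : 0 ≤ C := by
    obtain ⟨T, hT⟩ := hKC.exists
    exact (integral_nonneg fun w => sq_nonneg _).trans hT
  obtain ⟨D, hD⟩ := hY.bdd
  have hset (δ : ℝ) (T : ℕ) : MeasurableSet {w | δ ≤ |θ T w|} :=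
    measurableSet_le measurable_const (hθ T).abs
  have hlarge (δ : ℝ) (hδ : 0 < δ) :
      Tendsto (fun T : ℕ => (T : ℝ) * P.real {w | δ ≤ |θ T w|}) atTop (𝓝 0) := by
    have hc : 0 < A * min (1 / 2) (δ / 8) := mul_pos hA (lt_min (by norm_num) (by positivity))
    set c := A * min (1 / 2) (δ / 8) with hcd
    have hlim := ((hY.tendsto_mul_measure hc).add (hV.tendsto_mul_measure hc)).add
      (hKu.tendsto_mul_measure hc)
    simp only [add_zero] at hlim
    refine squeeze_zero' (Eventually.of_forall fun T => by positivity) ?_ hlim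
    filter_upwards [h, eventually_ge_atTop 1] with T hT hT1
    have hT' : (0 : ℝ) < T := by exact_mod_cast hT1
    rw [← mul_add, ← mul_add]
    refine mul_le_mul_of_nonneg_left ?_ hT'.le
    have hsub : P.real {w | δ ≤ |θ T w|} ≤ P.real ({w | c * T ≤ |Y T w|} ∪
        {w | c * T ≤ |V T w|} ∪ {w | c * T ≤ |K T w|}) := by
      refine ENNReal.toReal_mono (measure_ne_top _ _) (measure_mono_ae ?_)
      filter_upwards [hT] with w hw hθw
      rcases hw.large hA hδ hT' hθw with h1 | h1 | h1
      · exact Or.inl (Or.inl h1)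
      · exact Or.inl (Or.inr h1)
      · exact Or.inr h1
    exact hsub.trans ((measureReal_union_le _ _).trans
      (add_le_add_left (measureReal_union_le _ _) _))
  have hprob (δ : ℝ) (hδ : 0 < δ) :
      Tendsto (fun T : ℕ => P.real {w | δ ≤ |θ T w|}) atTop (𝓝 0) := by
    refine squeeze_zero' (Eventually.of_forall fun T => by positivity) ?_ (hlarge δ hδ)
    filter_upwards [eventually_ge_atTop 1] with T hT
    exact le_mul_of_one_le_left (by positivity) (by exact_mod_cast hT)
  -- the remainder of the second order expansion
  let rem (T : ℕ) (w : Ω) : ℝ :=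
    T * θ T w - V T w / A - r T w / A + Y T w * V T w / (T * A ^ 2)
  have hYV (T : ℕ) := integrable_mul_of_sq (hY.memLp T) (hV.memLp T)
  have hVi (T : ℕ) : Integrable (V T) P := (hV.memLp T).integrable one_le_two
  have hrem : Tendsto (fun T => ∫ w, rem T w ∂P) atTop (𝓝 0) := by
    rw [Metric.tendsto_nhds]
    intro η hη
    set M := 1 + 1 / A + 1 / A ^ 2 with hM
    have hM0 : 0 < M := by positivity
    have hL : 0 < M * (1 + C + 4 * |D|) := by positivity
    -- `δ` bounds the part of the remainder that does not vanish as `T` grows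
    set δ := min δ₀ (η / (2 * (M * (1 + C + 4 * |D|)))) with hδd
    have hδ : 0 < δ := lt_min hδ₀ (by positivity)
    have hδη : M * (δ * (1 + C + 4 * |D|)) ≤ η / 2 := by
      have h1 : δ ≤ η / (2 * (M * (1 + C + 4 * |D|))) := min_le_right _ _
      rw [le_div_iff₀ (by positivity)] at h1
      linarith
    have hsm : Tendsto (fun T : ℕ => M * ((1 / δ + 1) * (C / T) +
        (4 * (T * P.real {w | δ ≤ |θ T w|}) +
          2 * ((∫ w in {w | δ ≤ |θ T w|}, V T w ^ 2 ∂P) / T) +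
          (∫ w in {w | δ ≤ |θ T w|}, Y T w ^ 2 ∂P) / T))) atTop (𝓝 0) := by
      have h1 := (((((tendsto_const_div_atTop_nhds_zero_nat C).const_mul (1 / δ + 1)).add
        ((((hlarge δ hδ).const_mul 4).add
          ((hV.tendsto_setIntegral (hset δ) (hprob δ hδ)).const_mul 2)).add
          (hY.tendsto_setIntegral (hset δ) (hprob δ hδ))))).const_mul M)
      simpa using h1
    filter_upwards [h, hKC, hD, eventually_ge_atTop 1, hsm.eventually_lt_const (half_pos hη)]
      with T hT hT2 hT3 hT1 hT4
    have hT' : (0 : ℝ) < T := by exact_mod_cast hT1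
    set B := {w | δ ≤ |θ T w|} with hB
    have iK := (hK.memLp T).integrable_sq
    have iY := (hY.memLp T).integrable_sq
    have iV := (hV.memLp T).integrable_sq
    have i1 : Integrable (fun w => δ * (1 + K T w ^ 2)) P := ((integrable_const 1).add iK).const_mul δ
    have i2 : Integrable (fun w => 4 * δ * (Y T w ^ 2 / T)) P := (iY.div_const _).const_mul _
    have i3 : Integrable (fun w => (1 / δ + 1) * (K T w ^ 2 / T)) P := (iK.div_const _).const_mul _
    have i4 : Integrable (fun w => 2 * (V T w ^ 2 / T)) P := (iV.div_const _).const_mul _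
    have i5 : Integrable (fun w => Y T w ^ 2 / T) P := iY.div_const _
    have i45 : Integrable (fun w => 4 * T + 2 * (V T w ^ 2 / T)) P := (integrable_const _).add i4
    have i6 : Integrable (B.indicator fun w => (4 * T + 2 * (V T w ^ 2 / T)) + Y T w ^ 2 / T) P :=
      (i45.add i5).indicator (hset δ T)
    have i12 : Integrable (fun w => δ * (1 + K T w ^ 2) + 4 * δ * (Y T w ^ 2 / T)) P := i1.add i2
    have i123 : Integrable (fun w => δ * (1 + K T w ^ 2) + 4 * δ * (Y T w ^ 2 / T) +
      (1 / δ + 1) * (K T w ^ 2 / T)) P := i12.add i3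
    have hbd : ‖∫ w, rem T w ∂P‖ ≤ ∫ w, M * (((δ * (1 + K T w ^ 2) + 4 * δ * (Y T w ^ 2 / T)) +
        (1 / δ + 1) * (K T w ^ 2 / T)) +
          B.indicator (fun w => (4 * T + 2 * (V T w ^ 2 / T)) + Y T w ^ 2 / T) w) ∂P := by
      refine norm_integral_le_of_norm_le ((i123.add i6).const_mul M) ?_
      filter_upwards [hT] with w hw
      exact hw.abs_sub_le hA hδ (min_le_left _ _) hT'
    rw [dist_zero_right]
    generalize ‖∫ w, rem T w ∂P‖ = N at hbd ⊢
    rw [integral_const_mul, integral_add i123 i6, integral_add i12 i3, integral_add i1 i2,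
      integral_indicator (hset δ T), integral_add i45.integrableOn i5.integrableOn,
      integral_add (integrable_const _) i4.integrableOn, setIntegral_const,
      integral_const_mul, integral_const_mul, integral_const_mul, integral_const_mul,
      integral_div, integral_div, integral_div, integral_div,
      integral_add (integrable_const _) iK] at hbd
    simp only [integral_const, probReal_univ, smul_eq_mul, one_mul] at hbd
    refine hbd.trans_lt ?_
    have h1 : (∫ w, Y T w ^ 2 ∂P) / T ≤ |D| := by
      rw [div_le_iff₀ hT']
      exact hT3.trans (mul_le_mul_of_nonneg_right (le_abs_self D) hT'.le)
    have h2 : (1 / δ + 1) * ((∫ w, K T w ^ 2 ∂P) / T) ≤ (1 / δ + 1) * (C / T) := by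
      gcongr
    have h3 : δ * (1 + ∫ w, K T w ^ 2 ∂P) + 4 * δ * ((∫ w, Y T w ^ 2 ∂P) / T) ≤
        δ * (1 + C + 4 * |D|) := by nlinarith
    have h4 : M * (δ * (1 + ∫ w, K T w ^ 2 ∂P) + 4 * δ * ((∫ w, Y T w ^ 2 ∂P) / T) +
        (1 / δ + 1) * ((∫ w, K T w ^ 2 ∂P) / T) + (P.real B * (4 * T) +
          2 * ((∫ w in B, V T w ^ 2 ∂P) / T) + (∫ w in B, Y T w ^ 2 ∂P) / T)) ≤
        M * (δ * (1 + C + 4 * |D|)) + M * ((1 / δ + 1) * (C / T) + (4 * (T * P.real B) +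
          2 * ((∫ w in B, V T w ^ 2 ∂P) / T) + (∫ w in B, Y T w ^ 2 ∂P) / T)) := by
      rw [← mul_add]
      refine mul_le_mul_of_nonneg_left ?_ hM0.le
      linarith
    linarith
  have hlim := (((hρ.div_const A).sub ((hν.div_const (A ^ 2)))).add hrem)
  rw [add_zero] at hlim
  refine hlim.congr' ?_
  filter_upwards [h, eventually_ge_atTop 1] with T hT hT1
  have hθi : Integrable (θ T) P := by
    refine Integrable.of_bound (hθ T).aestronglyMeasurable 2 ?_
    filter_upwards [hT] with w hw
    exact hw.bdd
  simp only [rem]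
  rw [integral_add (by exact ((hθi.const_mul _).sub ((hVi T).div_const _)).sub ((hr T).div_const _))
    ((hYV T).div_const _),
    integral_sub (by exact (hθi.const_mul _).sub ((hVi T).div_const _)) ((hr T).div_const _),
    integral_sub (hθi.const_mul _) ((hVi T).div_const _), integral_const_mul, integral_div,
    integral_div, integral_div, hV0]
  have hT' : (T : ℝ) ≠ 0 := by positivity
  field_simp
  ring

/-- Almost everywhere measurable approximate roots have the same expansion of the mean. -/
theorem tendsto_mul_integral_of_approxRoot {θ V Y K r : ℕ → Ω → ℝ}
    {A δ₀ ρ ν : ℝ} (hA : 0 < A) (hδ₀ : 0 < δ₀)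
    (hθ : ∀ᶠ T : ℕ in atTop, AEMeasurable (θ T) P)
    (hV : SqUI P V) (hV0 : ∀ T, ∫ w, V T w ∂P = 0) (hY : SqUI P Y)
    (hK : L2Bounded P K)
    (hr : ∀ T, Integrable (r T) P)
    (hρ : Tendsto (fun T => ∫ w, r T w ∂P) atTop (𝓝 ρ))
    (hν : Tendsto (fun T : ℕ => (∫ w, Y T w * V T w ∂P) / T) atTop (𝓝 ν))
    (h : ∀ᶠ T : ℕ in atTop, ∀ᵐ w ∂P,
      ApproxRoot A δ₀ T (θ T w) (V T w) (Y T w) (K T w) (r T w)) :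
    Tendsto (fun T : ℕ => (T : ℝ) * ∫ w, θ T w ∂P) atTop (𝓝 (ρ / A - ν / A ^ 2)) := by
  have hex (T : ℕ) : ∃ θ' : Ω → ℝ, Measurable θ' ∧ (AEMeasurable (θ T) P → θ T =ᵐ[P] θ') := by
    by_cases hm : AEMeasurable (θ T) P
    · exact ⟨hm.mk _, hm.measurable_mk, fun _ => hm.ae_eq_mk⟩
    · exact ⟨0, measurable_zero, fun h => (hm h).elim⟩
  choose θ' hθ' hθe using hex
  have hlim := tendsto_mul_integral_of_approxRoot_of_measurable hA hδ₀ hθ' hV hV0 hY hK hr hρ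
    hν (by
      filter_upwards [h, hθ] with T h1 h2
      filter_upwards [h1, hθe T h2] with w h3 h4
      rwa [← h4])
  refine hlim.congr' ?_
  filter_upwards [hθ] with T h2
  rw [integral_congr_ae (hθe T h2)]

end

/-! ### Uniform bounds on perturbations of the objective function -/

/-- On `s` the function `f` has derivative `f'`, both are bounded by `K`, and `f'` is `K`-Lipschitz:
a `C²` bound that refers to the first derivative only. -/
structure C2Bound (s : Set ℝ) (f f' : ℝ → ℝ) (K : ℝ) : Prop where
  nonneg : 0 ≤ K
  hasDerivAt : ∀ x ∈ s, HasDerivAt f (f' x) x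
  bound : ∀ x ∈ s, |f x| ≤ K
  bound_deriv : ∀ x ∈ s, |f' x| ≤ K
  lipschitz : ∀ x ∈ s, ∀ y ∈ s, |f' x - f' y| ≤ K * |x - y|

theorem abs_sub_le_of_hasDerivAt {s : Set ℝ} (hs : Convex ℝ s) {f f' : ℝ → ℝ} {K : ℝ}
    (hf : ∀ x ∈ s, HasDerivAt f (f' x) x) (hK : ∀ x ∈ s, |f' x| ≤ K) {x y : ℝ} (hx : x ∈ s)
    (hy : y ∈ s) : |f x - f y| ≤ K * |x - y| :=
  hs.norm_image_sub_le_of_norm_hasDerivWithin_le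
    (fun z hz => (hf z hz).hasDerivWithinAt) hK hy hx

theorem abs_mul_sub_mul_le {a b c d Ka Kb La Lb t : ℝ} (ha : |a| ≤ Ka) (hd : |d| ≤ Kb)
    (hac : |a - c| ≤ La * t) (hbd : |b - d| ≤ Lb * t) :
    |a * b - c * d| ≤ (Ka * Lb + La * Kb) * t := by
  have h : a * b - c * d = a * (b - d) + (a - c) * d := by ring
  rw [h]
  refine (abs_add_le _ _).trans ?_
  rw [abs_mul, abs_mul, add_mul]
  have h1 : |a| * |b - d| ≤ Ka * (Lb * t) :=
    mul_le_mul ha hbd (abs_nonneg _) ((abs_nonneg _).trans ha)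
  have h2 : |a - c| * |d| ≤ La * t * Kb :=
    mul_le_mul hac hd (abs_nonneg _) ((abs_nonneg _).trans hac)
  linarith

namespace C2Bound

variable {s : Set ℝ} {f f' g g' : ℝ → ℝ} {K L : ℝ}

theorem abs_sub_le (hs : Convex ℝ s) (hf : C2Bound s f f' K) {x y : ℝ} (hx : x ∈ s)
    (hy : y ∈ s) : |f x - f y| ≤ K * |x - y| :=
  abs_sub_le_of_hasDerivAt hs hf.hasDerivAt hf.bound_deriv hx hy

theorem mono (hf : C2Bound s f f' K) (h : K ≤ L) : C2Bound s f f' L where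
  nonneg := hf.nonneg.trans h
  hasDerivAt := hf.hasDerivAt
  bound x hx := (hf.bound x hx).trans h
  bound_deriv x hx := (hf.bound_deriv x hx).trans h
  lipschitz x hx y hy :=
    (hf.lipschitz x hx y hy).trans (mul_le_mul_of_nonneg_right h (abs_nonneg _))

theorem const_mul (hf : C2Bound s f f' K) (c : ℝ) :
    C2Bound s (fun x => c * f x) (fun x => c * f' x) (|c| * K) where
  nonneg := mul_nonneg (abs_nonneg c) hf.nonneg
  hasDerivAt x hx := (hf.hasDerivAt x hx).const_mul c
  bound x hx := by
    rw [abs_mul]; exact mul_le_mul_of_nonneg_left (hf.bound x hx) (abs_nonneg c)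
  bound_deriv x hx := by
    rw [abs_mul]; exact mul_le_mul_of_nonneg_left (hf.bound_deriv x hx) (abs_nonneg c)
  lipschitz x hx y hy := by
    rw [← mul_sub, abs_mul, mul_assoc]
    exact mul_le_mul_of_nonneg_left (hf.lipschitz x hx y hy) (abs_nonneg c)

theorem add (hf : C2Bound s f f' K) (hg : C2Bound s g g' L) :
    C2Bound s (fun x => f x + g x) (fun x => f' x + g' x) (K + L) where
  nonneg := add_nonneg hf.nonneg hg.nonneg
  hasDerivAt x hx := (hf.hasDerivAt x hx).add (hg.hasDerivAt x hx)
  bound x hx := (abs_add_le _ _).trans (add_le_add (hf.bound x hx) (hg.bound x hx))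
  bound_deriv x hx :=
    (abs_add_le _ _).trans (add_le_add (hf.bound_deriv x hx) (hg.bound_deriv x hx))
  lipschitz x hx y hy := by
    rw [add_sub_add_comm, add_mul]
    exact (abs_add_le _ _).trans (add_le_add (hf.lipschitz x hx y hy) (hg.lipschitz x hx y hy))

theorem mul (hs : Convex ℝ s) (hf : C2Bound s f f' K) (hg : C2Bound s g g' L) :
    C2Bound s (fun x => f x * g x) (fun x => f' x * g x + f x * g' x) (4 * (K * L)) where
  nonneg := by have := mul_nonneg hf.nonneg hg.nonneg; linarith
  hasDerivAt x hx := (hf.hasDerivAt x hx).mul (hg.hasDerivAt x hx)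
  bound x hx := by
    have h0 := mul_nonneg hf.nonneg hg.nonneg
    have := mul_le_mul (hf.bound x hx) (hg.bound x hx) (abs_nonneg _) hf.nonneg
    rw [abs_mul]; linarith
  bound_deriv x hx := by
    have h0 := mul_nonneg hf.nonneg hg.nonneg
    have h1 := mul_le_mul (hf.bound_deriv x hx) (hg.bound x hx) (abs_nonneg _) hf.nonneg
    have h2 := mul_le_mul (hf.bound x hx) (hg.bound_deriv x hx) (abs_nonneg _) hf.nonneg
    refine (abs_add_le _ _).trans ?_
    rw [abs_mul, abs_mul]; linarith
  lipschitz x hx y hy := by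
    rw [add_sub_add_comm]
    have h1 := abs_mul_sub_mul_le (hf.bound_deriv x hx) (hg.bound y hy)
      (hf.lipschitz x hx y hy) (hg.abs_sub_le hs hx hy)
    have h2 := abs_mul_sub_mul_le (hf.bound x hx) (hg.bound_deriv y hy)
      (hf.abs_sub_le hs hx hy) (hg.lipschitz x hx y hy)
    refine (abs_add_le _ _).trans ((add_le_add h1 h2).trans (le_of_eq ?_))
    ring

/-- A bound on `f` itself is automatic if `f` has a zero in a set of diameter at most `2`. -/
theorem of_deriv (hs : Convex ℝ s) {x₀ : ℝ} (hx₀ : x₀ ∈ s) (hd : ∀ x ∈ s, |x - x₀| ≤ 2)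
    (hf : ∀ x ∈ s, HasDerivAt f (f' x) x) (h0 : f x₀ = 0) (hK : ∀ x ∈ s, |f' x| ≤ K)
    (hl : ∀ x ∈ s, ∀ y ∈ s, |f' x - f' y| ≤ K * |x - y|) : C2Bound s f f' (2 * K) := by
  have hK0 : 0 ≤ K := (abs_nonneg _).trans (hK x₀ hx₀)
  refine ⟨by linarith, hf, fun x hx => ?_, fun x hx => (hK x hx).trans (by linarith),
    fun x hx y hy => (hl x hx y hy).trans ?_⟩
  · have h1 := abs_sub_le_of_hasDerivAt hs hf hK hx hx₀
    rw [h0, sub_zero] at h1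
    nlinarith [hd x hx]
  · exact mul_le_mul_of_nonneg_right (by linarith) (abs_nonneg _)

theorem inv (hs : Convex ℝ s) (hf : C2Bound s f f' K) {c : ℝ} (hc : 0 < c)
    (hfc : ∀ x ∈ s, c ≤ f x) :
    C2Bound s (fun x => (f x)⁻¹) (fun x => -f' x / f x ^ 2)
      (c⁻¹ + K * c⁻¹ ^ 2 + 2 * K ^ 2 * c⁻¹ ^ 3) := by
  have hK := hf.nonneg
  have hci : 0 < c⁻¹ := inv_pos.2 hc
  have hpos (x : ℝ) (hx : x ∈ s) : 0 < f x := hc.trans_le (hfc x hx)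
  have hinv (x : ℝ) (hx : x ∈ s) : |(f x)⁻¹| ≤ c⁻¹ := by
    rw [abs_of_pos (inv_pos.2 (hpos x hx))]
    exact inv_anti₀ hc (hfc x hx)
  have hder (x : ℝ) (hx : x ∈ s) : |-f' x / f x ^ 2| ≤ K * c⁻¹ ^ 2 := by
    rw [div_eq_mul_inv, ← inv_pow, abs_mul, abs_neg, abs_pow]
    exact mul_le_mul (hf.bound_deriv x hx) (pow_le_pow_left₀ (abs_nonneg _) (hinv x hx) 2)
      (by positivity) hK
  have hderiv (x : ℝ) (hx : x ∈ s) : HasDerivAt (fun x => (f x)⁻¹) (-f' x / f x ^ 2) x :=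
    (hf.hasDerivAt x hx).fun_inv (hpos x hx).ne'
  have h2 : 0 ≤ K * c⁻¹ ^ 2 := by positivity
  have h3 : 0 ≤ 2 * K ^ 2 * c⁻¹ ^ 3 := by positivity
  refine ⟨by positivity, hderiv, fun x hx => (hinv x hx).trans (by linarith),
    fun x hx => (hder x hx).trans (by linarith), fun x hx y hy => ?_⟩
  have hl := abs_sub_le_of_hasDerivAt hs hderiv hder hx hy
  have hl2 := abs_mul_sub_mul_le (hinv x hx) (hinv y hy) hl hl
  have h4 := abs_mul_sub_mul_le (hf.bound_deriv x hx) (d := (f y)⁻¹ * (f y)⁻¹)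
    (Kb := c⁻¹ ^ 2) (by
      rw [abs_mul, pow_two]
      exact mul_le_mul (hinv y hy) (hinv y hy) (abs_nonneg _) hci.le)
    (hf.lipschitz x hx y hy) hl2
  have h5 : -f' x / f x ^ 2 - -f' y / f y ^ 2 =
      -(f' x * ((f x)⁻¹ * (f x)⁻¹) - f' y * ((f y)⁻¹ * (f y)⁻¹)) := by
    rw [div_eq_mul_inv, div_eq_mul_inv]; ring
  rw [h5, abs_neg]
  refine h4.trans (mul_le_mul_of_nonneg_right ?_ (abs_nonneg _))
  linarith

theorem log (hs : Convex ℝ s) (hf : C2Bound s f f' K) {c : ℝ} (hc : 0 < c)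
    (hfc : ∀ x ∈ s, c ≤ f x) {x₀ : ℝ} (hx₀ : x₀ ∈ s) (hd : ∀ x ∈ s, |x - x₀| ≤ 2) :
    C2Bound s (fun x => Real.log (f x) - Real.log (f x₀)) (fun x => f' x / f x)
      (2 * (K * c⁻¹ + K ^ 2 * c⁻¹ ^ 2)) := by
  have hK := hf.nonneg
  have hci : 0 < c⁻¹ := inv_pos.2 hc
  have hpos (x : ℝ) (hx : x ∈ s) : 0 < f x := hc.trans_le (hfc x hx)
  have hinv (x : ℝ) (hx : x ∈ s) : |(f x)⁻¹| ≤ c⁻¹ := by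
    rw [abs_of_pos (inv_pos.2 (hpos x hx))]
    exact inv_anti₀ hc (hfc x hx)
  have h2 : 0 ≤ K ^ 2 * c⁻¹ ^ 2 := by positivity
  refine of_deriv hs hx₀ hd (fun x hx => ?_) (sub_self _) (fun x hx => ?_)
    (fun x hx y hy => ?_)
  · exact ((hf.hasDerivAt x hx).log (hpos x hx).ne').sub_const _
  · rw [div_eq_mul_inv, abs_mul]
    have := mul_le_mul (hf.bound_deriv x hx) (hinv x hx) (abs_nonneg _) hK
    linarith
  · have hl : |(f x)⁻¹ - (f y)⁻¹| ≤ K * c⁻¹ ^ 2 * |x - y| := by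
      have h3 : (f x)⁻¹ - (f y)⁻¹ = -((f x - f y) * ((f x)⁻¹ * (f y)⁻¹)) := by
        have := (hpos x hx).ne'
        have := (hpos y hy).ne'
        field_simp
        ring
      rw [h3, abs_neg, abs_mul, abs_mul, mul_right_comm]
      refine mul_le_mul (hf.abs_sub_le hs hx hy) ?_ (by positivity) (by positivity)
      rw [pow_two]
      exact mul_le_mul (hinv x hx) (hinv y hy) (abs_nonneg _) hci.le
    rw [div_eq_mul_inv, div_eq_mul_inv]
    refine (abs_mul_sub_mul_le (hf.bound_deriv x hx) (hinv y hy)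
      (hf.lipschitz x hx y hy) hl).trans (le_of_eq ?_)
    ring

/-- The bound for `n (e^{f/n} - 1)` is uniform in `n ≥ 1`. -/
theorem exp_sub_one (hs : Convex ℝ s) (hf : C2Bound s f f' K) {n : ℝ} (hn : 1 ≤ n)
    {x₀ : ℝ} (hx₀ : x₀ ∈ s) (hd : ∀ x ∈ s, |x - x₀| ≤ 2) (h0 : f x₀ = 0) :
    C2Bound s (fun x => n * (Real.exp (f x / n) - 1)) (fun x => Real.exp (f x / n) * f' x)
      (2 * (Real.exp K * K + Real.exp K * K ^ 2)) := by
  have hK := hf.nonneg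
  have hn0 : 0 < n := by linarith
  have hexp (x : ℝ) (hx : x ∈ s) : |Real.exp (f x / n)| ≤ Real.exp K := by
    rw [abs_of_pos (Real.exp_pos _)]
    refine Real.exp_le_exp.2 ((div_le_div_of_nonneg_right
      ((le_abs_self _).trans (hf.bound x hx)) hn0.le).trans ?_)
    exact div_le_self hK hn
  have hder (x : ℝ) (hx : x ∈ s) :
      HasDerivAt (fun x => Real.exp (f x / n)) (Real.exp (f x / n) * (f' x / n)) x :=
    ((hf.hasDerivAt x hx).div_const n).exp
  have hprod (x : ℝ) (hx : x ∈ s) : |Real.exp (f x / n) * f' x| ≤ Real.exp K * K := by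
    rw [abs_mul]
    exact mul_le_mul (hexp x hx) (hf.bound_deriv x hx) (abs_nonneg _) (Real.exp_pos K).le
  have h2 : 0 ≤ Real.exp K * K ^ 2 := by positivity
  refine of_deriv hs hx₀ hd (fun x hx => ?_) (by simp [h0]) (fun x hx => ?_)
    (fun x hx y hy => ?_)
  · refine (((hder x hx).sub_const 1).const_mul n).congr_deriv ?_
    field_simp
  · exact (hprod x hx).trans (by linarith)
  · have hl := abs_sub_le_of_hasDerivAt hs hder (K := Real.exp K * K) (fun x hx => by
      rw [mul_div_assoc', abs_div, abs_of_pos hn0]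
      exact (div_le_self (abs_nonneg _) hn).trans (hprod x hx)) hx hy
    refine (abs_mul_sub_mul_le (hexp x hx) (hf.bound_deriv y hy) hl
      (hf.lipschitz x hx y hy)).trans (le_of_eq ?_)
    ring

end C2Bound

/-- A minimiser of a quadratic function plus a perturbation solves the first order condition
approximately. -/
theorem approxRoot_of_isMinOn {s : Set ℝ} (hs : Convex ℝ s) (hs1 : ∀ x ∈ s, |x| ≤ 1)
    {x₀ δ₀ A T V Y K c x : ℝ} {R r q : ℝ → ℝ} (hδ₀ : 0 < δ₀) (hball : Metric.ball x₀ δ₀ ⊆ s)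
    (hR : C2Bound s R r K)
    (hq : ∀ y ∈ s, q y = c + (1 / 2 * (T * A + Y) * (y - x₀) ^ 2 - V * (y - x₀)) - R y)
    (hx : x ∈ s) (hmin : IsMinOn q s x) : ApproxRoot A δ₀ T (x - x₀) V Y K (r x₀) := by
  have hx₀ : x₀ ∈ s := hball (Metric.mem_ball_self hδ₀)
  refine ⟨?_, ?_, fun hθ => ?_, hR.bound_deriv x₀ hx₀⟩
  · exact (abs_sub _ _).trans (by linarith [hs1 x hx, hs1 x₀ hx₀])
  · have h1 : q x ≤ q x₀ := hmin hx₀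
    rw [hq x hx, hq x₀ hx₀] at h1
    have h2 := (le_abs_self _).trans (hR.abs_sub_le hs hx hx₀)
    have h3 : V * (x - x₀) ≤ |V| * |x - x₀| := by
      rw [← abs_mul]; exact le_abs_self _
    rcases eq_or_lt_of_le (abs_nonneg (x - x₀)) with h0 | h0
    · rw [← h0, mul_zero]
      have := hR.nonneg
      positivity
    · refine le_of_mul_le_mul_right ?_ h0
      have h4 : (T * A + Y) * |x - x₀| * |x - x₀| = (T * A + Y) * (x - x₀) ^ 2 := by
        rw [mul_assoc, ← pow_two, sq_abs]
      rw [h4]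
      simp only [sub_self] at h1
      nlinarith
  · have hxb : x ∈ Metric.ball x₀ δ₀ := by rwa [Metric.mem_ball, Real.dist_eq]
    have hnhds : s ∈ 𝓝 x := Filter.mem_of_superset (Metric.isOpen_ball.mem_nhds hxb) hball
    have hder : HasDerivAt (fun y => c + (1 / 2 * (T * A + Y) * (y - x₀) ^ 2 - V * (y - x₀)) - R y)
        ((T * A + Y) * (x - x₀) - V - r x) x := by
      have h1 : HasDerivAt (fun y => y - x₀) 1 x := (hasDerivAt_id x).sub_const x₀
      have h2 := ((((h1.pow 2).const_mul (1 / 2 * (T * A + Y))).sub (h1.const_mul V)).const_add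
        c).sub (hR.hasDerivAt x hx)
      refine h2.congr_deriv ?_
      push_cast
      ring
    -- close to `x₀` the minimiser is an interior point, where the derivative vanishes
    have hq' : q =ᶠ[𝓝 x]
        fun y => c + (1 / 2 * (T * A + Y) * (y - x₀) ^ 2 - V * (y - x₀)) - R y :=
      Filter.mem_of_superset hnhds hq
    have h3 := (hmin.isLocalMin hnhds).hasDerivAt_eq_zero (hder.congr_of_eventuallyEq hq')
    have h4 : (T * A + Y) * (x - x₀) - V - r x₀ = r x - r x₀ := by linarith
    rw [h4]
    exact hR.lipschitz x hx x₀ hx₀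

/-! ### The concentrated level -/

/-- The inner product of residuals and level coefficients, as a function of the autoregressive
parameter; `a` and `b` are the first and last value of the centred series, and `z` is the sum of
all values but the last. -/
def levelNum (a b z φ : ℝ) : ℝ := φ * a + (1 - φ) * b + (1 - φ) ^ 2 * z

/-- The derivative of `levelNum`. -/
def levelNumDeriv (a b z φ : ℝ) : ℝ := a - b - 2 * (1 - φ) * z

/-- The sum of squared level coefficients divided by `n`, for a sample of size `n + 1`. -/
noncomputable def levelDen (n φ : ℝ) : ℝ := 1 / n + (1 - φ) ^ 2

/-- The reduction of the sum of squares that is due to concentrating out the level. -/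
noncomputable def levelGain (n a b z φ : ℝ) : ℝ :=
  1 / n * (levelNum a b z φ * levelNum a b z φ * (levelDen n φ)⁻¹)

/-- The derivative of `levelGain`. -/
noncomputable def levelGainDeriv (n a b z φ : ℝ) : ℝ :=
  1 / n * ((levelNumDeriv a b z φ * levelNum a b z φ + levelNum a b z φ * levelNumDeriv a b z φ) *
    (levelDen n φ)⁻¹ + levelNum a b z φ * levelNum a b z φ *
      (-(-2 * (1 - φ)) / levelDen n φ ^ 2))

theorem levelGain_eq {n : ℝ} (hn : 0 < n) (a b z φ : ℝ) :
    levelGain n a b z φ = levelNum a b z φ ^ 2 / (1 + n * (1 - φ) ^ 2) := by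
  have h : levelDen n φ = (1 + n * (1 - φ) ^ 2) / n := by
    rw [levelDen]; field_simp
  have h2 : 0 < 1 + n * (1 - φ) ^ 2 := by positivity
  rw [levelGain, h]
  field_simp

section

variable {s : Set ℝ} {κ : ℝ}

theorem c2Bound_levelNum (hs1 : ∀ x ∈ s, |x| ≤ 1) (a b z : ℝ) :
    C2Bound s (levelNum a b z) (levelNumDeriv a b z) (5 * (|a| + |b| + |z|)) := by
  have ha := abs_nonneg a
  have hb := abs_nonneg b
  have hz := abs_nonneg z
  have h1 (x : ℝ) (hx : x ∈ s) : |1 - x| ≤ 2 :=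
    (abs_sub _ _).trans (by rw [abs_one]; linarith [hs1 x hx])
  refine ⟨by positivity, fun x _ => ?_, fun x hx => ?_, fun x hx => ?_, fun x _ y _ => ?_⟩
  · have h2 : HasDerivAt (fun y : ℝ => 1 - y) (-1) x := (hasDerivAt_id x).const_sub 1
    refine ((((hasDerivAt_id x).mul_const a).add (h2.mul_const b)).add
      ((h2.pow 2).mul_const z)).congr_deriv ?_
    rw [levelNumDeriv]
    push_cast
    ring
  · rw [levelNum]
    refine (abs_add_le _ _).trans ((add_le_add_left (abs_add_le _ _) _).trans ?_)
    rw [abs_mul, abs_mul, abs_mul, abs_pow]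
    have e1 := mul_le_mul_of_nonneg_right (hs1 x hx) ha
    have e2 := mul_le_mul_of_nonneg_right (h1 x hx) hb
    have e3 := mul_le_mul_of_nonneg_right (pow_le_pow_left₀ (abs_nonneg _) (h1 x hx) 2) hz
    linarith
  · rw [levelNumDeriv]
    refine (abs_sub _ _).trans ((add_le_add_left (abs_sub _ _) _).trans ?_)
    rw [abs_mul, abs_mul, abs_two]
    have e3 := mul_le_mul_of_nonneg_right (h1 x hx) hz
    linarith
  · have h2 : levelNumDeriv a b z x - levelNumDeriv a b z y = 2 * z * (x - y) := by
      simp only [levelNumDeriv]; ring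
    rw [h2, abs_mul, abs_mul, abs_two]
    exact mul_le_mul_of_nonneg_right (by linarith) (abs_nonneg _)

/-- Dividing by `n` makes the bound uniform in the sample size. -/
theorem c2Bound_levelDen (hs1 : ∀ x ∈ s, |x| ≤ 1) {n : ℝ} (hn : 1 ≤ n) :
    C2Bound s (levelDen n) (fun x => -2 * (1 - x)) 5 := by
  have h1 (x : ℝ) (hx : x ∈ s) : |1 - x| ≤ 2 :=
    (abs_sub _ _).trans (by rw [abs_one]; linarith [hs1 x hx])
  have hn0 : 0 < n := by linarith
  refine ⟨by norm_num, fun x _ => ?_, fun x hx => ?_, fun x hx => ?_, fun x _ y _ => ?_⟩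
  · have h2 : HasDerivAt (fun y : ℝ => 1 - y) (-1) x := (hasDerivAt_id x).const_sub 1
    refine ((h2.pow 2).const_add (1 / n)).congr_deriv ?_
    push_cast
    ring
  · have h3 : 1 / n ≤ 1 := by rw [div_le_one hn0]; exact hn
    have h4 : (1 - x) ^ 2 ≤ 4 := by
      rw [← sq_abs]; nlinarith [h1 x hx, abs_nonneg (1 - x)]
    rw [levelDen, abs_of_nonneg (by positivity)]
    linarith
  · rw [abs_mul]; norm_num; linarith [h1 x hx]
  · have : -2 * (1 - x) - -2 * (1 - y) = 2 * (x - y) := by ring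
    rw [this, abs_mul, abs_two]
    exact mul_le_mul_of_nonneg_right (by norm_num) (abs_nonneg _)

theorem le_levelDen (hκ : 0 < κ) (hsκ : ∀ x ∈ s, κ ≤ 1 - x) {n : ℝ} (hn : 1 ≤ n) :
    ∀ x ∈ s, κ ^ 2 ≤ levelDen n x := by
  intro x hx
  have : 0 ≤ 1 / n := by positivity
  have := pow_le_pow_left₀ hκ.le (hsκ x hx) 2
  rw [levelDen]; linarith

theorem exists_c2Bound_levelGain (hs : Convex ℝ s) (hs1 : ∀ x ∈ s, |x| ≤ 1) (hκ : 0 < κ)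
    (hsκ : ∀ x ∈ s, κ ≤ 1 - x) : ∃ M, 0 ≤ M ∧ ∀ n a b z : ℝ, 1 ≤ n →
      C2Bound s (levelGain n a b z) (levelGainDeriv n a b z)
        (M * ((|a| + |b| + |z|) ^ 2 / n)) := by
  set L := (κ ^ 2)⁻¹ + 5 * (κ ^ 2)⁻¹ ^ 2 + 2 * 5 ^ 2 * (κ ^ 2)⁻¹ ^ 3 with hL
  refine ⟨400 * L, by positivity, fun n a b z hn => ?_⟩
  have hB := c2Bound_levelNum hs1 a b z
  have hD := (c2Bound_levelDen hs1 hn).inv hs (by positivity) (le_levelDen hκ hsκ hn)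
  refine (((hB.mul hs hB).mul hs hD).const_mul (1 / n)).mono (le_of_eq ?_)
  have hn0 : 0 < n := by linarith
  rw [abs_of_pos (by positivity), ← hL]
  ring

/-- The logarithmic change of the modification term, times `n`. -/
noncomputable def logModification (x₀ n x : ℝ) : ℝ :=
  Real.log (levelDen n x) - Real.log (levelDen n x₀)

/-- The relative change of the modification term between `x₀` and `x`, times `n`. -/
noncomputable def modificationGain (x₀ n x : ℝ) : ℝ :=
  n * (Real.exp (logModification x₀ n x / n) - 1)

/-- The derivative of `modificationGain`. -/
noncomputable def modificationGainDeriv (x₀ n x : ℝ) : ℝ :=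
  Real.exp (logModification x₀ n x / n) * (-2 * (1 - x) / levelDen n x)

theorem exists_c2Bound_modificationGain (hs : Convex ℝ s) (hs1 : ∀ x ∈ s, |x| ≤ 1) (hκ : 0 < κ)
    (hsκ : ∀ x ∈ s, κ ≤ 1 - x) {x₀ : ℝ} (hx₀ : x₀ ∈ s) : ∃ M, 0 ≤ M ∧ ∀ n : ℝ, 1 ≤ n →
      C2Bound s (modificationGain x₀ n) (modificationGainDeriv x₀ n) M := by
  set L := 2 * (5 * (κ ^ 2)⁻¹ + 5 ^ 2 * (κ ^ 2)⁻¹ ^ 2) with hL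
  refine ⟨2 * (Real.exp L * L + Real.exp L * L ^ 2), by positivity, fun n hn => ?_⟩
  have hd (x : ℝ) (hx : x ∈ s) : |x - x₀| ≤ 2 :=
    (abs_sub _ _).trans (by linarith [hs1 x hx, hs1 x₀ hx₀])
  exact ((c2Bound_levelDen hs1 hn).log hs (by positivity) (le_levelDen hκ hsκ hn) hx₀
    hd).exp_sub_one hs hn hx₀ hd (sub_self _)

end

/-! ### Moments of the perturbations -/

/-- The sum `∑ e_s²` of squared innovations. -/
def innovSq {Ω : Type*} (e : ℕ → Ω → ℝ) (T : ℕ) (w : Ω) : ℝ := ∑ s ∈ Finset.range T, e s w ^ 2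

/-- `levelGain` of a sample of size `T` from the centred AR(1) process. -/
noncomputable def sampleGain {Ω : Type*} (φ₀ : ℝ) (e : ℕ → Ω → ℝ) (T : ℕ) (w : Ω) (φ : ℝ) : ℝ :=
  levelGain (T - 1) (arProc φ₀ e 1 w) (arProc φ₀ e T w) (levelSum φ₀ e T w) φ

/-- The derivative of `sampleGain` in `φ`. -/
noncomputable def sampleGainDeriv {Ω : Type*} (φ₀ : ℝ) (e : ℕ → Ω → ℝ) (T : ℕ) (w : Ω) (φ : ℝ) :
    ℝ :=
  levelGainDeriv (T - 1) (arProc φ₀ e 1 w) (arProc φ₀ e T w) (levelSum φ₀ e T w) φ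

/-- The order of magnitude of `sampleGain` and its first two derivatives. -/
noncomputable def gainBound {Ω : Type*} (φ₀ : ℝ) (e : ℕ → Ω → ℝ) (T : ℕ) (w : Ω) : ℝ :=
  (|arProc φ₀ e 1 w| + |arProc φ₀ e T w| + |levelSum φ₀ e T w|) ^ 2 / ((T : ℝ) - 1)

/-- Half the sum of squared residuals at the true level, which is quadratic in `φ`. -/
noncomputable def sampleObj {Ω : Type*} (φ₀ : ℝ) (e : ℕ → Ω → ℝ) (T : ℕ) (w : Ω) (φ : ℝ) : ℝ :=
  1 / 2 * innovSq e T w +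
    (1 / 2 * sqSum φ₀ e T w * (φ - φ₀) ^ 2 - scoreSum φ₀ e T w * (φ - φ₀))

/-- The difference between `sampleObj` and the modified profile objective, the latter divided by
its modification term at `φ₀`. -/
noncomputable def modifiedGain {Ω : Type*} (φ₀ : ℝ) (e : ℕ → Ω → ℝ) (T : ℕ) (w : Ω) (φ : ℝ) : ℝ :=
  -1 * (modificationGain φ₀ (T - 1) φ *
    (1 / ((T : ℝ) - 1) * (sampleObj φ₀ e T w φ + -1 / 2 * sampleGain φ₀ e T w φ))) +
  1 / 2 * sampleGain φ₀ e T w φ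

/-- The derivative of `modifiedGain` in `φ`. -/
noncomputable def modifiedGainDeriv {Ω : Type*} (φ₀ : ℝ) (e : ℕ → Ω → ℝ) (T : ℕ) (w : Ω)
    (φ : ℝ) : ℝ :=
  -1 * (modificationGainDeriv φ₀ (T - 1) φ *
      (1 / ((T : ℝ) - 1) * (sampleObj φ₀ e T w φ + -1 / 2 * sampleGain φ₀ e T w φ)) +
    modificationGain φ₀ (T - 1) φ * (1 / ((T : ℝ) - 1) *
      ((sqSum φ₀ e T w * (φ - φ₀) - scoreSum φ₀ e T w) +
        -1 / 2 * sampleGainDeriv φ₀ e T w φ))) +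
  1 / 2 * sampleGainDeriv φ₀ e T w φ

theorem c2Bound_quadratic {s : Set ℝ} (hs1 : ∀ x ∈ s, |x| ≤ 1) {x₀ : ℝ} (hx₀ : x₀ ∈ s)
    (c W V : ℝ) : C2Bound s (fun x => c + (1 / 2 * W * (x - x₀) ^ 2 - V * (x - x₀)))
      (fun x => W * (x - x₀) - V) (|c| + 2 * |V| + 2 * |W|) := by
  have hd (x : ℝ) (hx : x ∈ s) : |x - x₀| ≤ 2 :=
    (abs_sub _ _).trans (by linarith [hs1 x hx, hs1 x₀ hx₀])
  have hc := abs_nonneg c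
  have hV := abs_nonneg V
  have hW := abs_nonneg W
  refine ⟨by positivity, fun x _ => ?_, fun x hx => ?_, fun x hx => ?_, fun x _ y _ => ?_⟩
  · have h1 : HasDerivAt (fun y => y - x₀) 1 x := (hasDerivAt_id x).sub_const x₀
    refine ((((h1.pow 2).const_mul (1 / 2 * W)).sub (h1.const_mul V)).const_add c).congr_deriv ?_
    push_cast
    ring
  · have h1 : |1 / 2 * W * (x - x₀) ^ 2| ≤ 2 * |W| := by
      rw [abs_mul, abs_mul, abs_pow, abs_of_pos (show (0 : ℝ) < 1 / 2 by norm_num)]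
      have := mul_le_mul_of_nonneg_left (pow_le_pow_left₀ (abs_nonneg _) (hd x hx) 2) hW
      linarith
    have h2 : |V * (x - x₀)| ≤ 2 * |V| := by
      rw [abs_mul]
      have := mul_le_mul_of_nonneg_left (hd x hx) hV
      linarith
    refine (abs_add_le _ _).trans ?_
    have := abs_sub (1 / 2 * W * (x - x₀) ^ 2) (V * (x - x₀))
    linarith
  · refine (abs_sub _ _).trans ?_
    rw [abs_mul]
    have := mul_le_mul_of_nonneg_left (hd x hx) hW
    linarith
  · have : W * (x - x₀) - V - (W * (y - x₀) - V) = W * (x - y) := by ring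
    rw [this, abs_mul]
    exact mul_le_mul_of_nonneg_right (by linarith) (abs_nonneg _)

section

variable {Ω : Type*} [mΩ : MeasurableSpace Ω] {P : Measure Ω} [IsProbabilityMeasure P]
  {e : ℕ → Ω → ℝ} {σ φ : ℝ}

theorem SqUI.l2Bounded_div {X : ℕ → Ω → ℝ} (hX : SqUI P X) (c : ℝ) :
    L2Bounded P fun T w => (X T w + T * c) / ((T : ℝ) - 1) := by
  obtain ⟨C, hC⟩ := hX.bdd
  have hm (T : ℕ) : MemLp (fun w => X T w + T * c) 2 P := (hX.memLp T).add (memLp_const _)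
  refine ⟨fun T => by simpa only [div_eq_mul_inv] using (hm T).mul_const ((T : ℝ) - 1)⁻¹, 8 * |C| + 8 * c ^ 2, ?_⟩
  filter_upwards [hC, eventually_ge_atTop 2] with T h1 hT
  have hT' : (2 : ℝ) ≤ T := by exact_mod_cast hT
  have hn : (T : ℝ) / 2 ≤ T - 1 := by linarith
  have i1 := (hX.memLp T).integrable_sq
  have h2 : ∫ w, (X T w + T * c) ^ 2 ∂P ≤ ∫ w, (2 * X T w ^ 2 + 2 * (T * c) ^ 2) ∂P := by
    refine integral_mono (hm T).integrable_sq ((i1.const_mul 2).add (integrable_const _))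
      fun w => ?_
    change (X T w + T * c) ^ 2 ≤ 2 * X T w ^ 2 + 2 * (T * c) ^ 2
    nlinarith [sq_nonneg (X T w - T * c)]
  rw [integral_add (i1.const_mul 2) (integrable_const _), integral_const_mul] at h2
  simp only [integral_const, probReal_univ, one_smul] at h2
  simp only [div_pow]
  rw [integral_div, div_le_iff₀ (by nlinarith)]
  have h3 : C * T ≤ |C| * T ^ 2 := by
    have h3a := mul_le_mul_of_nonneg_right (le_abs_self C) (Nat.cast_nonneg (α := ℝ) T)
    have h3b : 0 ≤ |C| * ((T : ℝ) * (T - 1)) :=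
      mul_nonneg (abs_nonneg C) (mul_nonneg (by linarith) (by linarith))
    nlinarith
  have h4 : ((T : ℝ) / 2) ^ 2 ≤ (T - 1) ^ 2 := pow_le_pow_left₀ (by positivity) hn 2
  have h5 : (8 * |C| + 8 * c ^ 2) * ((T : ℝ) / 2) ^ 2 ≤ (8 * |C| + 8 * c ^ 2) * (T - 1) ^ 2 :=
    mul_le_mul_of_nonneg_left h4 (by positivity)
  nlinarith

theorem tendsto_div_sub_one : Tendsto (fun T : ℕ => (T : ℝ) / ((T : ℝ) - 1)) atTop (𝓝 1) := by
  have h := (tendsto_const_div_atTop_nhds_zero_nat (1 : ℝ)).const_sub 1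
  rw [sub_zero] at h
  have h2 := h.inv₀ one_ne_zero
  rw [inv_one] at h2
  refine h2.congr' ?_
  filter_upwards [eventually_ge_atTop 2] with T hT
  have hT' : (2 : ℝ) ≤ T := by exact_mod_cast hT
  have : (T : ℝ) - 1 ≠ 0 := by linarith
  field_simp

theorem tendsto_levelDen (φ : ℝ) :
    Tendsto (fun T : ℕ => levelDen ((T : ℝ) - 1) φ) atTop (𝓝 ((1 - φ) ^ 2)) := by
  have h1 : Tendsto (fun T : ℕ => (T : ℝ) - 1) atTop atTop :=
    tendsto_atTop_add_const_right _ _ tendsto_natCast_atTop_atTop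
  have h2 := ((tendsto_const_nhds (x := (1 : ℝ))).div_atTop h1).add_const ((1 - φ) ^ 2)
  rwa [zero_add] at h2

theorem arProc_one (w : Ω) : arProc φ e 1 w = e 0 w := by
  rw [arProc_succ, arProc_zero]; ring

theorem levelNum_sample (T : ℕ) (w : Ω) :
    levelNum (arProc φ e 1 w) (arProc φ e T w) (levelSum φ e T w) φ =
      (1 - φ) * innovSum e T w + φ * e 0 w := by
  have h := levelSum_eq (φ := φ) (e := e) T w
  rw [levelNum, arProc_one, pow_two, mul_assoc, h]
  ring

theorem levelNumDeriv_sample (T : ℕ) (w : Ω) :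
    levelNumDeriv (arProc φ e 1 w) (arProc φ e T w) (levelSum φ e T w) φ =
      -2 * innovSum e T w + (e 0 w + arProc φ e T w) := by
  have h := levelSum_eq (φ := φ) (e := e) T w
  rw [levelNumDeriv, arProc_one, mul_assoc, h]
  ring

theorem innovSq_eq (σ : ℝ) (T : ℕ) (w : Ω) :
    innovSq e T w = weightedSum (fun x => x ^ 2 - σ ^ 2) (fun _ _ => 1) e T w + T * σ ^ 2 := by
  simp [innovSq, weightedSum]

theorem modifiedGainDeriv_self (T : ℕ) (w : Ω) : modifiedGainDeriv φ e T w φ =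
    (1 - φ) / levelDen (T - 1) φ / ((T : ℝ) - 1) * (innovSq e T w - sampleGain φ e T w φ) +
      1 / 2 * sampleGainDeriv φ e T w φ := by
  simp only [modifiedGainDeriv, modificationGainDeriv, modificationGain, logModification,
    sampleObj, sub_self, zero_div, Real.exp_zero]
  ring

namespace IsInnovation

variable (H : IsInnovation P e σ)
include H

theorem l2Bounded_gainBound (hφ : |φ| < 1) : L2Bounded P (gainBound φ e) := by
  obtain ⟨B, hB0, hB⟩ := H.exists_integral_arProc_pow_four_le hφ
  obtain ⟨C, hC0, hC⟩ := H.exists_integral_innovSum_pow_four_le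
  have hp : 0 < 1 - φ := by linarith [(abs_lt.1 hφ).2]
  set D := 8 / (1 - φ) ^ 4 with hD
  have hD0 : 0 < D := by positivity
  have iu (t : ℕ) := H.integrable_arProc_pow_four (φ := φ) hφ t
  have iE (T : ℕ) := H.integrable_innovSum_pow_four T
  have hms (T : ℕ) : Measurable fun w =>
      |arProc φ e 1 w| + |arProc φ e T w| + |levelSum φ e T w| :=
    ((H.measurable_ar 1).abs.add (H.measurable_ar T).abs).add
      (Finset.measurable_fun_sum _ fun s _ => H.measurable_ar s).abs
  have hpt (T : ℕ) (w : Ω) : (|arProc φ e 1 w| + |arProc φ e T w| + |levelSum φ e T w|) ^ 4 ≤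
      27 * (arProc φ e 1 w ^ 4 + arProc φ e T w ^ 4 +
        D * (innovSum e T w ^ 4 + arProc φ e T w ^ 4)) := by
    have h1 : levelSum φ e T w ^ 4 ≤ D * (innovSum e T w ^ 4 + arProc φ e T w ^ 4) := by
      have h2 : levelSum φ e T w = (innovSum e T w - arProc φ e T w) / (1 - φ) := by
        rw [eq_div_iff hp.ne', mul_comm, levelSum_eq]
      have h3 := Even.add_pow_le (n := 4) (a := innovSum e T w) (b := -arProc φ e T w) (by decide)
      rw [h2, div_pow, div_le_iff₀ (by positivity), hD, sub_eq_add_neg]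
      refine h3.trans (le_of_eq ?_)
      field_simp
      ring
    have h4 (a b c : ℝ) : (|a| + |b| + |c|) ^ 4 ≤ 27 * (a ^ 4 + b ^ 4 + c ^ 4) := by
      have h5 (x y z : ℝ) : (x + y + z) ^ 2 ≤ 3 * (x ^ 2 + y ^ 2 + z ^ 2) := by
        nlinarith [sq_nonneg (x - y), sq_nonneg (y - z), sq_nonneg (x - z)]
      have h6 := h5 |a| |b| |c|
      have h7 := h5 (|a| ^ 2) (|b| ^ 2) (|c| ^ 2)
      have h8 := pow_le_pow_left₀ (by positivity) h6 2
      simp only [sq_abs] at h7 h8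
      nlinarith
    refine (h4 _ _ _).trans ?_
    linarith
  have idom (T : ℕ) := ((((iu 1).add (iu T)).add (((iE T).add (iu T)).const_mul D)).const_mul 27)
  have i4 (T : ℕ) : Integrable
      (fun w => (|arProc φ e 1 w| + |arProc φ e T w| + |levelSum φ e T w|) ^ 4) P := by
    refine (idom T).mono' ((hms T).pow_const 4).aestronglyMeasurable (ae_of_all _ fun w => ?_)
    rw [Real.norm_of_nonneg (by positivity)]
    exact hpt T w
  have hsq (T : ℕ) (w : Ω) : gainBound φ e T w ^ 2 =
      (|arProc φ e 1 w| + |arProc φ e T w| + |levelSum φ e T w|) ^ 4 / ((T : ℝ) - 1) ^ 2 := by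
    rw [gainBound, div_pow, ← pow_mul]
  refine ⟨fun T => ?_, 4 * (27 * (B + B + D * (C + B))), ?_⟩
  · refine (memLp_two_iff_integrable_sq (((hms T).pow_const 2).div_const
      _).aestronglyMeasurable).2 ?_
    exact ((i4 T).div_const (((T : ℝ) - 1) ^ 2)).congr (ae_of_all _ fun w => (hsq T w).symm)
  · filter_upwards [eventually_ge_atTop 2] with T hT
    have hT' : (2 : ℝ) ≤ T := by exact_mod_cast hT
    have hn : (T : ℝ) / 2 ≤ T - 1 := by linarith
    have hn2 : ((T : ℝ) / 2) ^ 2 ≤ (T - 1) ^ 2 := pow_le_pow_left₀ (by positivity) hn 2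
    simp only [hsq]
    rw [integral_div, div_le_iff₀ (by nlinarith)]
    have h1 := integral_mono (i4 T) (idom T) (hpt T)
    have h2 : ∫ w, 27 * (arProc φ e 1 w ^ 4 + arProc φ e T w ^ 4 +
        D * (innovSum e T w ^ 4 + arProc φ e T w ^ 4)) ∂P ≤
        27 * (B + B + D * (C * (T : ℝ) ^ 2 + B)) := by
      rw [integral_const_mul, integral_add (by exact (iu 1).add (iu T))
        (by exact ((iE T).add (iu T)).const_mul D), integral_add (iu 1) (iu T),
        integral_const_mul, integral_add (iE T) (iu T)]
      have := hB 1
      have := hB T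
      have := hC T
      gcongr
    have h3 : 27 * (B + B + D * (C * (T : ℝ) ^ 2 + B)) ≤
        27 * (B + B + D * (C + B)) * (T : ℝ) ^ 2 := by
      have h5 : 0 ≤ (B + B + D * B) * ((T : ℝ) ^ 2 - 1) :=
        mul_nonneg (by positivity) (by nlinarith)
      nlinarith
    have h4 : 27 * (B + B + D * (C + B)) * (4 * ((T : ℝ) / 2) ^ 2) ≤
        27 * (B + B + D * (C + B)) * (4 * (T - 1) ^ 2) :=
      mul_le_mul_of_nonneg_left (by linarith) (by positivity)
    have h5 : (∫ w, (|arProc φ e 1 w| + |arProc φ e T w| + |levelSum φ e T w|) ^ 4 ∂P) ≤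
        27 * (B + B + D * (C * (T : ℝ) ^ 2 + B)) := h1.trans h2
    nlinarith

theorem tendsto_integral_innovSum_sq :
    Tendsto (fun T : ℕ => (∫ w, innovSum e T w ^ 2 ∂P) / T) atTop (𝓝 (σ ^ 2)) := by
  refine tendsto_const_nhds.congr' ?_
  filter_upwards [eventually_ge_atTop 1] with T hT
  have : (T : ℝ) ≠ 0 := by positivity
  rw [H.integral_innovSum_sq]
  field_simp

/-- Only the quadratic term in the sum of the innovations contributes in the limit. -/
theorem tendsto_integral_mul_innovSum {X Y : ℕ → Ω → ℝ} (hX : L2Bounded P X)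
    (hY : L2Bounded P Y) (a b : ℝ) :
    Tendsto (fun T : ℕ => (∫ w, (a * innovSum e T w + X T w) * (b * innovSum e T w + Y T w) ∂P) / T)
      atTop (𝓝 (a * b * σ ^ 2)) := by
  have hZ := (hX.const_mul b).add (hY.const_mul a)
  have h := ((H.tendsto_integral_innovSum_sq.const_mul (a * b)).add
    (H.sqUI_innovSum.tendsto_integral_mul hZ)).add (hX.sqUI.tendsto_integral_mul hY)
  simp only [add_zero] at h
  refine h.congr fun T => ?_
  have i1 := (H.memLp_innovSum T).integrable_sq
  have i2 := integrable_mul_of_sq (H.memLp_innovSum T) (hZ.memLp T)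
  have i3 := integrable_mul_of_sq (hX.memLp T) (hY.memLp T)
  have hexp (w : Ω) : (a * innovSum e T w + X T w) * (b * innovSum e T w + Y T w) =
      a * b * innovSum e T w ^ 2 + innovSum e T w * (b * X T w + a * Y T w) + X T w * Y T w := by
    ring
  simp only [hexp]
  rw [integral_add (by exact (i1.const_mul _).add i2) i3, integral_add (i1.const_mul _) i2,
    integral_const_mul]
  ring

theorem memLp_levelNum_sample (T : ℕ) :
    MemLp (fun w => (1 - φ) * innovSum e T w + φ * e 0 w) 2 P :=
  ((H.memLp_innovSum T).const_mul _).add (H.memLp_two.const_mul _)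

theorem memLp_levelNumDeriv_sample (hφ : |φ| < 1) (T : ℕ) :
    MemLp (fun w => -2 * innovSum e T w + (e 0 w + arProc φ e T w)) 2 P :=
  ((H.memLp_innovSum T).const_mul _).add (H.memLp_two.add (H.memLp_arProc hφ T))

theorem integrable_sampleGain (T : ℕ) : Integrable (fun w => sampleGain φ e T w φ) P := by
  simp only [sampleGain, levelGain, levelNum_sample]
  exact ((integrable_mul_of_sq (H.memLp_levelNum_sample T)
    (H.memLp_levelNum_sample T)).mul_const _).const_mul _

theorem integrable_sampleGainDeriv (hφ : |φ| < 1) (T : ℕ) :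
    Integrable (fun w => sampleGainDeriv φ e T w φ) P := by
  simp only [sampleGainDeriv, levelGainDeriv, levelNum_sample, levelNumDeriv_sample]
  have i1 := H.memLp_levelNum_sample (φ := φ) T
  have i2 := H.memLp_levelNumDeriv_sample hφ T
  exact (((((integrable_mul_of_sq i2 i1).add (integrable_mul_of_sq i1 i2)).mul_const _).add
    ((integrable_mul_of_sq i1 i1).mul_const _)).const_mul _)

theorem tendsto_integral_levelNum_sq :
    Tendsto (fun T : ℕ => (∫ w, ((1 - φ) * innovSum e T w + φ * e 0 w) *
      ((1 - φ) * innovSum e T w + φ * e 0 w) ∂P) / T) atTop (𝓝 ((1 - φ) * (1 - φ) * σ ^ 2)) :=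
  H.tendsto_integral_mul_innovSum ((L2Bounded.const H.memLp_two).const_mul φ)
    ((L2Bounded.const H.memLp_two).const_mul φ) _ _

/-- Concentrating out the level biases the score. -/
theorem tendsto_integral_sampleGainDeriv (hφ : |φ| < 1) :
    Tendsto (fun T : ℕ => ∫ w, 1 / 2 * sampleGainDeriv φ e T w φ ∂P) atTop
      (𝓝 (-σ ^ 2 / (1 - φ))) := by
  have hp : 0 < 1 - φ := by linarith [(abs_lt.1 hφ).2]
  have h1 := H.tendsto_integral_levelNum_sq (φ := φ)
  have h2 := H.tendsto_integral_mul_innovSum ((L2Bounded.const H.memLp_two).const_mul φ)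
    ((L2Bounded.const H.memLp_two).add (H.l2Bounded_arProc hφ)) (1 - φ) (-2)
  have hd := tendsto_levelDen φ
  have h3 := tendsto_div_sub_one.mul ((h2.div hd (by positivity)).add
    ((h1.const_mul (1 - φ)).div (hd.pow 2) (by positivity)))
  have hval : 1 * ((1 - φ) * -2 * σ ^ 2 / (1 - φ) ^ 2 + (1 - φ) * ((1 - φ) * (1 - φ) * σ ^ 2) /
      ((1 - φ) ^ 2) ^ 2) = -σ ^ 2 / (1 - φ) := by
    field_simp
    ring
  rw [hval] at h3
  refine h3.congr' ?_
  filter_upwards [eventually_ge_atTop 2] with T hT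
  have hT' : (2 : ℝ) ≤ T := by exact_mod_cast hT
  have hT0 : (T : ℝ) ≠ 0 := by linarith
  have hn : (0 : ℝ) < T - 1 := by linarith
  have hdp : 0 < levelDen (T - 1) φ := by rw [levelDen]; positivity
  have i1 := H.memLp_levelNum_sample (φ := φ) T
  have i2 := H.memLp_levelNumDeriv_sample hφ T
  have hexp (w : Ω) : 1 / 2 * sampleGainDeriv φ e T w φ = 1 / ((T : ℝ) - 1) *
      ((levelDen (T - 1) φ)⁻¹ * (((1 - φ) * innovSum e T w + φ * e 0 w) *
        (-2 * innovSum e T w + (e 0 w + arProc φ e T w))) +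
      (1 - φ) / levelDen (T - 1) φ ^ 2 * (((1 - φ) * innovSum e T w + φ * e 0 w) *
        ((1 - φ) * innovSum e T w + φ * e 0 w))) := by
    simp only [sampleGainDeriv, levelGainDeriv, levelNum_sample, levelNumDeriv_sample]
    ring
  simp only [hexp]
  rw [integral_const_mul, integral_add ((integrable_mul_of_sq i1 i2).const_mul _)
    ((integrable_mul_of_sq i1 i1).const_mul _), integral_const_mul, integral_const_mul]
  simp only [Pi.div_apply]
  generalize ∫ w, ((1 - φ) * innovSum e T w + φ * e 0 w) *
    (-2 * innovSum e T w + (e 0 w + arProc φ e T w)) ∂P = I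
  generalize ∫ w, ((1 - φ) * innovSum e T w + φ * e 0 w) *
    ((1 - φ) * innovSum e T w + φ * e 0 w) ∂P = J
  field_simp

theorem integrable_innovSq (T : ℕ) : Integrable (innovSq e T) P :=
  integrable_finsetSum _ fun s _ =>
    H.integrable_comp (g := fun x => x ^ 2) (measurable_id.pow_const 2)
      H.memLp_two.integrable_sq s

theorem integral_innovSq (T : ℕ) : ∫ w, innovSq e T w ∂P = T * σ ^ 2 := by
  unfold innovSq
  rw [integral_finsetSum _ fun s _ => H.integrable_comp (g := fun x => x ^ 2)
    (measurable_id.pow_const 2) H.memLp_two.integrable_sq s]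
  rw [Finset.sum_congr rfl fun s _ => (H.integral_comp (g := fun x => x ^ 2)
    (measurable_id.pow_const 2) s).trans H.var]
  simp

theorem integrable_modifiedGainDeriv (hφ : |φ| < 1) (T : ℕ) :
    Integrable (fun w => modifiedGainDeriv φ e T w φ) P := by
  simp only [modifiedGainDeriv_self]
  exact (((H.integrable_innovSq T).sub (H.integrable_sampleGain T)).const_mul _).add
    ((H.integrable_sampleGainDeriv hφ T).const_mul _)

/-- The modification term removes the bias of the profile score in the limit. -/
theorem tendsto_integral_modifiedGainDeriv (hφ : |φ| < 1) :
    Tendsto (fun T : ℕ => ∫ w, modifiedGainDeriv φ e T w φ ∂P) atTop (𝓝 0) := by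
  have hp : 0 < 1 - φ := by linarith [(abs_lt.1 hφ).2]
  have h1 := H.tendsto_integral_levelNum_sq (φ := φ)
  have hd := tendsto_levelDen φ
  have hn : Tendsto (fun T : ℕ => (T : ℝ) - 1) atTop atTop :=
    tendsto_atTop_add_const_right _ _ tendsto_natCast_atTop_atTop
  have h2 : Tendsto (fun T : ℕ => ∫ w, sampleGain φ e T w φ ∂P) atTop
      (𝓝 (1 * ((1 - φ) * (1 - φ) * σ ^ 2 / (1 - φ) ^ 2))) := by
    refine (tendsto_div_sub_one.mul (h1.div hd (by positivity))).congr' ?_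
    filter_upwards [eventually_ge_atTop 2] with T hT
    have hT' : (2 : ℝ) ≤ T := by exact_mod_cast hT
    have hT0 : (T : ℝ) ≠ 0 := by linarith
    have hn : (T : ℝ) - 1 ≠ 0 := by linarith
    simp only [sampleGain, levelGain, levelNum_sample]
    rw [integral_const_mul, integral_mul_const]
    simp only [Pi.div_apply]
    field_simp
  have h3 := ((((tendsto_const_nhds (x := 1 - φ)).div hd (by positivity)).mul ((tendsto_div_sub_one.mul_const
    (σ ^ 2)).sub (h2.div_atTop hn))).add (H.tendsto_integral_sampleGainDeriv hφ))
  have hval : (1 - φ) / (1 - φ) ^ 2 * (1 * σ ^ 2 - 0) + -σ ^ 2 / (1 - φ) = 0 := by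
    field_simp
    ring
  rw [hval] at h3
  refine h3.congr fun T => ?_
  simp only [modifiedGainDeriv_self]
  rw [integral_add (by exact ((H.integrable_innovSq T).sub (H.integrable_sampleGain T)).const_mul _)
    ((H.integrable_sampleGainDeriv hφ T).const_mul _), integral_const_mul, integral_const_mul,
    integral_sub (H.integrable_innovSq T) (H.integrable_sampleGain T), H.integral_innovSq]
  simp only [Pi.div_apply]
  ring

theorem exists_c2Bound_sampleGain (hφ : |φ| < 1) {s : Set ℝ} (hs : Convex ℝ s)
    (hs1 : ∀ x ∈ s, |x| ≤ 1) {κ : ℝ} (hκ : 0 < κ) (hsκ : ∀ x ∈ s, κ ≤ 1 - x) :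
    ∃ K : ℕ → Ω → ℝ, L2Bounded P K ∧ ∀ T : ℕ, 2 ≤ T → ∀ w,
      C2Bound s (fun x => 1 / 2 * sampleGain φ e T w x)
        (fun x => 1 / 2 * sampleGainDeriv φ e T w x) (K T w) := by
  obtain ⟨M, hM0, hM⟩ := exists_c2Bound_levelGain hs hs1 hκ hsκ
  refine ⟨_, (H.l2Bounded_gainBound hφ).const_mul (1 / 2 * M), fun T hT w => ?_⟩
  have hT' : (2 : ℝ) ≤ T := by exact_mod_cast hT
  refine ((hM ((T : ℝ) - 1) _ _ _ (by linarith)).const_mul (1 / 2)).mono (le_of_eq ?_)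
  rw [abs_of_pos (by norm_num), gainBound]
  ring

theorem exists_c2Bound_modifiedGain (hφ : |φ| < 1) {s : Set ℝ} (hs : Convex ℝ s)
    (hs1 : ∀ x ∈ s, |x| ≤ 1) {κ : ℝ} (hκ : 0 < κ) (hsκ : ∀ x ∈ s, κ ≤ 1 - x) (hφs : φ ∈ s) :
    ∃ K : ℕ → Ω → ℝ, L2Bounded P K ∧ ∀ T : ℕ, 2 ≤ T → ∀ w,
      C2Bound s (modifiedGain φ e T w) (modifiedGainDeriv φ e T w) (K T w) := by
  obtain ⟨M, hM0, hM⟩ := exists_c2Bound_levelGain hs hs1 hκ hsκ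
  obtain ⟨N, hN0, hN⟩ := exists_c2Bound_modificationGain hs hs1 hκ hsκ hφs
  have hg := H.l2Bounded_gainBound hφ
  have b1 := (H.sqUI_sum_sq_sub.l2Bounded_div (σ ^ 2)).abs.const_mul (1 / 2)
  have b2 := (((H.sqUI_scoreSum hφ).l2Bounded_div 0).abs).const_mul 2
  have b3 := (((H.sqUI_sqSum_sub hφ).l2Bounded_div (statVar φ σ)).abs).const_mul 2
  refine ⟨_, ((((b1.add b2).add b3).add (hg.const_mul (1 / 2 * M))).const_mul (4 * N)).add
    (hg.const_mul (1 / 2 * M)), fun T hT w => ?_⟩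
  have hT' : (2 : ℝ) ≤ T := by exact_mod_cast hT
  have hn : (1 : ℝ) ≤ T - 1 := by linarith
  have hn0 : (0 : ℝ) < T - 1 := by linarith
  have hG := hM ((T : ℝ) - 1) (arProc φ e 1 w) (arProc φ e T w) (levelSum φ e T w) hn
  have hO := c2Bound_quadratic hs1 hφs (1 / 2 * innovSq e T w) (sqSum φ e T w)
    (scoreSum φ e T w)
  refine ((((hN _ hn).mul hs ((hO.add (hG.const_mul (-1 / 2))).const_mul
    (1 / ((T : ℝ) - 1)))).const_mul (-1)).add (hG.const_mul (1 / 2))).mono ?_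
  rw [← innovSq_eq, sub_add_cancel, mul_zero, add_zero, abs_mul (1 / 2), abs_of_pos (show (0 : ℝ) < 1 / 2 by norm_num),
    show |(-1 / 2 : ℝ)| = 1 / 2 by rw [abs_of_neg] <;> norm_num, abs_neg, abs_one, one_mul,
    abs_of_pos (show 0 < 1 / ((T : ℝ) - 1) by positivity), abs_div, abs_div, abs_div,
    abs_of_pos hn0]
  change _ ≤ 4 * N * (1 / 2 * (|innovSq e T w| / ((T : ℝ) - 1)) +
    2 * (|scoreSum φ e T w| / ((T : ℝ) - 1)) + 2 * (|sqSum φ e T w| / ((T : ℝ) - 1)) +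
    1 / 2 * M * gainBound φ e T w) + 1 / 2 * M * gainBound φ e T w
  change 4 * (N * (1 / ((T : ℝ) - 1) * (1 / 2 * |innovSq e T w| + 2 * |scoreSum φ e T w| +
    2 * |sqSum φ e T w| + 1 / 2 * (M * gainBound φ e T w)))) +
    1 / 2 * (M * gainBound φ e T w) ≤ _
  have hg0 : 0 ≤ gainBound φ e T w := by rw [gainBound]; positivity
  have h1 : 1 / ((T : ℝ) - 1) * (1 / 2 * (M * gainBound φ e T w)) ≤
      1 / 2 * M * gainBound φ e T w := by
    have h2 : 1 / ((T : ℝ) - 1) ≤ 1 := by rw [div_le_one hn0]; exact hn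
    have h3 : 0 ≤ 1 / 2 * (M * gainBound φ e T w) := by positivity
    nlinarith
  have h4 : 1 / ((T : ℝ) - 1) * (1 / 2 * |innovSq e T w| + 2 * |scoreSum φ e T w| +
      2 * |sqSum φ e T w| + 1 / 2 * (M * gainBound φ e T w)) ≤
      1 / 2 * (|innovSq e T w| / ((T : ℝ) - 1)) +
        2 * (|scoreSum φ e T w| / ((T : ℝ) - 1)) + 2 * (|sqSum φ e T w| / ((T : ℝ) - 1)) +
        1 / 2 * M * gainBound φ e T w := by
    have h5 : 1 / ((T : ℝ) - 1) * (1 / 2 * |innovSq e T w| + 2 * |scoreSum φ e T w| +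
      2 * |sqSum φ e T w|) = 1 / 2 * (|innovSq e T w| / ((T : ℝ) - 1)) +
        2 * (|scoreSum φ e T w| / ((T : ℝ) - 1)) + 2 * (|sqSum φ e T w| / ((T : ℝ) - 1)) := by
      ring
    rw [mul_add, h5]
    linarith
  have h6 := mul_le_mul_of_nonneg_left h4 (show 0 ≤ 4 * N by positivity)
  linarith

end IsInnovation

end

/-! ### The objective functions as perturbed quadratic functions -/

theorem arError_congr (φ : ℝ) {e e' : ℕ → ℝ} (h : ∀ t, e (t + 1) = e' (t + 1)) (t : ℕ) :
    arError φ e t = arError φ e' t := by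
  induction t with
  | zero => rfl
  | succ t ih => rw [arError, arError, ih, h]

section

variable {Ω : Type*} [mΩ : MeasurableSpace Ω] {P : Measure Ω} [IsProbabilityMeasure P]
  {ε : ℕ → Ω → ℝ} {σ μ₀ φ₀ : ℝ} {x : Ω → ℕ → ℝ}

theorem arError_eq_arProc (φ : ℝ) (w : Ω) (t : ℕ) :
    arError φ (fun s => ε s w) t = arProc φ (fun s => ε (s + 1)) t w :=
  arError_congr φ (fun t => by rw [Nat.add_sub_cancel]) t

theorem cssResidual_eq (hx : ∀ w t, x w t = observation 0 μ₀ φ₀ (fun s => ε s w) t) (w : Ω)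
    (φ : ℝ) (t : ℕ) : cssResidual 0 φ μ₀ (x w) (t + 1) =
      ε (t + 1) w - (φ - φ₀) * arProc φ₀ (fun s => ε (s + 1)) t w := by
  rw [cssResidual_observation (hx w), arError_eq_arProc]

theorem knownLevelObj_eq (hx : ∀ w t, x w t = observation 0 μ₀ φ₀ (fun s => ε s w) t) (w : Ω)
    (T : ℕ) (φ : ℝ) :
    knownLevelObj μ₀ T (x w) 0 φ = sampleObj φ₀ (fun s => ε (s + 1)) T w φ := by
  rw [knownLevelObj_observation (hx w)]
  simp only [arError_eq_arProc]
  rfl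

theorem profileObj_eq (hx : ∀ w t, x w t = observation 0 μ₀ φ₀ (fun s => ε s w) t) (w : Ω)
    {T : ℕ} (hT : 2 ≤ T) (φ : ℝ) :
    profileObj T (x w) 0 φ = sampleObj φ₀ (fun s => ε (s + 1)) T w φ -
      1 / 2 * sampleGain φ₀ (fun s => ε (s + 1)) T w φ := by
  obtain ⟨n, rfl⟩ := Nat.exists_eq_add_of_le' (show 1 ≤ T by omega)
  have hn : (0 : ℝ) < ((n + 1 : ℕ) : ℝ) - 1 := by
    have : (2 : ℝ) ≤ ((n + 1 : ℕ) : ℝ) := by exact_mod_cast hT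
    linarith
  rw [profileObj_observation (hx w), knownLevelObj_eq hx, sampleGain, levelGain_eq hn, levelNum]
  simp only [arError_eq_arProc, Nat.cast_add, Nat.cast_one, add_sub_cancel_right]
  rfl

theorem modification_pos {T : ℕ} (hT : 2 ≤ T) (φ : ℝ) : 0 < modification T 0 φ := by
  obtain ⟨n, rfl⟩ := Nat.exists_eq_add_of_le' (show 1 ≤ T by omega)
  rw [modification, sumSqCoeff_zero_succ]
  positivity

theorem modification_eq {T : ℕ} (hT : 2 ≤ T) (φ₀ φ : ℝ) : modification T 0 φ =
    modification T 0 φ₀ * (1 + modificationGain φ₀ (T - 1) φ / ((T : ℝ) - 1)) := by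
  obtain ⟨n, rfl⟩ := Nat.exists_eq_add_of_le' (show 1 ≤ T by omega)
  have hn : 0 < (n : ℝ) := by exact_mod_cast (show 0 < n by omega)
  have hden (ψ : ℝ) : 1 + n * (1 - ψ) ^ 2 = n * levelDen n ψ := by
    rw [levelDen]; field_simp
  have hpos (ψ : ℝ) : 0 < levelDen n ψ := by rw [levelDen]; positivity
  rw [modification, modification, sumSqCoeff_zero_succ, sumSqCoeff_zero_succ, hden, hden,
    modificationGain, logModification]
  push_cast
  rw [add_sub_cancel_right, mul_div_cancel_left₀ _ hn.ne', add_sub_cancel,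
    Real.rpow_def_of_pos (mul_pos hn (hpos φ)), Real.rpow_def_of_pos (mul_pos hn (hpos φ₀)),
    ← Real.exp_add, Real.log_mul hn.ne' (hpos φ).ne', Real.log_mul hn.ne' (hpos φ₀).ne']
  congr 1
  ring

theorem modifiedObj_eq (hx : ∀ w t, x w t = observation 0 μ₀ φ₀ (fun s => ε s w) t) (w : Ω)
    {T : ℕ} (hT : 2 ≤ T) (φ : ℝ) :
    (modification T 0 φ₀)⁻¹ * modifiedObj T (x w) 0 φ = sampleObj φ₀ (fun s => ε (s + 1)) T w φ -
      modifiedGain φ₀ (fun s => ε (s + 1)) T w φ := by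
  have hm := (modification_pos hT φ₀).ne'
  rw [modifiedObj, modification_eq hT φ₀ φ, profileObj_eq hx w hT, modifiedGain, mul_assoc,
    inv_mul_cancel_left₀ hm]
  ring

theorem hasDerivAt_sampleObj (e : ℕ → Ω → ℝ) (T : ℕ) (w : Ω) :
    HasDerivAt (sampleObj φ₀ e T w) (-scoreSum φ₀ e T w) φ₀ := by
  have h1 : HasDerivAt (fun y => y - φ₀) 1 φ₀ := (hasDerivAt_id φ₀).sub_const φ₀
  refine ((((h1.pow 2).const_mul (1 / 2 * sqSum φ₀ e T w)).sub
    (h1.const_mul (scoreSum φ₀ e T w))).const_add (1 / 2 * innovSq e T w)).congr_deriv ?_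
  push_cast
  ring

/-! ### Exact biases -/

theorem residualDeriv_zero (hx : ∀ w t, x w t = observation 0 μ₀ φ₀ (fun s => ε s w) t) (t : ℕ)
    (w : Ω) : residualDeriv 0 x μ₀ φ₀ (t + 1) w = ε (t + 1) w := by
  rw [residualDeriv, iteratedDeriv_zero, cssResidual_eq hx]
  ring

theorem deriv_cssResidual (hx : ∀ w t, x w t = observation 0 μ₀ φ₀ (fun s => ε s w) t) (t : ℕ)
    (w : Ω) : deriv (fun φ => cssResidual 0 φ μ₀ (x w) (t + 1)) =
      fun _ => -arProc φ₀ (fun s => ε (s + 1)) t w := by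
  funext φ
  simp only [cssResidual_eq hx]
  have h : HasDerivAt (fun φ => ε (t + 1) w - (φ - φ₀) * arProc φ₀ (fun s => ε (s + 1)) t w)
      (-(1 * arProc φ₀ (fun s => ε (s + 1)) t w)) φ :=
    (((hasDerivAt_id φ).sub_const φ₀).mul_const _).const_sub _
  rw [h.deriv, one_mul]

theorem residualDeriv_one (hx : ∀ w t, x w t = observation 0 μ₀ φ₀ (fun s => ε s w) t) (t : ℕ)
    (w : Ω) : residualDeriv 1 x μ₀ φ₀ (t + 1) w = -arProc φ₀ (fun s => ε (s + 1)) t w := by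
  rw [residualDeriv, iteratedDeriv_one, deriv_cssResidual hx]

theorem residualDeriv_two (hx : ∀ w t, x w t = observation 0 μ₀ φ₀ (fun s => ε s w) t) (t : ℕ)
    (w : Ω) : residualDeriv 2 x μ₀ φ₀ (t + 1) w = 0 := by
  rw [residualDeriv, iteratedDeriv_succ, iteratedDeriv_one, deriv_cssResidual hx]
  simp

theorem exactF_eq_zero (hx : ∀ w t, x w t = observation 0 μ₀ φ₀ (fun s => ε s w) t) (T : ℕ) :
    exactF P x σ μ₀ φ₀ T = 0 := by
  simp [exactF, productMoment, sum_Icc_one_eq, residualDeriv_two hx]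

theorem exactC_eq_zero (hx : ∀ w t, x w t = observation 0 μ₀ φ₀ (fun s => ε s w) t) (T : ℕ) :
    exactC P x σ μ₀ φ₀ T = 0 := by
  simp [exactC, sum_Icc_one_eq, residualDeriv_two hx]

theorem exactG_eq (H : IsInnovation P (fun s => ε (s + 1)) σ) (hφ : |φ₀| < 1)
    (hx : ∀ w t, x w t = observation 0 μ₀ φ₀ (fun s => ε s w) t) {T : ℕ} (hT : 1 ≤ T) :
    exactG P x σ μ₀ φ₀ T = -((σ ^ 2)⁻¹ ^ 2 *
      ((∫ w, (sqSum φ₀ (fun s => ε (s + 1)) T w - T * statVar φ₀ σ) *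
        scoreSum φ₀ (fun s => ε (s + 1)) T w ∂P) / T)) := by
  set e : ℕ → Ω → ℝ := fun s => ε (s + 1) with he
  have hT0 : (0 : ℝ) < T := by exact_mod_cast hT
  have h01 (w : Ω) : productMoment P x σ μ₀ φ₀ 0 1 T w =
      -((σ ^ 2)⁻¹ * (Real.sqrt T)⁻¹ * scoreSum φ₀ e T w) := by
    have h0 (s : ℕ) : ∫ w, ε (s + 1) w * arProc φ₀ e s w ∂P = 0 := by
      have h := H.integral_mul (X := arProc φ₀ e s) (g := fun x => x) (measurable_arProc s)
        measurable_id
      rw [H.mean, mul_zero] at h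
      simp only [mul_comm] at h ⊢
      exact h
    simp only [productMoment, sum_Icc_one_eq, residualDeriv_zero hx, residualDeriv_one hx,
      mul_neg, integral_neg, ← he, h0, neg_zero, sub_zero, Finset.sum_neg_distrib]
    rfl
  set m : ℝ := ∑ s ∈ Finset.range T, ∫ w, arProc φ₀ e s w ^ 2 ∂P with hm
  have h11 (w : Ω) : productMoment P x σ μ₀ φ₀ 1 1 T w =
      (σ ^ 2)⁻¹ * (Real.sqrt T)⁻¹ * (sqSum φ₀ e T w - m) := by
    simp only [productMoment, sum_Icc_one_eq, residualDeriv_one hx, ← he,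
      Finset.sum_sub_distrib, ← pow_two, neg_sq]
    rfl
  have hr : (Real.sqrt T)⁻¹ * (Real.sqrt T)⁻¹ = (T : ℝ)⁻¹ := by
    rw [← mul_inv, Real.mul_self_sqrt hT0.le]
  have hV := H.memLp_scoreSum hφ T
  have i1 : Integrable (fun w => (sqSum φ₀ e T w - T * statVar φ₀ σ) * scoreSum φ₀ e T w) P :=
    integrable_mul_of_sq ((H.memLp_sqSum hφ T).sub (memLp_const _)) hV
  have hexp (w : Ω) : productMoment P x σ μ₀ φ₀ 1 1 T w * productMoment P x σ μ₀ φ₀ 0 1 T w =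
      -((σ ^ 2)⁻¹ ^ 2 * (T : ℝ)⁻¹) * ((sqSum φ₀ e T w - T * statVar φ₀ σ) * scoreSum φ₀ e T w +
        (T * statVar φ₀ σ - m) * scoreSum φ₀ e T w) := by
    rw [h01, h11, ← hr]
    ring
  unfold exactG
  simp only [hexp]
  rw [integral_const_mul, integral_add i1 ((hV.integrable one_le_two).const_mul _),
    integral_const_mul, H.integral_scoreSum hφ]
  ring

theorem tendsto_mul_exactIntrinsicBias (hσ : 0 < σ) (H : IsInnovation P (fun s => ε (s + 1)) σ)
    (hφ : |φ₀| < 1) (hx : ∀ w t, x w t = observation 0 μ₀ φ₀ (fun s => ε s w) t) :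
    Tendsto (fun T : ℕ => (T : ℝ) * exactIntrinsicBias P x σ μ₀ φ₀ T) atTop (𝓝 (-2 * φ₀)) := by
  have h1 := one_sub_sq_pos hφ
  have h := (((H.tendsto_integral_sqSum_mul_scoreSum hφ).const_mul ((σ ^ 2)⁻¹ ^ 2)).neg).const_mul
    ((1 - φ₀ ^ 2) ^ 2)
  have hval : (1 - φ₀ ^ 2) ^ 2 * -((σ ^ 2)⁻¹ ^ 2 * (2 * φ₀ * statVar φ₀ σ ^ 2)) = -2 * φ₀ := by
    rw [statVar]; field_simp
  rw [hval] at h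
  refine h.congr' ?_
  filter_upwards [eventually_ge_atTop 1] with T hT
  have hT0 : (T : ℝ) ≠ 0 := by positivity
  rw [exactIntrinsicBias, exactF_eq_zero hx, exactC_eq_zero hx, ← exactG_eq H hφ hx hT,
    coefA_eq hφ, inv_inv]
  generalize exactG P x σ μ₀ φ₀ T = g
  field_simp
  ring

theorem exists_pos_le_one_sub {Φ : Set ℝ} (hΦc : IsCompact Φ) (hΦ : ∀ φ ∈ Φ, |φ| < 1) :
    ∃ κ, 0 < κ ∧ ∀ φ ∈ Φ, κ ≤ 1 - φ := by
  rcases Φ.eq_empty_or_nonempty with rfl | hne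
  · exact ⟨1, one_pos, by simp⟩
  obtain ⟨m, hm, hmax⟩ := hΦc.exists_isMaxOn hne continuousOn_id
  refine ⟨1 - m, by linarith [(abs_lt.1 (hΦ m hm)).2], fun φ hφ => ?_⟩
  have : φ ≤ m := hmax hφ
  linarith

/-- The derivative of the profile objective at the true parameter. -/
theorem hasDerivAt_profileObj (hx : ∀ w t, x w t = observation 0 μ₀ φ₀ (fun s => ε s w) t)
    (hφ : |φ₀| < 1) (w : Ω) {T : ℕ} (hT : 2 ≤ T) :
    HasDerivAt (fun φ => profileObj T (x w) 0 φ) (-scoreSum φ₀ (fun s => ε (s + 1)) T w -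
      1 / 2 * sampleGainDeriv φ₀ (fun s => ε (s + 1)) T w φ₀) φ₀ := by
  obtain ⟨M, _, hM⟩ := exists_c2Bound_levelGain (convex_singleton φ₀) (κ := 1 - φ₀)
    (by rintro _ rfl; exact hφ.le) (by linarith [(abs_lt.1 hφ).2]) (by rintro _ rfl; exact le_rfl)
  have hT' : (2 : ℝ) ≤ T := by exact_mod_cast hT
  simp only [profileObj_eq hx w hT]
  exact (hasDerivAt_sampleObj _ T w).sub
    (((hM ((T : ℝ) - 1) _ _ _ (by linarith)).hasDerivAt φ₀ rfl).const_mul (1 / 2))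

theorem tendsto_mul_exactScoreBias (hσ : 0 < σ) (H : IsInnovation P (fun s => ε (s + 1)) σ)
    (hφ : |φ₀| < 1) (hx : ∀ w t, x w t = observation 0 μ₀ φ₀ (fun s => ε s w) t) :
    Tendsto (fun T : ℕ => (T : ℝ) * exactScoreBias P x σ φ₀ T) atTop (𝓝 (-(1 + φ₀))) := by
  have h1 := one_sub_sq_pos hφ
  have hp : 0 < 1 - φ₀ := by linarith [(abs_lt.1 hφ).2]
  have h := ((H.tendsto_integral_sampleGainDeriv hφ).const_mul ((1 - φ₀ ^ 2) * (σ ^ 2)⁻¹))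
  have hval : (1 - φ₀ ^ 2) * (σ ^ 2)⁻¹ * (-σ ^ 2 / (1 - φ₀)) = -(1 + φ₀) := by
    field_simp
    ring
  rw [hval] at h
  refine h.congr' ?_
  filter_upwards [eventually_ge_atTop 2] with T hT
  have hT0 : (T : ℝ) ≠ 0 := by positivity
  rw [exactScoreBias, coefA_eq hφ, inv_inv]
  simp only [(hasDerivAt_profileObj hx hφ _ hT).deriv]
  rw [integral_sub (by exact ((H.memLp_scoreSum hφ T).integrable one_le_two).neg)
    ((H.integrable_sampleGainDeriv hφ T).const_mul _), integral_neg, H.integral_scoreSum hφ]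
  field_simp
  ring

/-! ### The bias of the estimators -/

/-- The bias of a minimiser of a perturbed sum of squares. -/
theorem tendsto_mul_bias (hσ : 0 < σ) {e : ℕ → Ω → ℝ} (H : IsInnovation P e σ) (hφ : |φ₀| < 1)
    {Φ : Set ℝ} (hΦv : Convex ℝ Φ) (hΦ : ∀ φ ∈ Φ, |φ| < 1) (hφ₀ : φ₀ ∈ interior Φ)
    {est : ℕ → Ω → ℝ} {q : ℕ → Ω → ℝ → ℝ} {R r : ℕ → Ω → ℝ → ℝ} {K : ℕ → Ω → ℝ} {ρ : ℝ}
    (hest : ∀ T, 2 ≤ T → IsArgmin P Φ (q T) (est T))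
    (hq : ∀ T, 2 ≤ T → ∃ c > 0, ∀ w, ∀ φ ∈ Φ, c * q T w φ = sampleObj φ₀ e T w φ - R T w φ)
    (hK : L2Bounded P K) (hR : ∀ T, 2 ≤ T → ∀ w, C2Bound Φ (R T w) (r T w) (K T w))
    (hr : ∀ T, Integrable (fun w => r T w φ₀) P)
    (hρ : Tendsto (fun T => ∫ w, r T w φ₀ ∂P) atTop (𝓝 ρ)) :
    Tendsto (fun T : ℕ => (T : ℝ) * bias P φ₀ (est T)) atTop
      (𝓝 (ρ / statVar φ₀ σ - 2 * φ₀)) := by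
  have hA : 0 < statVar φ₀ σ := div_pos (by positivity) (one_sub_sq_pos hφ)
  obtain ⟨δ₀, hδ₀, hball⟩ := Metric.mem_nhds_iff.1 (mem_interior_iff_mem_nhds.1 hφ₀)
  have hlim := tendsto_mul_integral_of_approxRoot hA hδ₀ (θ := fun T w => est T w - φ₀)
    (by
      filter_upwards [eventually_ge_atTop 2] with T hT
      exact (hest T hT).1.sub_const φ₀)
    (H.sqUI_scoreSum hφ) (H.integral_scoreSum hφ) (H.sqUI_sqSum_sub hφ) hK hr hρ
    (H.tendsto_integral_sqSum_mul_scoreSum hφ) (by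
      filter_upwards [eventually_ge_atTop 2] with T hT
      obtain ⟨c, hc, hcq⟩ := hq T hT
      filter_upwards [(hest T hT).2] with w hw
      refine approxRoot_of_isMinOn hΦv (fun φ h => (hΦ φ h).le) hδ₀ hball (hR T hT w)
        (q := fun φ => c * q T w φ) (c := 1 / 2 * innovSq e T w) (fun φ h => ?_) hw.1 ?_
      · rw [hcq w φ h, sampleObj, add_sub_cancel]
      · intro φ h
        exact mul_le_mul_of_nonneg_left (hw.2 h) hc.le)
  have hval : ρ / statVar φ₀ σ - 2 * φ₀ * statVar φ₀ σ ^ 2 / statVar φ₀ σ ^ 2 =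
      ρ / statVar φ₀ σ - 2 * φ₀ := by
    rw [mul_div_cancel_right₀ _ (by positivity)]
  rw [hval] at hlim
  refine hlim.congr' ?_
  filter_upwards [eventually_ge_atTop 2] with T hT
  have hi : Integrable (est T) P := by
    refine Integrable.of_bound (hest T hT).1.aestronglyMeasurable 1 ?_
    filter_upwards [(hest T hT).2] with w hw
    exact (hΦ _ hw.1).le
  rw [bias, integral_sub hi (integrable_const _)]
  simp

theorem isLittleO_of_tendsto_mul {b a : ℕ → ℝ} {c : ℝ}
    (hb : Tendsto (fun T : ℕ => (T : ℝ) * b T) atTop (𝓝 c))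
    (ha : ∀ T : ℕ, 1 ≤ T → (T : ℝ) * a T = c) :
    (fun T => b T - a T) =o[atTop] fun T : ℕ => (T : ℝ)⁻¹ := by
  rw [isLittleO_iff_tendsto' (by
    filter_upwards [eventually_ge_atTop 1] with T hT h
    have : (T : ℝ) ≠ 0 := by positivity
    exact absurd h (inv_ne_zero this))]
  have h := hb.sub_const c
  rw [sub_self] at h
  refine h.congr' ?_
  filter_upwards [eventually_ge_atTop 1] with T hT
  rw [← ha T hT, div_inv_eq_mul]
  ring

end

end FracBias

theorem corollary3 {Ω : Type*} [MeasurableSpace Ω] (P : Measure Ω) [IsProbabilityMeasure P]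
    -- parameters: level, autoregressive coefficient, innovation standard deviation
    (μ₀ φ₀ σ₀ : ℝ) (hσ₀ : 0 < σ₀)
    -- parameter space: compact and convex, with `ω(·;φ)` absolutely summable, `φ₀` interior
    (Φ : Set ℝ) (hΦc : IsCompact Φ) (hΦv : Convex ℝ Φ) (hΦ : ∀ φ ∈ Φ, |φ| < 1)
    (hφ₀ : φ₀ ∈ interior Φ)
    -- the innovations `ε 1, ε 2, …` are iid(0, σ₀²) with finite fourth moments
    (ε : ℕ → Ω → ℝ) (hmeas : ∀ t, 1 ≤ t → Measurable (ε t))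
    (hindep : iIndepFun (fun t : ℕ => ε (t + 1)) P)
    (hident : ∀ t, 1 ≤ t → IdentDistrib (ε t) (ε 1) P P)
    (hmom : MemLp (ε 1) 4 P) (hmean : ∫ w, ε 1 w ∂P = 0) (hvar : ∫ w, ε 1 w ^ 2 ∂P = σ₀ ^ 2)
    -- the observations: memory parameter `d₀ = 0`
    (x : Ω → ℕ → ℝ)
    (hx : ∀ w t, x w t = FracBias.observation 0 μ₀ φ₀ (fun s => ε s w) t) :
    -- the bias expressions
    (∀ T : ℕ, 1 ≤ T → (T : ℝ) * FracBias.approxIntrinsicBias φ₀ T = -2 * φ₀) ∧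
    (∀ T : ℕ, 1 ≤ T → (T : ℝ) * FracBias.approxScoreBias φ₀ T = -(1 + φ₀)) ∧
    -- they are the limits of the exact ones
    Tendsto (fun T : ℕ => (T : ℝ) * FracBias.exactIntrinsicBias P x σ₀ μ₀ φ₀ T) atTop
      (𝓝 (-2 * φ₀)) ∧
    Tendsto (fun T : ℕ => (T : ℝ) * FracBias.exactScoreBias P x σ₀ φ₀ T) atTop
      (𝓝 (-(1 + φ₀))) ∧
    -- the CSS estimator with unknown level
    (∀ est : ℕ → Ω → ℝ,
      (∀ T, 2 ≤ T →
        FracBias.IsArgmin P Φ (fun w φ => FracBias.profileObj T (x w) 0 φ) (est T)) →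
      (fun T : ℕ => FracBias.bias P φ₀ (est T) -
          (FracBias.approxScoreBias φ₀ T + FracBias.approxIntrinsicBias φ₀ T))
        =o[atTop] (fun T : ℕ => (T : ℝ)⁻¹)) ∧
    -- the CSS estimator with known level
    (∀ est : ℕ → Ω → ℝ,
      (∀ T, 2 ≤ T →
        FracBias.IsArgmin P Φ (fun w φ => FracBias.knownLevelObj μ₀ T (x w) 0 φ) (est T)) →
      (fun T : ℕ => FracBias.bias P φ₀ (est T) - FracBias.approxIntrinsicBias φ₀ T)
        =o[atTop] (fun T : ℕ => (T : ℝ)⁻¹)) ∧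
    -- the MCSS estimator
    (∀ est : ℕ → Ω → ℝ,
      (∀ T, 2 ≤ T →
        FracBias.IsArgmin P Φ (fun w φ => FracBias.modifiedObj T (x w) 0 φ) (est T)) →
      (fun T : ℕ => FracBias.bias P φ₀ (est T) - FracBias.approxIntrinsicBias φ₀ T)
        =o[atTop] (fun T : ℕ => (T : ℝ)⁻¹) ∧
      (fun T : ℕ => FracBias.bias P φ₀ (est T) - (-2 * φ₀ / (T : ℝ)))
        =o[atTop] (fun T : ℕ => (T : ℝ)⁻¹)) := by
  have hφ : |φ₀| < 1 := hΦ φ₀ (interior_subset hφ₀)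
  have hp : 0 < 1 - φ₀ := by linarith [(abs_lt.1 hφ).2]
  have hs := FracBias.one_sub_sq_pos hφ
  obtain ⟨κ, hκ, hΦκ⟩ := FracBias.exists_pos_le_one_sub hΦc hΦ
  have hΦ1 : ∀ φ ∈ Φ, |φ| ≤ 1 := fun φ h => (hΦ φ h).le
  have H : FracBias.IsInnovation P (fun s => ε (s + 1)) σ₀ :=
    ⟨fun t => hmeas (t + 1) (by omega), hindep, fun t => hident (t + 1) (by omega), hmom, hmean,
      hvar⟩
  have hscore : -σ₀ ^ 2 / (1 - φ₀) / FracBias.statVar φ₀ σ₀ - 2 * φ₀ =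
      -(1 + φ₀) + -2 * φ₀ := by
    rw [FracBias.statVar]
    field_simp
    ring
  refine ⟨fun T hT => FracBias.mul_approxIntrinsicBias hφ hT,
    fun T hT => FracBias.mul_approxScoreBias hφ hT,
    FracBias.tendsto_mul_exactIntrinsicBias hσ₀ H hφ hx,
    FracBias.tendsto_mul_exactScoreBias hσ₀ H hφ hx, fun est hest => ?_, fun est hest => ?_,
    fun est hest => ?_⟩
  · obtain ⟨K, hK, hR⟩ := H.exists_c2Bound_sampleGain hφ hΦv hΦ1 hκ hΦκ
    have h := FracBias.tendsto_mul_bias hσ₀ H hφ hΦv hΦ hφ₀ hest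
      (fun T hT => ⟨1, one_pos, fun w φ _ => by rw [one_mul, FracBias.profileObj_eq hx w hT]⟩)
      hK hR (fun T => (H.integrable_sampleGainDeriv hφ T).const_mul _)
      (H.tendsto_integral_sampleGainDeriv hφ)
    rw [hscore] at h
    refine FracBias.isLittleO_of_tendsto_mul h fun T hT => ?_
    rw [mul_add, FracBias.mul_approxScoreBias hφ hT, FracBias.mul_approxIntrinsicBias hφ hT]
  · have h := FracBias.tendsto_mul_bias hσ₀ H hφ hΦv hΦ hφ₀ hest (R := fun _ _ _ => 0)
      (r := fun _ _ _ => 0) (K := fun _ _ => 0) (ρ := 0)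
      (fun T hT => ⟨1, one_pos, fun w φ _ => by
        rw [one_mul, FracBias.knownLevelObj_eq hx w, sub_zero]⟩)
      (FracBias.L2Bounded.const (memLp_const 0))
      (fun T _ w => ⟨le_rfl, fun y _ => hasDerivAt_const y 0, by simp, by simp, by simp⟩)
      (fun T => integrable_const 0) (by simp)
    rw [zero_div, zero_sub, ← neg_mul] at h
    exact FracBias.isLittleO_of_tendsto_mul h fun T hT => FracBias.mul_approxIntrinsicBias hφ hT
  · obtain ⟨K, hK, hR⟩ := H.exists_c2Bound_modifiedGain hφ hΦv hΦ1 hκ hΦκ (interior_subset hφ₀)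
    have h := FracBias.tendsto_mul_bias hσ₀ H hφ hΦv hΦ hφ₀ hest
      (fun T hT => ⟨_, inv_pos.2 (FracBias.modification_pos hT φ₀), fun w φ _ =>
        FracBias.modifiedObj_eq hx w hT φ⟩)
      hK hR (fun T => H.integrable_modifiedGainDeriv hφ T)
      (H.tendsto_integral_modifiedGainDeriv hφ)
    rw [zero_div, zero_sub, ← neg_mul] at h
    refine ⟨FracBias.isLittleO_of_tendsto_mul h fun T hT =>
      FracBias.mul_approxIntrinsicBias hφ hT, FracBias.isLittleO_of_tendsto_mul h fun T hT => ?_⟩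
    have : (T : ℝ) ≠ 0 := by positivity
    field_simp
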